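/- Let $W=(W(t))_{t\ge 0}$ be a Wiener process (standard one-dimensional Brownian motion). For $T,r>0$ let $$I_W(T,r)=\inf\Big\{\Big(\int_0^T h'(t)^2\,dt\Big)^{1/2}:\ h \text{ absolutely continuous on } [0,T],\ h(0)=0,\ \sup_{0\le t\le T}|h(t)-W(t)|\le r\Big\}.$$ Let $R=\max_{0\le s\le 1}W(s)-\min_{0\le t\le 1}W(t)$ be the range of $W$ on $[0,1]$ and, for $x>0$, put $Y_x=(R-2x)_+=\max(R-2x,0)$. There is a constant $\mathcal C$, the same for all Wiener processes, such that the random variables $I_W(T,r)$ are almost surely finite and have finite moments of all orders, for every $q>0$ $$\mathbb E\Big|\frac{r}{\sqrt T}\,I_W(T,r)-\mathcal C\Big|^q\to 0\qquad\text{as } \frac{r}{\sqrt T}\to 0,$$ and this constant satisfies the following lower bounds. 1. For every $x>0$, $\mathbb E\,Y_x^2<\infty$ and $$\mathcal C^2\ \ge\ x^2\,\mathbb E\,Y_x^2\ >\ 0 .$$ In particular $\mathcal C>0$. 2. Numerically, there is an $x\in[0.45,0.55]$ with $0.381\le x\sqrt{\mathbb E\,Y_x^2}\le 0.3815$. Hence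 $\mathcal C\ge 0.381$. -/

import Mathlib

open MeasureTheory ProbabilityTheory
open scoped NNReal ENNReal

namespace TautString

noncomputable section

/-- The energy `∫₀ᵀ h'(t)² dt`, as an element of `[0, ∞]`. -/
def energy (T : ℝ) (h : ℝ → ℝ) : ℝ≥0∞ :=
  ∫⁻ t in Set.Icc 0 T, ENNReal.ofReal (deriv h t ^ 2)

/-- `h` is absolutely continuous on `[0, T]`, starts at `0`, and stays within uniform distance `r`
of the path `w` on `[0, T]`. -/
def Admissible (w : ℝ≥0 → ℝ) (T r : ℝ) (h : ℝ → ℝ) : Prop :=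
  AbsolutelyContinuousOnInterval h 0 T ∧ h 0 = 0 ∧
    ∀ t : ℝ≥0, (t : ℝ) ≤ T → |h t - w t| ≤ r

/-- `I_w(T, r)`: the infimum, in `[0, ∞]`, of the norms `(∫₀ᵀ h'(t)² dt)^(1/2)` over the admissible
functions `h`. -/
def minNorm (w : ℝ≥0 → ℝ) (T r : ℝ) : ℝ≥0∞ :=
  ⨅ (h : ℝ → ℝ) (_ : Admissible w T r h), energy T h ^ (1 / 2 : ℝ)

/-- `C` is the constant for which `(r / √T) * I_W(T, r)` converges to `C` in `L_q`, for every
`q > 0`, as `r / √T → 0`. The random variables `I_W(T, r)` are required to be almost surely finite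
and to lie in `L_q` (in particular they are almost everywhere measurable). -/
def IsEnergyConstant {Ω : Type*} [MeasurableSpace Ω] (W : ℝ≥0 → Ω → ℝ) (P : Measure Ω)
    (C : ℝ) : Prop :=
  (∀ T > 0, ∀ r > 0, ∀ᵐ ω ∂P, minNorm (W · ω) T r < ∞) ∧
  ∀ q : ℝ, 0 < q →
    (∀ T > 0, ∀ r > 0, MemLp (fun ω ↦ (minNorm (W · ω) T r).toReal) (ENNReal.ofReal q) P) ∧
    ∀ δ : ℝ, 0 < δ → ∃ η : ℝ, 0 < η ∧ ∀ T > 0, ∀ r > 0, r / √T < η →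
      eLpNorm (fun ω ↦ r / √T * (minNorm (W · ω) T r).toReal - C) (ENNReal.ofReal q) P
        ≤ ENNReal.ofReal δ

/-- The range `max_{0 ≤ s ≤ 1} w(s) - min_{0 ≤ t ≤ 1} w(t)` of a path on the unit interval. -/
def range (w : ℝ≥0 → ℝ) : ℝ :=
  (⨆ s : Set.Icc (0 : ℝ≥0) 1, w s) - ⨅ t : Set.Icc (0 : ℝ≥0) 1, w t

/-- `Y_x = (R - 2x)_+`, with `R` the range of the path on the unit interval. -/
def excess (w : ℝ≥0 → ℝ) (x : ℝ) : ℝ :=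
  max (range w - 2 * x) 0

end

end TautString

namespace TautString

noncomputable section

open Filter Topology

/-! ### Versions of Brownian motion with regular paths. -/

variable {Ω : Type*} {mΩ : MeasurableSpace Ω} {P : Measure Ω} {W : ℝ≥0 → Ω → ℝ}

/-! Existence of the constant. By Brownian scaling, I_W(T, r)² has the law of the minimal energy
e(S) in the tube of radius 1 over [0, S], where S = T / r². So it suffices that e(S) / S converges
in every L_p to a constant c; then C = √c. Cutting time into blocks, the energy with free end points
is superadditive (`tubeEnergy_add_le`), while the energy with both end points pinned to the path is
subadditive (`bridgeEnergy_add_le`). A cut-off argument bounds the pinned energy by (1 + ε) times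
the free one plus a cost paid only in two unit strips at the ends
(`bridgeEnergy_le_tubeEnergy_add`). That cost is a multiple of `oscCost`, which measures how fine a
dyadic grid must be for the path to oscillate little on its cells; all its moments are finite, and
its mean over [0, n] is o(n). Terms from different blocks are pairwise independent and identically
distributed. For a fixed block length ℓ the L_p law of large numbers therefore squeezes e(S) / S
between m_ℓ / ℓ and (1 + ε) m_ℓ / ℓ plus a term that vanishes as ℓ grows, where m_ℓ is the mean free
energy. Fekete's lemma gives m_ℓ / ℓ → c. Since m_ℓ depends only on the law on path space, c is
universal. Measurability of the uncountable infima comes from a countable L²-dense family of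
derivatives.

Lower bound. In a tube of radius x over a unit interval, any function must vary by at least R - 2x
between the times of the extrema, so by Cauchy–Schwarz its energy is at least Y_x². Superadditivity
over n unit blocks and scaling turn this into x² E Y_x² ≤ c.

Numerical value. E (R - 2x)₊² is an iterated integral of P(max > a, -min > L - a). Repeated
reflection shows that the probability of alternating k times between two levels is a Gaussian tail,
and inclusion–exclusion over which level comes first expresses the joint probability by an
alternating series. Its truncations are Bonferroni bounds; integrated, they bound E (R - c)₊² by
combinations of E (|N| - kc)₊². These reduce to integrals over compact intervals, enclosed by
alternating Taylor sums. -/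

/-- A Brownian motion all of whose paths are continuous and start at `0`, with measurable
coordinates. -/
structure IsNiceBrownian {Ω : Type*} {mΩ : MeasurableSpace Ω} (W : ℝ≥0 → Ω → ℝ)
    (P : Measure Ω) : Prop extends IsPreBrownianReal W P where
  cont : ∀ ω, Continuous (W · ω)
  zero : ∀ ω, W 0 ω = 0
  meas : ∀ t, Measurable (W t)

/-- The coordinates of `W` are only almost everywhere measurable. Measurable versions are taken at
countably many dense times, so that one measurable null set contains all the bad paths, which are
set to zero; at other times measurability passes to the limit by continuity. -/
lemma exists_isNiceBrownian (hB : IsBrownianReal W P) :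
    ∃ V : ℝ≥0 → Ω → ℝ, IsNiceBrownian V P ∧ ∀ᵐ ω ∂P, ∀ t, V t ω = W t ω := by
  classical
  set D : ℕ → ℝ≥0 := TopologicalSpace.denseSeq ℝ≥0
  have hD : DenseRange D := TopologicalSpace.denseRange_denseSeq _
  have hae : ∀ᵐ ω ∂P, Continuous (W · ω) ∧ W 0 ω = 0 ∧
      ∀ n, W (D n) ω = (hB.aemeasurable (D n)).mk _ ω := by
    filter_upwards [hB.cont, hB.eval_zero_ae_eq_zero,
      ae_all_iff.2 fun n ↦ (hB.aemeasurable (D n)).ae_eq_mk] with ω h1 h2 h3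
    exact ⟨h1, h2, h3⟩
  obtain ⟨G, hGsub, hGm, hG0⟩ := exists_measurable_superset_of_null (ae_iff.1 hae)
  have hG : ∀ ω ∈ Gᶜ, Continuous (W · ω) ∧ W 0 ω = 0 ∧
      ∀ n, W (D n) ω = (hB.aemeasurable (D n)).mk _ ω := by
    intro ω hω
    by_contra h
    exact hω (hGsub h)
  let V : ℝ≥0 → Ω → ℝ := fun t ω ↦ Gᶜ.indicator (fun ω ↦ W t ω) ω
  have hVW : ∀ᵐ ω ∂P, ∀ t, V t ω = W t ω := by
    filter_upwards [compl_mem_ae_iff.2 hG0] with ω hω t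
    exact Set.indicator_of_mem hω _
  have hVc : ∀ ω, Continuous (V · ω) := by
    intro ω
    by_cases hω : ω ∈ Gᶜ
    · simp only [V, Set.indicator_of_mem hω]
      exact (hG ω hω).1
    · simp only [V, Set.indicator_of_notMem hω]
      exact continuous_const
  have hVD : ∀ n, Measurable (V (D n)) := by
    intro n
    have : V (D n) = Gᶜ.indicator ((hB.aemeasurable (D n)).mk _) := by
      ext ω
      by_cases hω : ω ∈ Gᶜ
      · simp only [V, Set.indicator_of_mem hω, (hG ω hω).2.2 n]
      · simp only [V, Set.indicator_of_notMem hω]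
    rw [this]
    exact (hB.aemeasurable (D n)).measurable_mk.indicator hGm.compl
  refine ⟨V, ?_, hVW⟩
  have hVB : IsPreBrownianReal V P := hB.toIsPreBrownianReal.congr fun t ↦ by
    filter_upwards [hVW] with ω hω using (hω t).symm
  refine ⟨hVB, hVc, ?_, ?_⟩
  · intro ω
    by_cases hω : ω ∈ Gᶜ
    · simp only [V, Set.indicator_of_mem hω, (hG ω hω).2.1]
    · simp only [V, Set.indicator_of_notMem hω]
  · intro t
    have : ∃ u : ℕ → ℕ, Tendsto (fun k ↦ D (u k)) atTop (𝓝 t) := by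
      have h1 : t ∈ closure (Set.range D) := hD t
      obtain ⟨x, hx, hxt⟩ := mem_closure_iff_seq_limit.1 h1
      choose u hu using hx
      exact ⟨u, by simpa only [hu] using hxt⟩
    obtain ⟨u, hu⟩ := this
    refine measurable_of_tendsto_metrizable (fun k ↦ hVD (u k)) ?_
    rw [tendsto_pi_nhds]
    intro ω
    exact ((hVc ω).tendsto t).comp hu

namespace IsNiceBrownian

lemma isProbabilityMeasure (hW : IsNiceBrownian W P) : IsProbabilityMeasure P :=
  hW.isGaussianProcess.isProbabilityMeasure

lemma measurable_path (hW : IsNiceBrownian W P) : Measurable fun ω ↦ (W · ω) :=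
  measurable_pi_lambda _ hW.meas

lemma shift (hW : IsNiceBrownian W P) (t₀ : ℝ≥0) :
    IsNiceBrownian (fun t ω ↦ W (t₀ + t) ω - W t₀ ω) P where
  toIsPreBrownianReal := hW.toIsPreBrownianReal.shift t₀
  cont ω := by
    have := hW.cont ω
    fun_prop
  zero ω := by simp
  meas t := (hW.meas _).sub (hW.meas _)

lemma smul (hW : IsNiceBrownian W P) {c : ℝ≥0} (hc : c ≠ 0) :
    IsNiceBrownian (fun t ω ↦ (√c)⁻¹ * W (c * t) ω) P where
  toIsPreBrownianReal := hW.toIsPreBrownianReal.smul hc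
  cont ω := by
    have := hW.cont ω
    fun_prop
  zero ω := by simp [hW.zero]
  meas t := (hW.meas _).const_mul _

lemma neg (hW : IsNiceBrownian W P) : IsNiceBrownian (-W) P where
  toIsPreBrownianReal := hW.toIsPreBrownianReal.neg
  cont ω := by
    have := hW.cont ω
    simpa [← Pi.neg_def, continuous_neg_iff]
  zero ω := by simp [hW.zero]
  meas t := (hW.meas _).neg

end IsNiceBrownian

/-! ### The reflection principle. -/

/-- All pre-Brownian motions have the same law on path space. -/
lemma map_path_eq {Ω' : Type*} {mΩ' : MeasurableSpace Ω'} {Q : Measure Ω'} {V : ℝ≥0 → Ω' → ℝ}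
    (hW : IsPreBrownianReal W P) (hV : IsPreBrownianReal V Q)
    (mW : Measurable fun ω ↦ (W · ω)) (mV : Measurable fun ω ↦ (V · ω)) :
    P.map (fun ω ↦ (W · ω)) = Q.map (fun ω ↦ (V · ω)) := by
  have hP := hW.isGaussianProcess.isProbabilityMeasure
  have hQ := hV.isGaussianProcess.isProbabilityMeasure
  have h1 := isProjectiveLimit_map (X := W) (P := P) mW.aemeasurable
  have h2 := isProjectiveLimit_map (X := V) (P := Q) mV.aemeasurable
  have : (fun I : Finset ℝ≥0 ↦ P.map (fun ω ↦ I.restrict (W · ω))) =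
      fun I : Finset ℝ≥0 ↦ Q.map (fun ω ↦ I.restrict (V · ω)) := by
    funext I
    rw [(hW.hasLaw I).map_eq, (hV.hasLaw I).map_eq]
  rw [this] at h1
  exact h1.unique h2

lemma IsNiceBrownian.map_path_eq {Ω' : Type*} {mΩ' : MeasurableSpace Ω'} {Q : Measure Ω'}
    {V : ℝ≥0 → Ω' → ℝ} (hW : IsNiceBrownian W P) (hV : IsNiceBrownian V Q) :
    P.map (fun ω ↦ (W · ω)) = Q.map (fun ω ↦ (V · ω)) :=
  TautString.map_path_eq hW.toIsPreBrownianReal hV.toIsPreBrownianReal hW.measurable_path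
    hV.measurable_path

/-- The path reflected at time `t₀`. -/
def reflectAt (t₀ : ℝ≥0) (w : ℝ≥0 → ℝ) (t : ℝ≥0) : ℝ :=
  if t ≤ t₀ then w t else 2 * w t₀ - w t

lemma measurable_reflectAt (t₀ : ℝ≥0) : Measurable (reflectAt t₀) := by
  refine measurable_pi_lambda _ fun t ↦ ?_
  unfold reflectAt
  split_ifs <;> fun_prop

/-- Each reflected coordinate is a linear combination of at most two coordinates of `W`, so the
process stays Gaussian, and only mean and covariance have to be checked. -/
lemma isPreBrownianReal_reflectAt (hB : IsPreBrownianReal W P) (t₀ : ℝ≥0) :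
    IsPreBrownianReal (fun t ω ↦ reflectAt t₀ (W · ω) t) P := by
  have hP := hB.isGaussianProcess.isProbabilityMeasure
  have hL : ∀ t, MemLp (W t) 2 P := fun t ↦ (hB.isGaussianProcess.hasGaussianLaw_eval t).memLp_two
  refine IsGaussianProcess.isPreBrownianReal_of_covariance ?_ ?_ ?_
  · apply hB.isGaussianProcess.of_isGaussianProcess
    intro t
    by_cases h : t ≤ t₀
    · exact ⟨{t}, 
        { toFun x := x ⟨t, by simp⟩
          map_add' x y := by simp
          map_smul' c x := by simp }, by simp [reflectAt, h]⟩
    · exact ⟨{t₀, t},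
        { toFun x := 2 * x ⟨t₀, by simp⟩ - x ⟨t, by simp⟩
          map_add' x y := by simp; ring
          map_smul' c x := by simp; ring }, by simp [reflectAt, h]⟩
  · intro t
    unfold reflectAt
    split_ifs
    · exact hB.integral_eval t
    · rw [integral_sub ((hB.integrable_eval t₀).const_mul 2) (hB.integrable_eval t),
        integral_const_mul, hB.integral_eval, hB.integral_eval]
      simp
  · intro s t hst
    have e : ∀ r, (fun ω ↦ reflectAt t₀ (W · ω) r) = 
        if r ≤ t₀ then W r else ((2 : ℝ) • W t₀ - W r) := by
      intro r; unfold reflectAt; split_ifs <;> rfl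
    rw [e, e]
    have h2 : MemLp ((2 : ℝ) • W t₀) 2 P := (hL t₀).const_smul 2
    by_cases hs : s ≤ t₀ <;> by_cases ht : t ≤ t₀
    · simp only [hs, ht, if_true]
      rw [hB.covariance_eval, min_eq_left hst]
    · simp only [hs, ht, if_true, if_false]
      rw [covariance_sub_right (hL s) h2 (hL t), covariance_smul_right,
        hB.covariance_eval, hB.covariance_eval, min_eq_left hst, min_eq_left hs]
      ring
    · exact absurd (hst.trans ht) hs
    · simp only [hs, ht, if_false]
      have hs' := (not_le.1 hs).le
      have ht' := (not_le.1 ht).le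
      rw [covariance_sub_right (h2.sub (hL s)) h2 (hL t), covariance_sub_left h2 (hL s) h2,
        covariance_sub_left h2 (hL s) (hL t), covariance_smul_right, covariance_smul_left,
        covariance_smul_left, covariance_smul_right,
        hB.covariance_eval, hB.covariance_eval, hB.covariance_eval, hB.covariance_eval,
        min_eq_left hst, min_self, min_eq_right hs', min_eq_left ht']
      ring

/-- Gluing measure preserving maps along a partition which they all respect. -/
lemma measurePreserving_of_fibers {X : Type*} [MeasurableSpace X] {μ : Measure X}
    {ρ : ℕ → X → X} (hρ : ∀ k, MeasurePreserving (ρ k) μ μ) {idx : X → ℕ} (hidx : Measurable idx)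
    (h : ∀ k w, idx (ρ k w) = k ↔ idx w = k) :
    MeasurePreserving (fun w ↦ ρ (idx w) w) μ μ := by
  -- By `h`, the fibre over `k` equals its own preimage under `ρ k`; the preimage of `S` under the
  -- glued map thus splits into preimages under single measure preserving maps.
  have key : ∀ S : Set X, (fun w ↦ ρ (idx w) w) ⁻¹' S =
      ⋃ k, ρ k ⁻¹' (idx ⁻¹' {k} ∩ S) := by
    intro S
    ext w
    simp only [Set.mem_preimage, Set.mem_iUnion, Set.mem_inter_iff, Set.mem_singleton_iff, h]
    exact ⟨fun hw ↦ ⟨idx w, rfl, hw⟩, fun ⟨k, hk, hw⟩ ↦ hk ▸ hw⟩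
  have hm : ∀ k, MeasurableSet (idx ⁻¹' {k}) := fun k ↦ hidx (measurableSet_singleton k)
  have hmeas : Measurable (fun w ↦ ρ (idx w) w) := by
    intro S hS
    rw [key]
    exact MeasurableSet.iUnion fun k ↦ (hρ k).measurable ((hm k).inter hS)
  refine ⟨hmeas, Measure.ext fun S hS ↦ ?_⟩
  rw [Measure.map_apply hmeas hS, key, measure_iUnion]
  · have : S = ⋃ k, idx ⁻¹' {k} ∩ S := by
      ext w; simp
    conv_rhs => rw [this]
    rw [measure_iUnion]
    · refine tsum_congr fun k ↦ ?_
      exact (hρ k).measure_preimage ((hm k).inter hS).nullMeasurableSet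
    · intro i j hij
      refine Set.disjoint_left.2 fun w hw hw' ↦ hij ?_
      exact hw.1.symm.trans hw'.1
    · exact fun k ↦ (hm k).inter hS
  · intro i j hij
    refine Set.disjoint_left.2 fun w hw hw' ↦ hij ?_
    have h1 := (h i w).1 hw.1
    have h2 := (h j w).1 hw'.1
    exact h1.symm.trans h2
  · exact fun k ↦ (hρ k).measurable ((hm k).inter hS)

lemma measurePreserving_reflectAt (hW : IsNiceBrownian W P) (t₀ : ℝ≥0) :
    MeasurePreserving (reflectAt t₀) (P.map fun ω ↦ (W · ω)) (P.map fun ω ↦ (W · ω)) := by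
  refine ⟨measurable_reflectAt t₀, ?_⟩
  rw [Measure.map_map (measurable_reflectAt t₀) hW.measurable_path]
  exact map_path_eq (W := fun t ω ↦ reflectAt t₀ (W · ω) t)
    (isPreBrownianReal_reflectAt hW.toIsPreBrownianReal t₀)
    hW.toIsPreBrownianReal ((measurable_reflectAt t₀).comp hW.measurable_path) hW.measurable_path

/-- The grid of mesh `1 / (n + 1)`. -/
def gridPt (n j : ℕ) : ℝ≥0 := j / (n + 1)

lemma gridPt_mono (n : ℕ) : Monotone (gridPt n) := by
  intro i j hij
  unfold gridPt
  gcongr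

open Classical in
/-- `j + 1` if `j` is the first index of a grid point at which the path exceeds `u`, and `0` if
there is no such index. -/
def gridIdx (n : ℕ) (u : ℝ) (w : ℝ≥0 → ℝ) : ℕ :=
  if h : ∃ j, u < w (gridPt n j) then Nat.find h + 1 else 0

lemma gridIdx_eq_succ {n : ℕ} {u : ℝ} {w : ℝ≥0 → ℝ} {j : ℕ} :
    gridIdx n u w = j + 1 ↔ u < w (gridPt n j) ∧ ∀ i < j, w (gridPt n i) ≤ u := by
  classical
  unfold gridIdx
  split_ifs with h
  · rw [Nat.add_right_cancel_iff, Nat.find_eq_iff]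
    simp
  · push Not at h
    exact ⟨fun h0 ↦ h0.elim, fun hh ↦ absurd hh.1 (not_lt.2 (h j))⟩

lemma gridIdx_eq_zero {n : ℕ} {u : ℝ} {w : ℝ≥0 → ℝ} :
    gridIdx n u w = 0 ↔ ∀ i, w (gridPt n i) ≤ u := by
  classical
  unfold gridIdx
  split_ifs with h
  · refine ⟨fun h0 ↦ h0.elim, fun h' ↦ ?_⟩
    obtain ⟨j, hj⟩ := h
    exact absurd hj (not_lt.2 (h' j))
  · push Not at h
    simpa using h

lemma measurable_gridIdx (n : ℕ) (u : ℝ) : Measurable (gridIdx n u) := by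
  refine measurable_to_countable' fun k ↦ ?_
  cases k with
  | zero =>
    have : gridIdx n u ⁻¹' {0} = ⋂ i, {w | w (gridPt n i) ≤ u} := by
      ext w; simp [gridIdx_eq_zero]
    rw [this]
    exact MeasurableSet.iInter fun i ↦ measurableSet_le (measurable_pi_apply _) measurable_const
  | succ j =>
    have : gridIdx n u ⁻¹' {j + 1} =
        {w | u < w (gridPt n j)} ∩ ⋂ i, ⋂ (_ : i < j), {w | w (gridPt n i) ≤ u} := by
      ext w; simp [gridIdx_eq_succ]
    rw [this]
    exact (measurableSet_lt measurable_const (measurable_pi_apply _)).inter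
      (MeasurableSet.iInter fun i ↦ MeasurableSet.iInter fun _ ↦
        measurableSet_le (measurable_pi_apply _) measurable_const)

/-- Reflection at the `k`-th possible value of `gridIdx`. -/
def reflectIdx (n : ℕ) : ℕ → (ℝ≥0 → ℝ) → ℝ≥0 → ℝ
  | 0 => id
  | j + 1 => reflectAt (gridPt n j)

/-- Reflection at a grid point does not alter the path up to and including that point, and these
values alone decide whether it is the first exceedance. -/
lemma gridIdx_reflectIdx (n : ℕ) (u : ℝ) (k : ℕ) (w : ℝ≥0 → ℝ) :
    gridIdx n u (reflectIdx n k w) = k ↔ gridIdx n u w = k := by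
  cases k with
  | zero => simp [reflectIdx]
  | succ j =>
    simp only [gridIdx_eq_succ, reflectIdx, reflectAt, le_refl, if_true]
    refine and_congr_right fun _ ↦ forall₂_congr fun i hi ↦ ?_
    rw [if_pos (gridPt_mono n hi.le)]

/-- The strong Markov property for a stopping time with values in a grid: reflection at each fixed
time preserves the law and respects the partition by the value of the stopping time. -/
lemma measurePreserving_gridReflect (hW : IsNiceBrownian W P) (n : ℕ) (u : ℝ) :
    MeasurePreserving (fun w ↦ reflectIdx n (gridIdx n u w) w)
      (P.map fun ω ↦ (W · ω)) (P.map fun ω ↦ (W · ω)) := by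
  refine measurePreserving_of_fibers (fun k ↦ ?_) (measurable_gridIdx n u)
    (gridIdx_reflectIdx n u)
  cases k with
  | zero => exact MeasurePreserving.id _
  | succ j => exact measurePreserving_reflectAt hW _

open Classical in
/-- The path reflected at the level `u` from the first time on at which it exceeds `u`. -/
def reflectHit (u : ℝ) (w : ℝ≥0 → ℝ) (t : ℝ≥0) : ℝ :=
  if ∃ s ≤ t, u < w s then 2 * u - w t else w t

lemma reflectHit_of_hit {u : ℝ} {w : ℝ≥0 → ℝ} {t : ℝ≥0} (h : ∃ s ≤ t, u < w s) :
    reflectHit u w t = 2 * u - w t := if_pos h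

lemma reflectHit_of_not_hit {u : ℝ} {w : ℝ≥0 → ℝ} {t : ℝ≥0} (h : ¬ ∃ s ≤ t, u < w s) :
    reflectHit u w t = w t := if_neg h

lemma exists_lt_hit {u : ℝ} {w : ℝ≥0 → ℝ} (hw : Continuous w) (h0 : w 0 ≤ u) {s : ℝ≥0}
    (hs : u < w s) : ∃ a < s, ∀ t, a < t → t ≤ s → u < w t := by
  have hs0 : 0 < s := by
    rcases eq_or_ne s 0 with rfl | h
    · exact absurd hs (not_lt.2 h0)
    · exact pos_iff_ne_zero.2 h
  have : {t | u < w t} ∈ 𝓝 s := (isOpen_lt continuous_const hw).mem_nhds hs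
  obtain ⟨a, ha, has⟩ := exists_Ioc_subset_of_mem_nhds this ⟨0, hs0⟩
  exact ⟨a, ha, fun t h1 h2 ↦ has ⟨h1, h2⟩⟩

lemma eventually_gridPt_lt_hit {u : ℝ} {w : ℝ≥0 → ℝ} (hw : Continuous w) (h0 : w 0 ≤ u)
    {s : ℝ≥0} (hs : u < w s) :
    ∀ᶠ n in atTop, ∃ j, gridIdx n u w = j + 1 ∧ gridPt n j < s := by
  classical
  obtain ⟨a, has, ha⟩ := exists_lt_hit hw h0 hs
  have hpos : 0 < s - a := tsub_pos_of_lt has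
  obtain ⟨N, hN⟩ := exists_nat_one_div_lt (NNReal.coe_pos.2 hpos)
  filter_upwards [eventually_ge_atTop N] with n hn
  have hn1 : (0 : ℝ) < (n : ℝ) + 1 := by positivity
  have hstep : 1 / ((n : ℝ) + 1) < (s : ℝ) - a := by
    refine lt_of_le_of_lt ?_ (hN.trans_eq (by rw [NNReal.coe_sub has.le]))
    gcongr
  have hs0 : (0 : ℝ) < s := lt_of_le_of_lt a.coe_nonneg (NNReal.coe_lt_coe.2 has)
  have hex : ∃ i, u < w (gridPt n i) ∧ gridPt n i < s := by
    -- `m` is the last grid index strictly before `s`, hence the ceiling minus one; its grid point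
    -- is within one mesh of `s`, so it lies beyond `a`.
    obtain ⟨m, hm⟩ : ∃ m, ⌈(s : ℝ) * (n + 1)⌉₊ = m + 1 :=
      Nat.exists_eq_succ_of_ne_zero (Nat.ceil_pos.2 (by positivity)).ne'
    have h1 : (m : ℝ) < s * (n + 1) := by
      have := Nat.ceil_lt_add_one (a := (s : ℝ) * (n + 1)) (by positivity)
      rw [hm] at this; push_cast at this; linarith
    have h2 : (s : ℝ) * (n + 1) ≤ m + 1 := by
      have := Nat.le_ceil ((s : ℝ) * (n + 1))
      rw [hm] at this; exact_mod_cast this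
    have e : ((gridPt n m : ℝ≥0) : ℝ) = m / (n + 1) := by simp [gridPt]
    have h3 : gridPt n m < s := by
      rw [← NNReal.coe_lt_coe, e, div_lt_iff₀ hn1]; exact h1
    have h4 : a < gridPt n m := by
      rw [← NNReal.coe_lt_coe, e]
      have : (s : ℝ) ≤ m / (n + 1) + 1 / (n + 1) := by
        rw [← add_div, le_div_iff₀ hn1]; exact h2
      linarith
    exact ⟨m, ha _ h4 h3.le, h3⟩
  obtain ⟨i, hi, his⟩ := hex
  have h : ∃ j, u < w (gridPt n j) := ⟨i, hi⟩
  refine ⟨Nat.find h, by unfold gridIdx; rw [dif_pos h], ?_⟩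
  exact lt_of_le_of_lt (gridPt_mono n (Nat.find_min' h hi)) his

lemma tendsto_gridReflect {u : ℝ} {w : ℝ≥0 → ℝ} (hw : Continuous w) (h0 : w 0 ≤ u) (t : ℝ≥0) :
    Tendsto (fun n ↦ reflectIdx n (gridIdx n u w) w t) atTop (𝓝 (reflectHit u w t)) := by
  by_cases hit : ∃ s ≤ t, u < w s
  · rw [reflectHit_of_hit hit]
    obtain ⟨s, hst, hs⟩ := hit
    set A : Set ℝ≥0 := {s | u < w s} with hA
    have hAne : A.Nonempty := ⟨s, hs⟩
    -- `τ` is the hitting time of the level, and `w τ = u`. The grid exceedance times lie in `A`,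
    -- hence at or after `τ`, and eventually before any given point of `A`; so the reflection level
    -- `w (gridPt n j)` tends to `u`.
    set τ := sInf A with hτ
    have hτle : ∀ r ∈ A, τ ≤ r := fun r hr ↦ csInf_le (OrderBot.bddBelow _) hr
    have hwτ : w τ = u := by
      apply le_antisymm
      · by_contra hlt
        obtain ⟨a, haτ, ha⟩ := exists_lt_hit hw h0 (not_le.1 hlt)
        obtain ⟨b, hab, hbτ⟩ := exists_between haτ
        exact absurd (hτle b (ha b hab hbτ.le)) (not_le.2 hbτ)
      · have : τ ∈ closure A := csInf_mem_closure hAne (OrderBot.bddBelow _)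
        have hcl : IsClosed {s | u ≤ w s} := isClosed_le continuous_const hw
        exact (closure_minimal (fun x (hx : u < w x) ↦ hx.le) hcl) this
    rw [Metric.tendsto_atTop']
    intro ε hε
    have hnb : {r | |w r - u| < ε / 2} ∈ 𝓝 τ := by
      refine (isOpen_lt (by fun_prop) continuous_const).mem_nhds ?_
      simp [hwτ, hε]
    obtain ⟨b, hb, hbs⟩ := exists_Ico_subset_of_mem_nhds hnb ⟨τ + 1, by simp⟩
    obtain ⟨r, hrA, hrb⟩ := exists_lt_of_csInf_lt hAne hb
    obtain ⟨N, hN⟩ := eventually_atTop.1 ((eventually_gridPt_lt_hit hw h0 hrA).and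
      (eventually_gridPt_lt_hit hw h0 hs))
    refine ⟨N, fun n hn ↦ ?_⟩
    obtain ⟨⟨j, hj, hjr⟩, ⟨j', hj', hjs⟩⟩ := hN n hn.le
    obtain rfl : j = j' := by omega
    rw [hj]
    have hjA : gridPt n j ∈ A := (gridIdx_eq_succ.1 hj).1
    have hclose : |w (gridPt n j) - u| < ε / 2 := hbs ⟨hτle _ hjA, hjr.trans hrb⟩
    simp only [reflectIdx, reflectAt, if_neg (not_le.2 (hjs.trans_le hst))]
    rw [Real.dist_eq, show 2 * w (gridPt n j) - w t - (2 * u - w t) = 2 * (w (gridPt n j) - u) by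
      ring, abs_mul, abs_two]
    linarith
  · rw [reflectHit_of_not_hit hit]
    refine tendsto_const_nhds.congr fun n ↦ ?_
    rcases hk : gridIdx n u w with _ | j
    · rfl
    · have h1 := (gridIdx_eq_succ.1 hk).1
      have h2 : t ≤ gridPt n j := by
        by_contra h
        exact hit ⟨_, (not_le.1 h).le, h1⟩
      simp [reflectIdx, reflectAt, h2]

/-- Away from the level one of the two branches holds in a whole neighbourhood. At the level both
branches are equally far from `u`, so it does not matter which one applies. -/
lemma continuous_reflectHit {u : ℝ} {w : ℝ≥0 → ℝ} (hw : Continuous w) :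
    Continuous (reflectHit u w) := by
  rw [continuous_iff_continuousAt]
  intro t
  rcases lt_trichotomy (w t) u with h | h | h
  · have hn : {r | w r < u} ∈ 𝓝 t := (isOpen_lt hw continuous_const).mem_nhds h
    by_cases hit : ∃ s ≤ t, u < w s
    · obtain ⟨s, hst, hs⟩ := hit
      have hne : s < t := lt_of_le_of_ne hst (by rintro rfl; exact absurd hs (not_lt.2 h.le))
      have : reflectHit u w =ᶠ[𝓝 t] fun r ↦ 2 * u - w r := by
        filter_upwards [lt_mem_nhds hne] with r hr
        exact reflectHit_of_hit ⟨s, hr.le, hs⟩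
      exact (continuous_const.sub hw).continuousAt.congr this.symm
    · have : reflectHit u w =ᶠ[𝓝 t] w := by
        obtain ⟨b, hb, hbs⟩ := exists_Ico_subset_of_mem_nhds hn ⟨t + 1, by simp⟩
        filter_upwards [gt_mem_nhds hb] with r hr
        apply reflectHit_of_not_hit
        rintro ⟨s, hsr, hs⟩
        rcases le_or_gt s t with hst | hst
        · exact hit ⟨s, hst, hs⟩
        · have : w s < u := hbs ⟨hst.le, hsr.trans_lt hr⟩
          exact absurd hs (not_lt.2 this.le)
      exact hw.continuousAt.congr this.symm
  · have hval : reflectHit u w t = u := by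
      unfold reflectHit; split_ifs <;> linarith
    rw [ContinuousAt, hval]
    have habs : ∀ r, |reflectHit u w r - u| = |w r - u| := by
      intro r
      unfold reflectHit; split_ifs
      · rw [show 2 * u - w r - u = -(w r - u) by ring, abs_neg]
      · rfl
    rw [tendsto_iff_norm_sub_tendsto_zero]
    simp only [Real.norm_eq_abs, habs]
    have := (hw.tendsto t).sub_const u
    rw [h, sub_self] at this
    simpa using this.abs
  · have hn : {r | u < w r} ∈ 𝓝 t := (isOpen_lt continuous_const hw).mem_nhds h
    have : reflectHit u w =ᶠ[𝓝 t] fun r ↦ 2 * u - w r := by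
      filter_upwards [hn] with r hr
      exact reflectHit_of_hit ⟨r, le_rfl, hr⟩
    exact (continuous_const.sub hw).continuousAt.congr this.symm

/-- **Reflection principle**: a Brownian motion reflected at the level `u ≥ 0` from the first time
on at which it exceeds `u` is a Brownian motion. -/
theorem IsNiceBrownian.reflectHit (hW : IsNiceBrownian W P) {u : ℝ} (hu : 0 ≤ u) :
    IsNiceBrownian (fun t ω ↦ reflectHit u (W · ω) t) P := by
  have hP := hW.isProbabilityMeasure
  have h0 : ∀ ω, W 0 ω ≤ u := fun ω ↦ (hW.zero ω).trans_le hu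
  have hgm : ∀ n, Measurable fun ω ↦ reflectIdx n (gridIdx n u (W · ω)) (W · ω) := fun n ↦
    (measurePreserving_gridReflect hW n u).measurable.comp hW.measurable_path
  have hmeas : ∀ t, Measurable fun ω ↦ TautString.reflectHit u (W · ω) t := by
    intro t
    refine measurable_of_tendsto_metrizable
      (f := fun n ω ↦ reflectIdx n (gridIdx n u (W · ω)) (W · ω) t)
      (fun n ↦ (measurable_pi_apply t).comp (hgm n)) ?_
    rw [tendsto_pi_nhds]
    exact fun ω ↦ tendsto_gridReflect (hW.cont ω) (h0 ω) t
  have hmI : ∀ I : Finset ℝ≥0,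
      Measurable fun ω ↦ I.restrict fun t ↦ TautString.reflectHit u (W · ω) t :=
    fun I ↦ measurable_pi_lambda _ fun i ↦ hmeas i
  refine ⟨⟨fun I ↦ ⟨(hmI I).aemeasurable, ?_⟩⟩,
    fun ω ↦ continuous_reflectHit (hW.cont ω), fun ω ↦ ?_, hmeas⟩
  · have hm := hmI I
    have : IsProbabilityMeasure
        (P.map fun ω ↦ I.restrict fun t ↦ TautString.reflectHit u (W · ω) t) :=
      Measure.isProbabilityMeasure_map hm.aemeasurable
    rw [← (hW.hasLaw I).map_eq]
    have : IsProbabilityMeasure (P.map fun ω ↦ I.restrict (W · ω)) :=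
      Measure.isProbabilityMeasure_map (hW.hasLaw I).aemeasurable
    -- Finite dimensional laws are compared through bounded continuous functions: the grid
    -- reflections do not change the integral, and they converge pointwise to the reflected path.
    refine ext_of_forall_integral_eq_of_IsFiniteMeasure fun f ↦ ?_
    rw [integral_map hm.aemeasurable (by fun_prop),
      integral_map (hW.hasLaw I).aemeasurable (by fun_prop)]
    have hr : ∀ n, ∫ ω, f (I.restrict (reflectIdx n (gridIdx n u (W · ω)) (W · ω))) ∂P =
        ∫ ω, f (I.restrict (W · ω)) ∂P := by
      intro n
      have h := (measurePreserving_gridReflect hW n u)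
      have e : ∀ g : (ℝ≥0 → ℝ) → ℝ, Measurable g →
          ∫ w, g w ∂(P.map fun ω ↦ (W · ω)) = ∫ ω, g (W · ω) ∂P := fun g hg ↦
        integral_map hW.measurable_path.aemeasurable hg.aestronglyMeasurable
      have hf : Measurable fun w : ℝ≥0 → ℝ ↦ f (I.restrict w) :=
        f.continuous.measurable.comp (Finset.measurable_restrict I)
      rw [← e (fun w ↦ f (I.restrict w)) hf,
        ← e (fun w ↦ f (I.restrict (reflectIdx n (gridIdx n u w) w))) (hf.comp h.measurable)]
      conv_rhs => rw [← h.map_eq]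
      rw [integral_map h.measurable.aemeasurable hf.aestronglyMeasurable]
    have hlim : Tendsto
        (fun n ↦ ∫ ω, f (I.restrict (reflectIdx n (gridIdx n u (W · ω)) (W · ω))) ∂P) atTop
        (𝓝 (∫ ω, f (I.restrict fun t ↦ TautString.reflectHit u (W · ω) t) ∂P)) := by
      refine tendsto_integral_of_dominated_convergence (fun _ ↦ ‖f‖) (fun n ↦ ?_)
        (integrable_const _) (fun n ↦ ae_of_all _ fun ω ↦ f.norm_coe_le_norm _)
        (ae_of_all _ fun ω ↦ ?_)
      · exact (f.continuous.measurable.comp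
          ((Finset.measurable_restrict I).comp (hgm n))).aestronglyMeasurable
      · refine (f.continuous.tendsto _).comp ?_
        rw [tendsto_pi_nhds]
        exact fun i ↦ tendsto_gridReflect (hW.cont ω) (h0 ω) i
    simp only [hr] at hlim
    exact tendsto_nhds_unique hlim tendsto_const_nhds
  · unfold TautString.reflectHit
    rw [if_neg]
    · exact hW.zero ω
    · rintro ⟨s, hs, h⟩
      rw [nonpos_iff_eq_zero] at hs
      subst hs
      exact absurd h (not_lt.2 (h0 ω))

lemma measurableSet_hit (hW : IsNiceBrownian W P) (t : ℝ≥0) (u : ℝ) :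
    MeasurableSet {ω | ∃ s ≤ t, u < W s ω} := by
  have : {ω | ∃ s ≤ t, u < W s ω} =
      ⋃ n, {ω | u < W (TopologicalSpace.denseSeq (Set.Iic t) n : Set.Iic t) ω} := by
    ext ω
    simp only [Set.mem_ofPred_eq, Set.mem_iUnion]
    constructor
    · rintro ⟨s, hs, h⟩
      have ho : IsOpen {r : Set.Iic t | u < W r ω} :=
        isOpen_lt continuous_const ((hW.cont ω).comp continuous_subtype_val)
      obtain ⟨x, hx, n, rfl⟩ := (TopologicalSpace.denseRange_denseSeq (Set.Iic t)).inter_open_nonempty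
        _ ho ⟨⟨s, hs⟩, h⟩
      exact ⟨n, hx⟩
    · rintro ⟨n, hn⟩
      exact ⟨_, (TopologicalSpace.denseSeq (Set.Iic t) n).2, hn⟩
  rw [this]
  exact MeasurableSet.iUnion fun n ↦ measurableSet_lt measurable_const (hW.meas _)

lemma measure_lt_eq_of_isNiceBrownian {Ω' : Type*} {mΩ' : MeasurableSpace Ω'} {Q : Measure Ω'}
    {V : ℝ≥0 → Ω' → ℝ} (hW : IsNiceBrownian W P) (hV : IsNiceBrownian V Q) (t : ℝ≥0) {S : Set ℝ}
    (hS : MeasurableSet S) : P (W t ⁻¹' S) = Q (V t ⁻¹' S) := by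
  rw [← Measure.map_apply (hW.meas t) hS, ← Measure.map_apply (hV.meas t) hS,
    (hW.hasLaw_eval t).map_eq, (hV.hasLaw_eval t).map_eq]

/-- The law of the running maximum of Brownian motion. -/
theorem measure_hit (hW : IsNiceBrownian W P) (t : ℝ≥0) {u : ℝ} (hu : 0 ≤ u) :
    P {ω | ∃ s ≤ t, u < W s ω} = P {ω | u < |W t ω|} := by
  -- At time 0 the law is a Dirac mass, and a single level need not be null.
  rcases eq_or_ne t 0 with rfl | ht
  · congr 1
    ext ω
    simp only [nonpos_iff_eq_zero, exists_eq_left, Set.mem_ofPred_eq, hW.zero, abs_zero]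
  have h1 : P (W t ⁻¹' {u}) = 0 := by
    rw [← Measure.map_apply (hW.meas t) (measurableSet_singleton u), (hW.hasLaw_eval t).map_eq]
    exact gaussianReal_absolutelyContinuous 0 ht (by simp)
  -- Once the level has been exceeded, exactly one of the path and its reflection is above it at
  -- time `t`, unless the path is at the level itself, a null event.
  have hdec : {ω | ∃ s ≤ t, u < W s ω} =ᵐ[P]
      (W t ⁻¹' Set.Ioi u ∪ {ω | u < reflectHit u (W · ω) t} : Set Ω) := by
    have h2 : ∀ᵐ ω ∂P, W t ω ≠ u := by
      rw [ae_iff]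
      simp only [not_not]
      exact h1
    filter_upwards [h2] with ω hω
    apply propext
    change (∃ s ≤ t, u < W s ω) ↔ (u < W t ω ∨ u < reflectHit u (W · ω) t)
    by_cases hit : ∃ s ≤ t, u < W s ω
    · rw [reflectHit_of_hit hit]
      refine iff_of_true hit ?_
      rcases lt_or_gt_of_ne hω with h | h
      · right; linarith
      · exact Or.inl h
    · rw [reflectHit_of_not_hit hit, or_self]
      refine iff_of_false hit fun h ↦ hit ⟨t, le_rfl, h⟩
  have hdis : Disjoint (W t ⁻¹' Set.Ioi u) {ω | u < reflectHit u (W · ω) t} := by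
    rw [Set.disjoint_left]
    intro ω h h'
    simp only [Set.mem_preimage, Set.mem_Ioi] at h
    rw [Set.mem_ofPred_eq, reflectHit_of_hit ⟨t, le_rfl, h⟩] at h'
    linarith
  have hsplit : {ω | u < |W t ω|} = W t ⁻¹' Set.Ioi u ∪ (-W) t ⁻¹' Set.Ioi u := by
    ext ω
    simp [lt_abs]
  have hdis' : Disjoint (W t ⁻¹' Set.Ioi u) ((-W) t ⁻¹' Set.Ioi u) := by
    rw [Set.disjoint_left]
    intro ω h h'
    simp only [Set.mem_preimage, Set.mem_Ioi, Pi.neg_apply] at h h'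
    linarith
  have hR := hW.reflectHit hu
  rw [measure_congr hdec, measure_union hdis (measurableSet_lt measurable_const (hR.meas t)),
    hsplit, measure_union hdis' (hW.neg.meas t measurableSet_Ioi)]
  congr 1
  rw [measure_lt_eq_of_isNiceBrownian hW.neg hR t measurableSet_Ioi]
  rfl

/-! ### Alternating crossings of two levels. -/

/-- `Alt k u d s w`: after time `s` and up to time `1` the path alternately exceeds `u` and goes
below `d`, starting with `u`, at least `k` times in total. -/
def Alt : ℕ → ℝ → ℝ → ℝ≥0 → (ℝ≥0 → ℝ) → Prop
  | 0, _, _, _, _ => True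
  | k + 1, u, d, s, w => ∃ t, s ≤ t ∧ t ≤ 1 ∧ u < w t ∧ Alt k (-d) (-u) t (-w)

lemma Alt.mono {k : ℕ} {u d : ℝ} {s s' : ℝ≥0} {w : ℝ≥0 → ℝ} (hs : s ≤ s')
    (h : Alt k u d s' w) : Alt k u d s w := by
  cases k with
  | zero => trivial
  | succ k =>
    obtain ⟨t, h1, h2⟩ := h
    exact ⟨t, hs.trans h1, h2⟩

lemma Alt.pred {k : ℕ} {u d : ℝ} {s : ℝ≥0} {w : ℝ≥0 → ℝ} (h : Alt (k + 1) u d s w) :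
    Alt k u d s w := by
  induction k generalizing u d s w with
  | zero => trivial
  | succ k ih =>
    obtain ⟨t, h1, h2, h3, h4⟩ := h
    exact ⟨t, h1, h2, h3, ih h4⟩

lemma Alt.congr {k : ℕ} {u d : ℝ} {s : ℝ≥0} {w v : ℝ≥0 → ℝ} (hwv : ∀ t, s ≤ t → w t = v t)
    (h : Alt k u d s w) : Alt k u d s v := by
  induction k generalizing u d s w v with
  | zero => trivial
  | succ k ih =>
    obtain ⟨t, h1, h2, h3, h4⟩ := h
    refine ⟨t, h1, h2, hwv t h1 ▸ h3, ih (fun r hr ↦ ?_) h4⟩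
    simp only [Pi.neg_apply, hwv r (h1.trans hr)]

lemma Alt.add_const {k : ℕ} {u d : ℝ} {s : ℝ≥0} {w : ℝ≥0 → ℝ} (c : ℝ)
    (h : Alt k u d s w) : Alt k (u + c) (d + c) s (fun t ↦ w t + c) := by
  induction k generalizing u d s w c with
  | zero => trivial
  | succ k ih =>
    obtain ⟨t, h1, h2, h3, h4⟩ := h
    refine ⟨t, h1, h2, by linarith, ?_⟩
    have := ih (-c) h4
    convert this using 1
    · ring
    · ring
    · ext r; simp; ring

/-- Of the two initial crossings, the earlier one can be put in front of the other alternating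
sequence, which lengthens that sequence by one; conversely a sequence of length k + 1 contains one
of length k starting with either level. -/
lemma alt_and_alt_neg_iff {k : ℕ} (hk : k ≠ 0) {u d : ℝ} {s : ℝ≥0} {w : ℝ≥0 → ℝ} :
    Alt k u d s w ∧ Alt k (-d) (-u) s (-w) ↔
      Alt (k + 1) u d s w ∨ Alt (k + 1) (-d) (-u) s (-w) := by
  obtain ⟨m, rfl⟩ := Nat.exists_eq_succ_of_ne_zero hk
  constructor
  · rintro ⟨⟨t, h1, h2, h3, h4⟩, ⟨t', h1', h2', h3', h4'⟩⟩
    rcases le_total t t' with h | h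
    · exact Or.inl ⟨t, h1, h2, h3, ⟨t', h, h2', h3', h4'⟩⟩
    · refine Or.inr ⟨t', h1', h2', h3', ⟨t, h, h2, ?_, ?_⟩⟩
      · simpa using h3
      · simpa using h4
  · rintro (h | h)
    · refine ⟨h.pred, ?_⟩
      obtain ⟨t, h1, h2, h3, h4⟩ := h
      exact h4.mono h1
    · refine ⟨?_, h.pred⟩
      obtain ⟨t, h1, h2, h3, h4⟩ := h
      have := h4.mono h1
      simpa using this

/-- After the first passage of `u`, reflection turns a descent below `d` into a rise above `2 * u -
d`, and a return above `u` into a descent below `u`. Since `2 * u - d ≥ u`, exceeding the new level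
already forces the passage of `u`, so one crossing is saved. -/
lemma alt_succ_iff_reflectHit {k : ℕ} (hk : k ≠ 0) {u d : ℝ} (hd : d ≤ u) {w : ℝ≥0 → ℝ} :
    Alt (k + 1) u d 0 w ↔ Alt k (2 * u - d) u 0 (reflectHit u w) := by
  constructor
  · rintro ⟨t, h1, h2, h3, h4⟩
    have h5 := (h4.add_const (2 * u)).congr (v := reflectHit u w) fun r hr ↦ by
      rw [reflectHit_of_hit ⟨t, hr, h3⟩, Pi.neg_apply]; ring
    have h6 := h5.mono h1
    convert h6 using 1 <;> ring
  · intro h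
    obtain ⟨m, rfl⟩ := Nat.exists_eq_succ_of_ne_zero hk
    obtain ⟨t, h1, h2, h3, h4⟩ := h
    have hit : ∃ s ≤ t, u < w s := by
      by_contra hn
      rw [reflectHit_of_not_hit hn] at h3
      exact hn ⟨t, le_rfl, by linarith⟩
    obtain ⟨s, hst, hs⟩ := hit
    have h5 : Alt (m + 1) (2 * u - d) u s (reflectHit u w) := ⟨t, hst, h2, h3, h4⟩
    have h6 := (h5.add_const (-(2 * u))).congr (v := -w) fun r hr ↦ by
      rw [reflectHit_of_hit ⟨s, hr, hs⟩, Pi.neg_apply]; ring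
    refine ⟨s, zero_le, hst.trans h2, hs, ?_⟩
    convert h6 using 1 <;> ring

lemma alt_one_iff {u d : ℝ} {w : ℝ≥0 → ℝ} : Alt 1 u d 0 w ↔ ∃ s ≤ 1, u < w s := by
  simp [Alt]

/-- The probability of `k + 1` alternating crossings. -/
theorem measure_alt (hW : IsNiceBrownian W P) (k : ℕ) {u d : ℝ} (hu : 0 ≤ u) (hd : d ≤ u) :
    MeasurableSet {ω | Alt (k + 1) u d 0 (W · ω)} ∧
    P {ω | Alt (k + 1) u d 0 (W · ω)} = gaussianReal 0 1 {z | u + k * (u - d) < |z|} := by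
  induction k generalizing u d W with
  | zero =>
    simp only [zero_add, alt_one_iff, Nat.cast_zero, zero_mul, add_zero]
    refine ⟨measurableSet_hit hW 1 u, ?_⟩
    rw [measure_hit hW 1 hu, ← (hW.hasLaw_eval 1).map_eq, Measure.map_apply (hW.meas 1)]
    · rfl
    · exact measurableSet_lt measurable_const (by fun_prop)
  | succ k ih =>
    -- Each reflection replaces (u, d) by (2u - d, u): the gap is kept and the upper level rises by
    -- it. After k reflections a single crossing of u + k (u - d) remains.
    simp only [alt_succ_iff_reflectHit (Nat.succ_ne_zero k) hd]
    have := ih (hW.reflectHit hu) (u := 2 * u - d) (d := u) (by linarith) (by linarith)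
    refine ⟨this.1, this.2.trans ?_⟩
    congr 1
    ext z
    simp only [Set.mem_ofPred_eq]
    push_cast
    ring_nf

/-! ### The truncated second moment of the range. -/

/-- The maximum of a path on the unit interval. -/
def pathMax (w : ℝ≥0 → ℝ) : ℝ := ⨆ s : Set.Icc (0 : ℝ≥0) 1, w s

lemma bddAbove_range_path {w : ℝ≥0 → ℝ} (hw : Continuous w) :
    BddAbove (Set.range fun s : Set.Icc (0 : ℝ≥0) 1 ↦ w s) :=
  (isCompact_range (hw.comp continuous_subtype_val)).bddAbove

lemma lt_pathMax_iff {w : ℝ≥0 → ℝ} (hw : Continuous w) {u : ℝ} :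
    u < pathMax w ↔ ∃ s ≤ 1, u < w s := by
  unfold pathMax
  have : Nonempty (Set.Icc (0 : ℝ≥0) 1) := ⟨0, by simp⟩
  rw [lt_ciSup_iff (bddAbove_range_path hw)]
  constructor
  · rintro ⟨i, hi⟩; exact ⟨i, i.2.2, hi⟩
  · rintro ⟨s, hs, h⟩; exact ⟨⟨s, zero_le, hs⟩, h⟩

lemma le_pathMax {w : ℝ≥0 → ℝ} (hw : Continuous w) {s : ℝ≥0} (hs : s ≤ 1) : w s ≤ pathMax w :=
  le_ciSup (bddAbove_range_path hw) (⟨s, zero_le, hs⟩ : Set.Icc (0 : ℝ≥0) 1)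

lemma range_eq_pathMax (w : ℝ≥0 → ℝ) : range w = pathMax w + pathMax (-w) := by
  unfold range pathMax
  rw [sub_eq_add_neg]
  congr 1
  rw [iInf, Real.sInf_def, neg_neg, iSup]
  congr 1
  ext x
  simp only [Set.mem_neg, Set.mem_range, Pi.neg_apply, neg_eq_iff_eq_neg]

lemma measurable_pathMax (hW : IsNiceBrownian W P) : Measurable fun ω ↦ pathMax (W · ω) := by
  refine measurable_of_Ioi fun u ↦ ?_
  have : (fun ω ↦ pathMax (W · ω)) ⁻¹' Set.Ioi u = {ω | ∃ s ≤ 1, u < W s ω} := by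
    ext ω
    exact lt_pathMax_iff (hW.cont ω)
  rw [this]
  exact measurableSet_hit hW 1 u

lemma pathMax_nonneg {w : ℝ≥0 → ℝ} (hw : Continuous w) (h0 : w 0 = 0) : 0 ≤ pathMax w :=
  h0 ▸ le_pathMax hw zero_le_one

lemma measurable_range (hW : IsNiceBrownian W P) : Measurable fun ω ↦ range (W · ω) := by
  have h : (fun ω ↦ range (W · ω)) = fun ω ↦ pathMax (W · ω) + pathMax ((-W) · ω) := by
    ext ω; exact range_eq_pathMax _
  rw [h]
  exact (measurable_pathMax hW).add (measurable_pathMax hW.neg)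

/-- The maximum of Brownian motion on the unit interval is distributed as `|N|`. -/
lemma map_pathMax (hW : IsNiceBrownian W P) :
    P.map (fun ω ↦ pathMax (W · ω)) = (gaussianReal 0 1).map fun z ↦ |z| := by
  have hP := hW.isProbabilityMeasure
  have h1 : IsProbabilityMeasure (P.map (fun ω ↦ pathMax (W · ω))) :=
    Measure.isProbabilityMeasure_map (measurable_pathMax hW).aemeasurable
  have h2 : IsProbabilityMeasure ((gaussianReal 0 1).map fun z ↦ |z|) :=
    Measure.isProbabilityMeasure_map (by fun_prop)
  refine Measure.ext_of_Iic _ _ fun u ↦ ?_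
  rw [← Set.compl_Ioi, prob_compl_eq_one_sub measurableSet_Ioi,
    prob_compl_eq_one_sub measurableSet_Ioi]
  congr 1
  rw [Measure.map_apply (measurable_pathMax hW) measurableSet_Ioi,
    Measure.map_apply (by fun_prop) measurableSet_Ioi]
  rcases le_or_gt 0 u with hu | hu
  · have := (measure_alt hW 0 hu hu).2
    simp only [zero_add, alt_one_iff, Nat.cast_zero, zero_mul, add_zero] at this
    have h : (fun ω ↦ pathMax (W · ω)) ⁻¹' Set.Ioi u = {ω | ∃ s ≤ 1, u < W s ω} := by
      ext ω
      exact lt_pathMax_iff (hW.cont ω)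
    rw [h, this]
    rfl
  · have e1 : (fun ω ↦ pathMax (W · ω)) ⁻¹' Set.Ioi u = Set.univ :=
      Set.eq_univ_of_forall fun ω ↦ hu.trans_le (pathMax_nonneg (hW.cont ω) (hW.zero ω))
    have e2 : (fun z : ℝ ↦ |z|) ⁻¹' Set.Ioi u = Set.univ :=
      Set.eq_univ_of_forall fun z ↦ hu.trans_le (abs_nonneg z)
    rw [e1, e2, measure_univ, measure_univ]

lemma sq_ofReal_sub_eq_lintegral (y c : ℝ) :
    ENNReal.ofReal (y - c) ^ 2 = ∫⁻ L in Set.Ioi c, 2 * ENNReal.ofReal (y - L) := by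
  rcases le_or_gt y c with h | h
  · rw [ENNReal.ofReal_of_nonpos (by linarith), setLIntegral_congr_fun (g := fun _ ↦ 0)
      measurableSet_Ioi]
    · simp
    · intro L hL
      simp only [Set.mem_Ioi] at hL
      simp only [ENNReal.ofReal_of_nonpos (show y - L ≤ 0 by linarith), mul_zero]
  · have h1 : ∫⁻ L in Set.Ioi c, 2 * ENNReal.ofReal (y - L) =
        ∫⁻ L in Set.Ioc c y, ENNReal.ofReal (2 * (y - L)) := by
      rw [← lintegral_indicator measurableSet_Ioi, ← lintegral_indicator measurableSet_Ioc]
      congr 1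
      ext L
      simp only [Set.indicator_apply, Set.mem_Ioi, Set.mem_Ioc]
      by_cases h1 : c < L
      · by_cases h2 : L ≤ y
        · simp only [h1, h2, and_self, if_true]
          rw [ENNReal.ofReal_mul (by norm_num)]
          simp
        · simp only [h1, h2, and_false, if_true, if_false]
          rw [ENNReal.ofReal_of_nonpos (by linarith), mul_zero]
      · simp only [h1, false_and, if_false]
    rw [h1, ← ofReal_integral_eq_lintegral_ofReal, ← intervalIntegral.integral_of_le h.le]
    · have : ∫ L in c..y, 2 * (y - L) = (y - c) ^ 2 := by
        have hd : ∀ x ∈ Set.uIcc c y, HasDerivAt (fun L : ℝ ↦ -(y - L) ^ 2) (2 * (y - x)) x := by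
          intro x _
          have := (((hasDerivAt_id' x).const_sub y).pow 2).neg
          exact this.congr_deriv (by norm_num)
        rw [intervalIntegral.integral_eq_sub_of_hasDerivAt hd
          (Continuous.intervalIntegrable (by fun_prop) _ _)]
        ring
      rw [this, ENNReal.ofReal_pow (by linarith)]
    · exact (Continuous.integrableOn_Icc (by fun_prop)).mono_set Set.Ioc_subset_Icc_self
    · rw [EventuallyLE, ae_restrict_iff' measurableSet_Ioc]
      refine ae_of_all _ fun L hL ↦ ?_
      change (0 : ℝ) ≤ 2 * (y - L)
      linarith [hL.2]

/-- `E (Y - c)₊² = 2 ∫_c^∞ E (Y - L)₊ dL`. -/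
lemma lintegral_sq_ofReal_sub {X : Type*} [MeasurableSpace X] {μ : Measure X} [SFinite μ]
    {Y : X → ℝ} (hY : Measurable Y) (c : ℝ) :
    ∫⁻ x, ENNReal.ofReal (Y x - c) ^ 2 ∂μ =
      ∫⁻ L in Set.Ioi c, 2 * ∫⁻ x, ENNReal.ofReal (Y x - L) ∂μ := by
  simp only [sq_ofReal_sub_eq_lintegral]
  rw [lintegral_lintegral_swap]
  · refine lintegral_congr fun L ↦ ?_
    rw [lintegral_const_mul]
    fun_prop
  · have : Measurable fun p : X × ℝ ↦ 2 * ENNReal.ofReal (Y p.1 - p.2) := by fun_prop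
    exact this.aemeasurable

/-- The last term is the length of the interval from max(0, L - v) to min(L, u). With `u` the
maximum and `v` minus the minimum, it reduces the excess of the range to joint tails of these two
variables. -/
lemma ofReal_add_sub_eq {u v L : ℝ} (hu : 0 ≤ u) (hv : 0 ≤ v) (hL : 0 ≤ L) :
    ENNReal.ofReal (u + v - L) = ENNReal.ofReal (u - L) + ENNReal.ofReal (v - L) +
      ∫⁻ a in Set.Ioo 0 L, Set.indicator {a | a < u ∧ L - a < v} 1 a := by
  have hm : MeasurableSet {a : ℝ | a < u ∧ L - a < v} :=
    (measurableSet_lt measurable_id measurable_const).inter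
      (measurableSet_lt (measurable_const.sub measurable_id) measurable_const)
  rw [lintegral_indicator_one hm, Measure.restrict_apply hm]
  have : {a : ℝ | a < u ∧ L - a < v} ∩ Set.Ioo 0 L = Set.Ioo (max 0 (L - v)) (min L u) := by
    ext a
    simp only [Set.mem_inter_iff, Set.mem_ofPred_eq, Set.mem_Ioo, max_lt_iff, lt_min_iff]
    constructor
    · rintro ⟨⟨h1, h2⟩, h3, h4⟩; exact ⟨⟨h3, by linarith⟩, h4, h1⟩
    · rintro ⟨⟨h3, h2⟩, h4, h1⟩; exact ⟨⟨h1, by linarith⟩, h3, h4⟩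
  rw [this, Real.volume_Ioo]
  rcases le_total L u with h1 | h1 <;> rcases le_total L v with h2 | h2
  · rw [min_eq_left h1, max_eq_left (by linarith), ← ENNReal.ofReal_add (by linarith)
      (by linarith), ← ENNReal.ofReal_add (by linarith) (by linarith)]
    ring_nf
  · rw [min_eq_left h1, max_eq_right (by linarith), ENNReal.ofReal_of_nonpos (p := v - L)
      (by linarith), add_zero, ← ENNReal.ofReal_add (by linarith) (by linarith)]
    ring_nf
  · rw [min_eq_right h1, max_eq_left (by linarith), ENNReal.ofReal_of_nonpos (p := u - L)
      (by linarith), zero_add, ← ENNReal.ofReal_add (by linarith) (by linarith)]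
    ring_nf
  · rw [min_eq_right h1, max_eq_right (by linarith), ENNReal.ofReal_of_nonpos (p := u - L)
      (by linarith), ENNReal.ofReal_of_nonpos (p := v - L) (by linarith), zero_add, zero_add]
    ring_nf

/-- `E (|N| - t)₊`. -/
def tailMean (t : ℝ) : ℝ≥0∞ := ∫⁻ z, ENNReal.ofReal (|z| - t) ∂gaussianReal 0 1

/-- `E (|N| - t)₊²`. -/
def tailSq (t : ℝ) : ℝ≥0∞ := ∫⁻ z, ENNReal.ofReal (|z| - t) ^ 2 ∂gaussianReal 0 1

lemma tailMean_lt_top {t : ℝ} (ht : 0 ≤ t) : tailMean t < ∞ := by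
  have h : MemLp (id : ℝ → ℝ) 1 (gaussianReal 0 1) := by
    simpa using memLp_id_gaussianReal (μ := 0) (v := 1) 1
  refine lt_of_le_of_lt (lintegral_mono (g := fun z ↦ ‖z‖ₑ) fun z ↦ ?_) ?_
  · change _ ≤ ‖z‖ₑ
    rw [← ofReal_norm, Real.norm_eq_abs]
    exact ENNReal.ofReal_le_ofReal (by linarith)
  · have := h.2
    rw [eLpNorm_one_eq_lintegral_enorm] at this
    simpa using this

/-- This is `lintegral_sq_ofReal_sub` for the variable |N| / k; the two sides scale with different
powers of k, which leaves the factor 1 / k. -/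
lemma lintegral_tailMean_mul {k c : ℝ} (hk : 0 < k) :
    ∫⁻ L in Set.Ioi c, 2 * tailMean (k * L) = ENNReal.ofReal (1 / k) * tailSq (k * c) := by
  have h := lintegral_sq_ofReal_sub (μ := gaussianReal 0 1) (Y := fun z ↦ |z| / k)
    (by fun_prop) c
  have e1 : ∀ L, tailMean (k * L) =
      ENNReal.ofReal k * ∫⁻ z, ENNReal.ofReal (|z| / k - L) ∂gaussianReal 0 1 := by
    intro L
    unfold tailMean
    rw [← lintegral_const_mul _ (by fun_prop)]
    refine lintegral_congr fun z ↦ ?_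
    rw [← ENNReal.ofReal_mul hk.le]
    congr 1
    field_simp
  have e2 : tailSq (k * c) =
      ENNReal.ofReal k ^ 2 * ∫⁻ z, ENNReal.ofReal (|z| / k - c) ^ 2 ∂gaussianReal 0 1 := by
    unfold tailSq
    rw [← lintegral_const_mul]
    swap; · fun_prop
    refine lintegral_congr fun z ↦ ?_
    rw [← mul_pow, ← ENNReal.ofReal_mul hk.le]
    congr 2
    field_simp
  rw [e2, h, ← mul_assoc]
  have e3 : ENNReal.ofReal (1 / k) * ENNReal.ofReal k ^ 2 = ENNReal.ofReal k := by
    rw [sq, ← mul_assoc, ← ENNReal.ofReal_mul (by positivity), one_div, inv_mul_cancel₀ hk.ne']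
    simp
  have hmeas : Measurable fun L : ℝ ↦
      ∫⁻ z, ENNReal.ofReal (|z| / k - L) ∂gaussianReal 0 1 := by
    apply Measurable.lintegral_prod_right' (f := fun p : ℝ × ℝ ↦ ENNReal.ofReal (|p.2| / k - p.1))
    fun_prop
  rw [e3, ← lintegral_const_mul _ (by fun_prop)]
  refine lintegral_congr fun L ↦ ?_
  rw [e1]
  ring

lemma measurable_tailMean_mul (k : ℝ) : Measurable fun L ↦ tailMean (k * L) := by
  unfold tailMean
  apply Measurable.lintegral_prod_right' (f := fun p : ℝ × ℝ ↦ ENNReal.ofReal (|p.2| - k * p.1))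
  fun_prop

/-- The integral over `a ∈ (0, L)` of `P (|N| > s + a)`. -/
lemma lintegral_gaussian_tail (s : ℝ) {L : ℝ} (hL : 0 ≤ L) :
    (∫⁻ a in Set.Ioo 0 L, gaussianReal 0 1 {z | s + a < |z|}) + tailMean (s + L) =
      tailMean s := by
  have hm : MeasurableSet {p : ℝ × ℝ | s + p.1 < |p.2|} :=
    measurableSet_lt (by fun_prop) (by fun_prop)
  have h1 : ∫⁻ a in Set.Ioo 0 L, gaussianReal 0 1 {z | s + a < |z|} =
      ∫⁻ z, ENNReal.ofReal (min L (|z| - s)) ∂gaussianReal 0 1 := by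
    have e : ∀ a : ℝ, gaussianReal 0 1 {z | s + a < |z|} =
        ∫⁻ z, Set.indicator {p : ℝ × ℝ | s + p.1 < |p.2|} 1 (a, z) ∂gaussianReal 0 1 := by
      intro a
      rw [← lintegral_indicator_one (measurableSet_lt measurable_const (by fun_prop))]
      rfl
    simp only [e]
    rw [lintegral_lintegral_swap]
    · refine lintegral_congr fun z ↦ ?_
      have : (fun a ↦ Set.indicator {p : ℝ × ℝ | s + p.1 < |p.2|} (1 : ℝ × ℝ → ℝ≥0∞) (a, z)) =
          Set.indicator {a | s + a < |z|} 1 := rfl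
      have hm' : MeasurableSet {a | s + a < |z|} := measurableSet_lt (by fun_prop) (by fun_prop)
      rw [this, lintegral_indicator_one hm', Measure.restrict_apply hm']
      have : {a | s + a < |z|} ∩ Set.Ioo 0 L = Set.Ioo 0 (min L (|z| - s)) := by
        ext a
        simp only [Set.mem_inter_iff, Set.mem_ofPred_eq, Set.mem_Ioo, lt_min_iff]
        constructor
        · rintro ⟨h1, h2, h3⟩; exact ⟨h2, h3, by linarith⟩
        · rintro ⟨h2, h3, h1⟩; exact ⟨by linarith, h2, h3⟩
      rw [this, Real.volume_Ioo, sub_zero]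
    · exact (measurable_one.indicator hm).aemeasurable
  rw [h1]
  unfold tailMean
  rw [← lintegral_add_left (by fun_prop)]
  refine lintegral_congr fun z ↦ ?_
  rcases le_total L (|z| - s) with h | h
  · rw [min_eq_left h, ← ENNReal.ofReal_add hL (by linarith)]
    congr 1; ring
  · rw [min_eq_right h, ENNReal.ofReal_of_nonpos (p := |z| - (s + L)) (by linarith), add_zero]

lemma lintegral_Ioo_reflect (f : ℝ → ℝ≥0∞) (L : ℝ) :
    ∫⁻ a in Set.Ioo 0 L, f (L - a) = ∫⁻ a in Set.Ioo 0 L, f a := by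
  have h := (Measure.measurePreserving_sub_left (volume : Measure ℝ) L).setLIntegral_comp_preimage_emb
    (MeasurableEquiv.subLeft L).measurableEmbedding f (Set.Ioo 0 L)
  have : (fun x ↦ L - x) ⁻¹' Set.Ioo 0 L = Set.Ioo 0 L := by
    ext x; simp [and_comm]
  rwa [this] at h

/-- `P (s < |N|)`. -/
def gaussTail (s : ℝ) : ℝ≥0∞ := gaussianReal 0 1 {z | s < |z|}

lemma measurable_gaussTail : Measurable gaussTail := by
  have : Antitone gaussTail := fun s t hst ↦ measure_mono fun z hz ↦ lt_of_le_of_lt hst hz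
  exact this.measurable

/-- Either of the two alternating crossing events of length `k` for the levels `a` and `-b`. -/
def altUnion (W : ℝ≥0 → Ω → ℝ) (k : ℕ) (a b : ℝ) : Set Ω :=
  {ω | Alt k a (-b) 0 (W · ω)} ∪ {ω | Alt k b (-a) 0 ((-W) · ω)}

/-- Inclusion–exclusion: the intersection of the two events of length k + 1 is the union of the two
events of length k + 2. Iterating this expresses the case of length 2, the joint tail of maximum and
minimum, by an alternating series of Gaussian tails. -/
lemma measure_altUnion_add (hW : IsNiceBrownian W P) (k : ℕ) {a b : ℝ} (ha : 0 ≤ a) (hb : 0 ≤ b) :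
    P (altUnion W (k + 1) a b) + P (altUnion W (k + 2) a b) =
      gaussTail (a + k * (a + b)) + gaussTail (b + k * (a + b)) := by
  have hA := measure_alt hW k ha (show -b ≤ a by linarith)
  have hB := measure_alt hW.neg k hb (show -a ≤ b by linarith)
  have hint : altUnion W (k + 2) a b =
      {ω | Alt (k + 1) a (-b) 0 (W · ω)} ∩ {ω | Alt (k + 1) b (-a) 0 ((-W) · ω)} := by
    ext ω
    have := alt_and_alt_neg_iff (k := k + 1) (Nat.succ_ne_zero k) (u := a) (d := -b) (s := 0)
      (w := (W · ω))
    rw [neg_neg] at this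
    exact this.symm
  rw [hint, altUnion, measure_union_add_inter _ hB.1, hA.2, hB.2]
  unfold gaussTail
  rw [sub_neg_eq_add, sub_neg_eq_add, add_comm b a]

lemma altUnion_two (hW : IsNiceBrownian W P) (a b : ℝ) :
    altUnion W 2 a b = {ω | a < pathMax (W · ω) ∧ b < pathMax ((-W) · ω)} := by
  ext ω
  have := alt_and_alt_neg_iff (k := 1) one_ne_zero (u := a) (d := -b) (s := 0) (w := (W · ω))
  rw [neg_neg] at this
  refine Iff.trans this.symm ?_
  rw [alt_one_iff, alt_one_iff, Set.mem_ofPred_eq, lt_pathMax_iff (hW.cont ω),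
    lt_pathMax_iff (hW.neg.cont ω)]
  rfl

lemma lintegral_range_sub (hW : IsNiceBrownian W P) {L : ℝ} (hL : 0 ≤ L) :
    ∫⁻ ω, ENNReal.ofReal (range (W · ω) - L) ∂P =
      tailMean L + tailMean L + ∫⁻ a in Set.Ioo 0 L, P (altUnion W 2 a (L - a)) := by
  have hP := hW.isProbabilityMeasure
  have hU := measurable_pathMax hW
  have hV := measurable_pathMax hW.neg
  have e : ∀ {V : ℝ≥0 → Ω → ℝ}, IsNiceBrownian V P →
      ∫⁻ ω, ENNReal.ofReal (pathMax (V · ω) - L) ∂P = tailMean L := by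
    intro V hV
    have hf : Measurable fun y : ℝ ↦ ENNReal.ofReal (y - L) := by fun_prop
    rw [← lintegral_map hf (measurable_pathMax hV), map_pathMax hV, lintegral_map hf (by fun_prop)]
    rfl
  have hm : MeasurableSet {p : Ω × ℝ | p.2 < pathMax (W · p.1) ∧ L - p.2 < pathMax ((-W) · p.1)} :=
    (measurableSet_lt measurable_snd (hU.comp measurable_fst)).inter
      (measurableSet_lt (measurable_const.sub measurable_snd) (hV.comp measurable_fst))
  have h1 : ∀ ω, ENNReal.ofReal (range (W · ω) - L) =
      ENNReal.ofReal (pathMax (W · ω) - L) + ENNReal.ofReal (pathMax ((-W) · ω) - L) +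
      ∫⁻ a in Set.Ioo 0 L, Set.indicator
        {p : Ω × ℝ | p.2 < pathMax (W · p.1) ∧ L - p.2 < pathMax ((-W) · p.1)} 1 (ω, a) := by
    intro ω
    rw [range_eq_pathMax]
    exact ofReal_add_sub_eq (pathMax_nonneg (hW.cont ω) (hW.zero ω))
      (pathMax_nonneg (hW.neg.cont ω) (hW.neg.zero ω)) hL
  simp only [h1]
  rw [lintegral_add_left (by fun_prop), lintegral_add_left (by fun_prop), e hW, e hW.neg,
    lintegral_lintegral_swap]
  swap; · exact (measurable_one.indicator hm).aemeasurable
  congr 1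
  refine lintegral_congr fun a ↦ ?_
  rw [altUnion_two hW, ← lintegral_indicator_one]
  · rfl
  · exact measurable_prodMk_right hm

/-- The substitution a ↦ L - a makes both halves equal to the same `I`, which is the difference of
consecutive values of `tailMean`; the alternating sum over j then simplifies. -/
lemma lintegral_gaussTail_pair (j : ℝ) {L : ℝ} (hL : 0 ≤ L) :
    ∃ I : ℝ≥0∞, ∫⁻ a in Set.Ioo 0 L, (gaussTail (a + j * L) + gaussTail (L - a + j * L)) = I + I ∧
      I + tailMean ((j + 1) * L) = tailMean (j * L) := by
  refine ⟨∫⁻ a in Set.Ioo 0 L, gaussTail (a + j * L), ?_, ?_⟩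
  · have hm : Measurable fun a ↦ gaussTail (a + j * L) :=
      measurable_gaussTail.comp (measurable_id.add_const _)
    rw [lintegral_add_left hm,
      lintegral_Ioo_reflect (fun a ↦ gaussTail (a + j * L))]
  · have := lintegral_gaussian_tail (j * L) hL
    rw [show (j + 1) * L = j * L + L by ring, ← this]
    simp only [gaussTail, add_comm]

/-- Bonferroni bounds for the tail integral of the range of Brownian motion. -/
lemma lintegral_range_sub_bounds (hW : IsNiceBrownian W P) {L : ℝ} (hL : 0 ≤ L) :
    4 * tailMean (1 * L) + 4 * tailMean (3 * L) ≤
      ∫⁻ ω, ENNReal.ofReal (range (W · ω) - L) ∂P + 4 * tailMean (2 * L) + 4 * tailMean (4 * L) ∧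
    ∫⁻ ω, ENNReal.ofReal (range (W · ω) - L) ∂P + 4 * tailMean (2 * L) ≤
      4 * tailMean (1 * L) + 4 * tailMean (3 * L) := by
  rw [lintegral_range_sub hW hL]
  set Q := ∫⁻ a in Set.Ioo 0 L, P (altUnion W 2 a (L - a)) with hQ
  obtain ⟨I1, e1, f1⟩ := lintegral_gaussTail_pair 1 hL
  obtain ⟨I2, e2, f2⟩ := lintegral_gaussTail_pair 2 hL
  obtain ⟨I3, e3, f3⟩ := lintegral_gaussTail_pair 3 hL
  obtain ⟨I4, e4, f4⟩ := lintegral_gaussTail_pair 4 hL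
  set g : ℝ → ℝ → ℝ≥0∞ := fun j a ↦ gaussTail (a + j * L) + gaussTail (L - a + j * L) with hg
  have hgm : ∀ j, Measurable (g j) := fun j ↦
    (measurable_gaussTail.comp (by fun_prop)).add (measurable_gaussTail.comp (by fun_prop))
  have hp : ∀ a ∈ Set.Ioo 0 L, ∀ k : ℕ, P (altUnion W (k + 1) a (L - a)) +
      P (altUnion W (k + 2) a (L - a)) = g k a := by
    intro a ha k
    rw [measure_altUnion_add hW k ha.1.le (by linarith [ha.2]), add_sub_cancel]
  -- With U_k the probability of `altUnion` of length k and g_k = U_(k+1) + U_(k+2), one has U_2 =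
  -- g_1 - g_2 + g_3 - g_4 + U_6 = g_1 - g_2 + g_3 - U_5. Dropping U_6 gives the lower bound,
  -- dropping U_5 the upper one. All is written additively to avoid truncated subtraction.
  have low : I1 + I1 + (I3 + I3) ≤ Q + (I2 + I2) + (I4 + I4) := by
    rw [← e1, ← e2, ← e3, ← e4, hQ, ← lintegral_add_left (hgm 1), ← lintegral_add_right _ (hgm 2),
      ← lintegral_add_right _ (hgm 4)]
    refine setLIntegral_mono' measurableSet_Ioo fun a ha ↦ ?_
    have h1 := hp a ha 1
    have h2 := hp a ha 2
    have h3 := hp a ha 3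
    have h4 := hp a ha 4
    norm_num at h1 h2 h3 h4
    simp only [hg] at h1 h2 h3 h4 ⊢
    rw [← h1, ← h2, ← h3, ← h4]
    have : P (altUnion W 2 a (L - a)) + (P (altUnion W 3 a (L - a)) + P (altUnion W 4 a (L - a))) +
        (P (altUnion W 5 a (L - a)) + P (altUnion W 6 a (L - a))) =
        P (altUnion W 2 a (L - a)) + P (altUnion W 3 a (L - a)) +
        (P (altUnion W 4 a (L - a)) + P (altUnion W 5 a (L - a))) +
        P (altUnion W 6 a (L - a)) := by ring
    rw [this]
    exact le_self_add
  have upp : Q + (I2 + I2) ≤ I1 + I1 + (I3 + I3) := by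
    rw [← e1, ← e2, ← e3, hQ, ← lintegral_add_left (hgm 1), ← lintegral_add_right _ (hgm 2)]
    refine setLIntegral_mono' measurableSet_Ioo fun a ha ↦ ?_
    have h1 := hp a ha 1
    have h2 := hp a ha 2
    have h3 := hp a ha 3
    norm_num at h1 h2 h3
    simp only [hg] at h1 h2 h3 ⊢
    rw [← h1, ← h2, ← h3]
    have : P (altUnion W 2 a (L - a)) + P (altUnion W 3 a (L - a)) +
        (P (altUnion W 4 a (L - a)) + P (altUnion W 5 a (L - a))) =
        P (altUnion W 2 a (L - a)) + (P (altUnion W 3 a (L - a)) + P (altUnion W 4 a (L - a))) +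
        P (altUnion W 5 a (L - a)) := by ring
    rw [this]
    exact le_self_add
  norm_num at f1 f2 f3 f4
  rw [one_mul]
  have hτ1 : tailMean L ≠ ∞ := (tailMean_lt_top hL).ne
  have hτ2 : tailMean (2 * L) ≠ ∞ := (tailMean_lt_top (by positivity)).ne
  have hτ3 : tailMean (3 * L) ≠ ∞ := (tailMean_lt_top (by positivity)).ne
  have hτ4 : tailMean (4 * L) ≠ ∞ := (tailMean_lt_top (by positivity)).ne
  have hτ5 : tailMean (5 * L) ≠ ∞ := (tailMean_lt_top (by positivity)).ne
  have hI : ∀ {I t s : ℝ≥0∞}, I + t = s → s ≠ ∞ → I ≠ ∞ := fun h hs ↦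
    ne_top_of_le_ne_top hs (h ▸ le_self_add)
  have hI1 := hI f1 hτ1
  have hI2 := hI f2 hτ2
  have hI3 := hI f3 hτ3
  have hI4 := hI f4 hτ4
  -- Everything is finite, so the rest is linear arithmetic over the reals. The remainders 2
  -- `tailMean (5 * L)` below and -2 `tailMean (4 * L)` above are dropped because of their signs.
  have hQt : Q ≠ ∞ := ne_top_of_le_ne_top (by finiteness) (le_self_add.trans upp)
  clear hp hQ
  clear_value Q
  lift Q to ℝ≥0 using hQt
  lift I1 to ℝ≥0 using hI1
  lift I2 to ℝ≥0 using hI2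
  lift I3 to ℝ≥0 using hI3
  lift I4 to ℝ≥0 using hI4
  generalize tailMean L = t1 at *
  generalize tailMean (2 * L) = t2 at *
  generalize tailMean (3 * L) = t3 at *
  generalize tailMean (4 * L) = t4 at *
  generalize tailMean (5 * L) = t5 at *
  lift t1 to ℝ≥0 using hτ1
  lift t2 to ℝ≥0 using hτ2
  lift t3 to ℝ≥0 using hτ3
  lift t4 to ℝ≥0 using hτ4
  lift t5 to ℝ≥0 using hτ5
  norm_cast at *
  rw [← NNReal.coe_inj] at f1 f2 f3 f4
  rw [← NNReal.coe_le_coe] at low upp ⊢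
  rw [← NNReal.coe_le_coe]
  push_cast at *
  have := t5.coe_nonneg
  constructor <;> linarith

/-- Two-sided bounds for `E (R - c)₊²`, with `R` the range of Brownian motion. -/
theorem lintegral_sq_range_sub_bounds (hW : IsNiceBrownian W P) {c : ℝ} (hc : 0 ≤ c) :
    4 * tailSq c + ENNReal.ofReal (4 / 3) * tailSq (3 * c) ≤
      ∫⁻ ω, ENNReal.ofReal (range (W · ω) - c) ^ 2 ∂P + 2 * tailSq (2 * c) + tailSq (4 * c) ∧
    ∫⁻ ω, ENNReal.ofReal (range (W · ω) - c) ^ 2 ∂P + 2 * tailSq (2 * c) ≤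
      4 * tailSq c + ENNReal.ofReal (4 / 3) * tailSq (3 * c) := by
  have hP := hW.isProbabilityMeasure
  have hm : ∀ k, Measurable fun L ↦ 4 * (2 * tailMean (k * L)) := fun k ↦
    ((measurable_tailMean_mul k).const_mul 2).const_mul 4
  -- Integrating twice the Bonferroni bounds over L > c turns 4 `tailMean (k * L)` into (4 / k)
  -- `tailSq (k * c)`, whence the coefficients 4, 2, 4/3 and 1.
  have key : ∀ k : ℝ, 0 < k → ENNReal.ofReal (4 / k) * tailSq (k * c) =
      ∫⁻ L in Set.Ioi c, 4 * (2 * tailMean (k * L)) := by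
    intro k hk
    rw [lintegral_const_mul _ ((measurable_tailMean_mul k).const_mul 2), lintegral_tailMean_mul hk,
      ← mul_assoc, show (4 : ℝ) / k = 4 * (1 / k) by ring, ENNReal.ofReal_mul (by norm_num)]
    simp
  have k1 := key 1 one_pos
  have k2 := key 2 two_pos
  have k3 := key 3 three_pos
  have k4 := key 4 four_pos
  norm_num at k1 k2 k4
  rw [lintegral_sq_ofReal_sub (measurable_range hW), k1, k2, k3, k4]
  rw [← lintegral_add_right _ (hm 3), ← lintegral_add_right _ (hm 2),
    ← lintegral_add_right _ (hm 4)]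
  constructor <;> refine setLIntegral_mono' measurableSet_Ioi fun L hL ↦ ?_
  · have := mul_le_mul_right (lintegral_range_sub_bounds hW (hc.trans hL.le)).1 2
    rw [one_mul] at this
    convert this using 1 <;> ring
  · have := mul_le_mul_right (lintegral_range_sub_bounds hW (hc.trans hL.le)).2 2
    rw [one_mul] at this
    convert this using 1 <;> ring

/-! ### Numerical evaluation of Gaussian tails. -/

/-- The partial sums of the exponential series of `-y` alternate around `exp (-y)`. -/
lemma neg_one_pow_mul_exp_neg_sub_sum_nonneg (n : ℕ) {y : ℝ} (hy : 0 ≤ y) :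
    0 ≤ (-1) ^ n * (Real.exp (-y) - ∑ i ∈ Finset.range n, (-y) ^ i / (i.factorial : ℝ)) := by
  induction n generalizing y with
  | zero => simpa using (Real.exp_pos _).le
  | succ n ih =>
    set F : ℕ → ℝ → ℝ := fun n y ↦
      (-1) ^ n * (Real.exp (-y) - ∑ i ∈ Finset.range n, (-y) ^ i / (i.factorial : ℝ)) with hF
    -- The signed remainder of order n + 1 vanishes at 0 and has the signed remainder of order n as
    -- its derivative, so nonnegativity propagates by monotonicity.
    have hd : ∀ x, HasDerivAt (F (n + 1)) (F n x) x := by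
      intro x
      have h1 : HasDerivAt (fun y : ℝ ↦ Real.exp (-y)) (-Real.exp (-x)) x := by
        simpa using (hasDerivAt_neg x).exp
      have h2 : HasDerivAt
          (fun y : ℝ ↦ ∑ i ∈ Finset.range (n + 1), (-y) ^ i / (i.factorial : ℝ))
          (-∑ i ∈ Finset.range n, (-x) ^ i / (i.factorial : ℝ)) x := by
        simp only [Finset.sum_range_succ', pow_zero, Nat.factorial_zero, Nat.cast_one, div_one]
        rw [← Finset.sum_neg_distrib]
        refine HasDerivAt.add_const _ (HasDerivAt.fun_sum fun i _ ↦ ?_)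
        have := ((hasDerivAt_neg x).pow (i + 1)).div_const ((i + 1).factorial : ℝ)
        refine this.congr_deriv ?_
        rw [Nat.factorial_succ]
        push_cast
        have : (i.factorial : ℝ) ≠ 0 := by positivity
        have : (i : ℝ) + 1 ≠ 0 := by positivity
        simp
        field_simp
      refine ((h1.sub h2).const_mul _).congr_deriv ?_
      rw [hF]
      ring
    have hmono : MonotoneOn (F (n + 1)) (Set.Ici 0) := by
      refine monotoneOn_of_deriv_nonneg (convex_Ici 0)
        (fun x _ ↦ (hd x).continuousAt.continuousWithinAt)
        (fun x _ ↦ (hd x).differentiableAt.differentiableWithinAt) fun x hx ↦ ?_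
      rw [interior_Ici] at hx
      rw [(hd x).deriv]
      exact ih hx.le
    have h0 : F (n + 1) 0 = 0 := by
      rw [hF]
      simp only [Finset.sum_range_succ']
      simp
    have := hmono (Set.self_mem_Ici) hy hy
    rwa [h0] at this

/-- The density of the standard normal law at `0`. -/
def gaussConst : ℝ := (√(2 * Real.pi))⁻¹

lemma gaussConst_pos : 0 < gaussConst := by
  unfold gaussConst; positivity

lemma integral_even_gaussian (f : ℝ → ℝ) :
    ∫ z, f |z| ∂gaussianReal 0 1 =
      2 * gaussConst * ∫ x in Set.Ioi 0, Real.exp (-x ^ 2 / 2) * f x := by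
  rw [integral_gaussianReal_eq_integral_smul one_ne_zero]
  have : (fun x : ℝ ↦ gaussianPDFReal 0 1 x • f |x|) =
      fun x ↦ (fun y ↦ gaussConst * (Real.exp (-y ^ 2 / 2) * f y)) |x| := by
    ext x
    simp only [gaussianPDFReal, gaussConst, sq_abs, smul_eq_mul]
    simp [mul_assoc]
  rw [this, integral_comp_abs (f := fun y ↦ gaussConst * (Real.exp (-y ^ 2 / 2) * f y)),
    integral_const_mul]
  ring

lemma integral_abs_gaussian : ∫ z, |z| ∂gaussianReal 0 1 = 2 * gaussConst := by
  rw [integral_even_gaussian (fun x ↦ x)]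
  have h : ∫ x in Set.Ioi (0 : ℝ), Real.exp (-x ^ 2 / 2) * x = 1 := by
    have hd : ∀ x ∈ Set.Ici (0 : ℝ), HasDerivAt (fun x : ℝ ↦ -Real.exp (-x ^ 2 / 2))
        (Real.exp (-x ^ 2 / 2) * x) x := by
      intro x _
      have h1 : HasDerivAt (fun x : ℝ ↦ -x ^ 2 / 2) (-x) x :=
        (((hasDerivAt_id' x).pow 2).neg.div_const 2).congr_deriv (by simp; ring)
      exact h1.exp.neg.congr_deriv (by ring)
    have ht : Tendsto (fun x : ℝ ↦ -Real.exp (-x ^ 2 / 2)) atTop (𝓝 (-0)) := by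
      refine (Real.tendsto_exp_atBot.comp ?_).neg
      have : Tendsto (fun x : ℝ ↦ x ^ 2 / 2) atTop atTop :=
        (tendsto_pow_atTop two_ne_zero).atTop_div_const two_pos
      refine (tendsto_neg_atTop_atBot.comp this).congr fun x ↦ ?_
      simp [neg_div]
    have := integral_Ioi_of_hasDerivAt_of_nonneg' (a := 0) hd
      (fun x hx ↦ mul_nonneg (Real.exp_pos _).le (le_of_lt hx)) ht
    rw [this]
    simp
  rw [h, mul_one]

/-- `∫₀ᵗ (t - y)² exp (-y² / 2) dy`. -/
def lowerPart (t : ℝ) : ℝ := ∫ y in (0 : ℝ)..t, (t - y) ^ 2 * Real.exp (-y ^ 2 / 2)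

lemma integral_sq_pos_gaussian {t : ℝ} (ht : 0 ≤ t) :
    ∫ z, (max (t - |z|) 0) ^ 2 ∂gaussianReal 0 1 = 2 * gaussConst * lowerPart t := by
  rw [integral_even_gaussian (fun x ↦ (max (t - x) 0) ^ 2), lowerPart,
    intervalIntegral.integral_of_le ht]
  congr 1
  rw [← integral_indicator measurableSet_Ioi, ← integral_indicator measurableSet_Ioc]
  congr 1
  ext x
  simp only [Set.indicator_apply, Set.mem_Ioi, Set.mem_Ioc]
  by_cases h1 : 0 < x
  · by_cases h2 : x ≤ t
    · simp only [h1, h2, and_self, if_true]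
      rw [max_eq_left (by linarith)]; ring
    · simp only [h1, h2, and_false, if_true, if_false]
      rw [max_eq_right (by linarith)]; ring
  · simp only [h1, false_and, if_false]

lemma integrable_gaussian_of_le {f : ℝ → ℝ} (hf : Measurable f) {C : ℝ}
    (h : ∀ z, |f z| ≤ C * (1 + z ^ 2)) : Integrable f (gaussianReal 0 1) := by
  have h2 : Integrable (fun z : ℝ ↦ z ^ 2) (gaussianReal 0 1) :=
    (memLp_id_gaussianReal (μ := 0) (v := 1) 2).integrable_sq
  refine (((integrable_const (1 : ℝ)).add h2).const_mul C).mono' hf.aestronglyMeasurable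
    (ae_of_all _ fun z ↦ ?_)
  simpa using h z

/-- Since (|z| - t)₊² = (|z| - t)² - (t - |z|)₊², the tail expectation is an explicit part, using E
N² = 1 and E |N| = 2 `gaussConst`, minus an integral over a compact interval, where Taylor expansion
gives rigorous bounds. -/
lemma tailSq_eq {t : ℝ} (ht : 0 ≤ t) :
    tailSq t = ENNReal.ofReal (1 + t ^ 2 - gaussConst * (4 * t + 2 * lowerPart t)) ∧
      0 ≤ 1 + t ^ 2 - gaussConst * (4 * t + 2 * lowerPart t) := by
  have i0 : Integrable (fun z : ℝ ↦ z ^ 2) (gaussianReal 0 1) :=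
    integrable_gaussian_of_le (by fun_prop) (C := 1) fun z ↦ by
      rw [abs_of_nonneg (by positivity)]; linarith
  have i1 : Integrable (fun z : ℝ ↦ |z|) (gaussianReal 0 1) :=
    integrable_gaussian_of_le (by fun_prop) (C := 1) fun z ↦ by
      rw [abs_abs]; nlinarith [sq_abs z, sq_nonneg (|z| - 1)]
  have i2 : Integrable (fun z : ℝ ↦ (max (t - |z|) 0) ^ 2) (gaussianReal 0 1) :=
    integrable_gaussian_of_le (by fun_prop) (C := t ^ 2) fun z ↦ by
      rw [abs_of_nonneg (by positivity)]
      have h1 : max (t - |z|) 0 ≤ t := max_le (by linarith [abs_nonneg z]) ht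
      have h2 : 0 ≤ max (t - |z|) 0 := le_max_right _ _
      nlinarith [mul_nonneg (sq_nonneg t) (sq_nonneg z)]
  have e : ∀ z : ℝ, (max (|z| - t) 0) ^ 2 =
      z ^ 2 - 2 * t * |z| + t ^ 2 - (max (t - |z|) 0) ^ 2 := by
    intro z
    rw [← sq_abs z]
    rcases le_total |z| t with h | h
    · rw [max_eq_right (by linarith), max_eq_left (by linarith)]; ring
    · rw [max_eq_left (by linarith), max_eq_right (by linarith)]; ring
  have i3 : Integrable (fun z : ℝ ↦ (max (|z| - t) 0) ^ 2) (gaussianReal 0 1) := by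
    simp only [e]
    exact ((i0.sub (i1.const_mul _)).add (integrable_const _)).sub i2
  have hsq : ∫ z, z ^ 2 ∂gaussianReal 0 1 = 1 := by
    have := variance_id_gaussianReal (μ := 0) (v := 1)
    rw [variance_eq_integral (by fun_prop)] at this
    simpa using this
  have hint : ∫ z, (max (|z| - t) 0) ^ 2 ∂gaussianReal 0 1 =
      1 + t ^ 2 - gaussConst * (4 * t + 2 * lowerPart t) := by
    simp only [e]
    have j1 : Integrable (fun z : ℝ ↦ z ^ 2 - 2 * t * |z|) (gaussianReal 0 1) :=
      i0.sub (i1.const_mul _)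
    have j2 : Integrable (fun z : ℝ ↦ z ^ 2 - 2 * t * |z| + t ^ 2) (gaussianReal 0 1) :=
      j1.add (integrable_const _)
    rw [integral_sub j2 i2, integral_add j1 (integrable_const _),
      integral_sub i0 (i1.const_mul _), integral_const_mul, hsq, integral_abs_gaussian,
      integral_sq_pos_gaussian ht]
    simp
    ring
  refine ⟨?_, ?_⟩
  · rw [← hint, ofReal_integral_eq_lintegral_ofReal i3 (ae_of_all _ fun z ↦ by positivity)]
    refine lintegral_congr fun z ↦ ?_
    rw [ENNReal.ofReal_pow (le_max_right _ _)]
    congr 1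
    rw [ENNReal.ofReal, ENNReal.ofReal, ← Real.toNNReal_coe (r := Real.toNNReal (|z| - t)),
      Real.coe_toNNReal']
  · rw [← hint]
    exact integral_nonneg fun z ↦ by positivity

/-- The Taylor approximation of `lowerPart`. -/
def lowerSum (n : ℕ) (t : ℝ) : ℝ :=
  ∑ i ∈ Finset.range n, (-1) ^ i / (2 ^ i * (i.factorial : ℝ)) *
    (2 * t ^ (2 * i + 3) / ((2 * i + 1) * (2 * i + 2) * (2 * i + 3)))

lemma integral_sub_sq_mul_pow (i : ℕ) (t : ℝ) :
    ∫ y in (0 : ℝ)..t, (t - y) ^ 2 * y ^ (2 * i) =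
      2 * t ^ (2 * i + 3) / ((2 * i + 1) * (2 * i + 2) * (2 * i + 3)) := by
  have : ∀ y : ℝ, (t - y) ^ 2 * y ^ (2 * i) =
      t ^ 2 * y ^ (2 * i) - 2 * t * y ^ (2 * i + 1) + y ^ (2 * i + 2) := fun y ↦ by ring
  simp only [this]
  rw [intervalIntegral.integral_add (Continuous.intervalIntegrable (by fun_prop) _ _)
    (Continuous.intervalIntegrable (by fun_prop) _ _),
    intervalIntegral.integral_sub (Continuous.intervalIntegrable (by fun_prop) _ _)
    (Continuous.intervalIntegrable (by fun_prop) _ _), intervalIntegral.integral_const_mul,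
    intervalIntegral.integral_const_mul, integral_pow, integral_pow, integral_pow]
  push_cast
  simp only [ne_eq, Nat.add_eq_zero_iff, one_ne_zero, and_false, not_false_eq_true, zero_pow,
    sub_zero]
  have h1 : (2 * (i : ℝ) + 1) ≠ 0 := by positivity
  have h2 : (2 * (i : ℝ) + 1 + 1) ≠ 0 := by positivity
  have h3 : (2 * (i : ℝ) + 2 + 1) ≠ 0 := by positivity
  have h4 : (2 * (i : ℝ) + 2) ≠ 0 := by positivity
  have h5 : (2 * (i : ℝ) + 3) ≠ 0 := by positivity
  field_simp
  ring

/-- The alternating Taylor bounds at y² / 2 are integrated against the nonnegative weight (t - y)².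
-/
lemma neg_one_pow_mul_lowerPart_sub_nonneg (n : ℕ) {t : ℝ} (ht : 0 ≤ t) :
    0 ≤ (-1) ^ n * (lowerPart t - lowerSum n t) := by
  have h1 : lowerSum n t = ∫ y in (0 : ℝ)..t, (t - y) ^ 2 *
      ∑ i ∈ Finset.range n, (-(y ^ 2 / 2)) ^ i / (i.factorial : ℝ) := by
    simp only [Finset.mul_sum]
    rw [intervalIntegral.integral_finsetSum
      fun i _ ↦ Continuous.intervalIntegrable (by fun_prop) _ _]
    refine Finset.sum_congr rfl fun i _ ↦ ?_
    rw [← integral_sub_sq_mul_pow, ← intervalIntegral.integral_const_mul]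
    congr 1
    ext y
    rw [neg_pow (y ^ 2 / 2), div_pow, ← pow_mul]
    field_simp
  rw [h1, lowerPart, ← intervalIntegral.integral_sub
    (Continuous.intervalIntegrable (by fun_prop) _ _)
    (Continuous.intervalIntegrable (by fun_prop) _ _), ← intervalIntegral.integral_const_mul]
  refine intervalIntegral.integral_nonneg ht fun y _ ↦ ?_
  have := neg_one_pow_mul_exp_neg_sub_sum_nonneg n (y := y ^ 2 / 2) (by positivity)
  have h2 : (-1) ^ n * ((t - y) ^ 2 * Real.exp (-y ^ 2 / 2) - (t - y) ^ 2 *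
      ∑ i ∈ Finset.range n, (-(y ^ 2 / 2)) ^ i / (i.factorial : ℝ)) = (t - y) ^ 2 *
      ((-1) ^ n * (Real.exp (-(y ^ 2 / 2)) -
        ∑ i ∈ Finset.range n, (-(y ^ 2 / 2)) ^ i / (i.factorial : ℝ))) := by
    rw [neg_div]; ring
  rw [h2]
  positivity

lemma lowerPart_le {n : ℕ} (hn : Odd n) {t : ℝ} (ht : 0 ≤ t) : lowerPart t ≤ lowerSum n t := by
  have := neg_one_pow_mul_lowerPart_sub_nonneg n ht
  rw [hn.neg_one_pow] at this
  linarith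

lemma le_lowerPart {n : ℕ} (hn : Even n) {t : ℝ} (ht : 0 ≤ t) : lowerSum n t ≤ lowerPart t := by
  have := neg_one_pow_mul_lowerPart_sub_nonneg n ht
  rw [hn.neg_one_pow] at this
  linarith

lemma gaussConst_sq : gaussConst ^ 2 = 1 / (2 * Real.pi) := by
  unfold gaussConst
  rw [inv_pow, Real.sq_sqrt (by positivity), one_div]

/-- A lower bound for this constant suffices on both sides: its coefficient is positive in the lower
estimate of the second moment and negative in the upper one. -/
lemma gaussConst_gt : (0.398942279 : ℝ) < gaussConst := by
  refine lt_of_pow_lt_pow_left₀ 2 gaussConst_pos.le ?_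
  rw [gaussConst_sq, lt_div_iff₀ (by positivity)]
  have := Real.pi_lt_d20
  norm_num at this ⊢
  linarith

set_option maxRecDepth 4000 in
-- An odd number of Taylor terms bounds `lowerPart` from above, an even number from below; the
-- parities follow the signs. The larger the argument, the more terms are needed.
lemma lowerSum_lower_bounds :
    4 * (4 * 0.976 + 2 * lowerSum 5 0.976) + 4 / 3 * (4 * (3 * 0.976) + 2 * lowerSum 17 (3 * 0.976))
      - 2 * (4 * (2 * 0.976) + 2 * lowerSum 10 (2 * 0.976))
      - (4 * (4 * 0.976) + 2 * lowerSum 26 (4 * 0.976)) ≤ -14.781265 := by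
  norm_num [lowerSum, Finset.sum_range_succ, Nat.factorial]

/-- The parities are opposite to those of the previous lemma, and no term in 4 · 0.976 occurs
because the upper Bonferroni bound stops one step earlier. -/
lemma lowerSum_upper_bounds :
    25.929 ≤ 4 * (4 * 0.976 + 2 * lowerSum 4 0.976)
      + 4 / 3 * (4 * (3 * 0.976) + 2 * lowerSum 14 (3 * 0.976))
      - 2 * (4 * (2 * 0.976) + 2 * lowerSum 7 (2 * 0.976)) := by
  norm_num [lowerSum, Finset.sum_range_succ, Nat.factorial]

/-- Numerical bounds for `E (R - 0.976)₊²`. -/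
theorem lintegral_sq_range_sub_numeric {Ω : Type*} {mΩ : MeasurableSpace Ω} {P : Measure Ω}
    {W : ℝ≥0 → Ω → ℝ} (hW : IsNiceBrownian W P) :
    ENNReal.ofReal 0.60959 ≤ ∫⁻ ω, ENNReal.ofReal (range (W · ω) - 0.976) ^ 2 ∂P ∧
      ∫⁻ ω, ENNReal.ofReal (range (W · ω) - 0.976) ^ 2 ∂P ≤ ENNReal.ofReal 0.6098 := by
  obtain ⟨hlow, hupp⟩ := lintegral_sq_range_sub_bounds hW (c := 0.976) (by norm_num)
  set E := ∫⁻ ω, ENNReal.ofReal (range (W · ω) - 0.976) ^ 2 ∂P with hE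
  clear_value E
  obtain ⟨e1, p1⟩ := tailSq_eq (t := 0.976) (by norm_num)
  obtain ⟨e2, p2⟩ := tailSq_eq (t := 2 * 0.976) (by norm_num)
  obtain ⟨e3, p3⟩ := tailSq_eq (t := 3 * 0.976) (by norm_num)
  obtain ⟨e4, p4⟩ := tailSq_eq (t := 4 * 0.976) (by norm_num)
  rw [e1, e2, e3] at hlow hupp
  rw [e4] at hlow
  have hEt : E ≠ ∞ := ne_top_of_le_ne_top (by finiteness) (le_self_add.trans hupp)
  have hE' : E = ENNReal.ofReal E.toReal := (ENNReal.ofReal_toReal hEt).symm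
  have hE0 : 0 ≤ E.toReal := ENNReal.toReal_nonneg
  rw [hE'] at hlow hupp ⊢
  generalize E.toReal = x at *
  have four : (4 : ℝ≥0∞) = ENNReal.ofReal 4 := by simp
  have two : (2 : ℝ≥0∞) = ENNReal.ofReal 2 := by simp
  rw [four, two, ← ENNReal.ofReal_mul (by norm_num), ← ENNReal.ofReal_mul (by norm_num),
    ← ENNReal.ofReal_mul (by norm_num), ← ENNReal.ofReal_add (by positivity) (by positivity),
    ← ENNReal.ofReal_add (by positivity) (by positivity)] at hlow hupp
  rw [← ENNReal.ofReal_add (by positivity) (by positivity),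
    ENNReal.ofReal_le_ofReal_iff (by positivity)] at hlow
  rw [ENNReal.ofReal_le_ofReal_iff (by positivity)] at hupp
  have b1 := lowerPart_le (n := 5) (by decide) (t := 0.976) (by norm_num)
  have b3 := lowerPart_le (n := 17) (by decide) (t := 3 * 0.976) (by norm_num)
  have b2 := le_lowerPart (n := 10) (by decide) (t := 2 * 0.976) (by norm_num)
  have b4 := le_lowerPart (n := 26) (by decide) (t := 4 * 0.976) (by norm_num)
  have c1 := le_lowerPart (n := 4) (by decide) (t := 0.976) (by norm_num)
  have c3 := le_lowerPart (n := 14) (by decide) (t := 3 * 0.976) (by norm_num)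
  have c2 := lowerPart_le (n := 7) (by decide) (t := 2 * 0.976) (by norm_num)
  have nl := lowerSum_lower_bounds
  have nu := lowerSum_upper_bounds
  have g0 := gaussConst_pos
  have g1 := gaussConst_gt
  generalize gaussConst = κ at *
  constructor
  · apply ENNReal.ofReal_le_ofReal
    have hB : 4 * (4 * 0.976 + 2 * lowerPart 0.976) +
        4 / 3 * (4 * (3 * 0.976) + 2 * lowerPart (3 * 0.976))
        - 2 * (4 * (2 * 0.976) + 2 * lowerPart (2 * 0.976))
        - (4 * (4 * 0.976) + 2 * lowerPart (4 * 0.976)) ≤ -14.781265 := by linarith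
    have := mul_le_mul_of_nonneg_left hB g0.le
    linarith
  · apply ENNReal.ofReal_le_ofReal
    have hB : 25.929 ≤ 4 * (4 * 0.976 + 2 * lowerPart 0.976)
        + 4 / 3 * (4 * (3 * 0.976) + 2 * lowerPart (3 * 0.976))
        - 2 * (4 * (2 * 0.976) + 2 * lowerPart (2 * 0.976)) := by linarith
    have := mul_le_mul_of_nonneg_left hB g0.le
    linarith

/-! ### Absolutely continuous functions and their energy. -/

lemma AbsolutelyContinuousOnInterval.congr {f g : ℝ → ℝ} {a b : ℝ}
    (hf : AbsolutelyContinuousOnInterval f a b) (h : Set.EqOn f g (Set.uIcc a b)) :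
    AbsolutelyContinuousOnInterval g a b := by
  rw [absolutelyContinuousOnInterval_iff] at hf ⊢
  intro ε hε
  obtain ⟨δ, hδ, H⟩ := hf ε hε
  refine ⟨δ, hδ, fun E hE hlen ↦ ?_⟩
  have := H E hE hlen
  convert this using 1
  refine Finset.sum_congr rfl fun i hi ↦ ?_
  rw [h (hE.1 i hi).1, h (hE.1 i hi).2]

lemma absolutelyContinuousOnInterval_const_add {f : ℝ → ℝ} {a b : ℝ} (c : ℝ)
    (hf : AbsolutelyContinuousOnInterval f a b) :
    AbsolutelyContinuousOnInterval (fun t ↦ c + f t) a b := by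
  rw [absolutelyContinuousOnInterval_iff] at hf ⊢
  simpa only [dist_add_left] using hf

lemma AbsolutelyContinuousOnInterval.eq_add_integral {h : ℝ → ℝ} {T t : ℝ}
    (hh : AbsolutelyContinuousOnInterval h 0 T) (ht : t ∈ Set.Icc 0 T) :
    h t = h 0 + ∫ s in (0 : ℝ)..t, deriv h s := by
  have : AbsolutelyContinuousOnInterval h 0 t := hh.mono (by
    rw [Set.uIcc_of_le ht.1, Set.uIcc_of_le (ht.1.trans ht.2)]
    exact Set.Icc_subset_Icc_right ht.2)
  rw [this.integral_deriv_eq_sub]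
  ring

lemma energy_eq_of_ae {T : ℝ} {h g : ℝ → ℝ}
    (hg : ∀ᵐ t, t ∈ Set.Ioo 0 T → HasDerivAt h (g t) t) :
    energy T h = ∫⁻ t in Set.Icc 0 T, ENNReal.ofReal (g t ^ 2) := by
  unfold energy
  rw [setLIntegral_congr (Ioo_ae_eq_Icc (a := (0 : ℝ)) (b := T)).symm,
    setLIntegral_congr (Ioo_ae_eq_Icc (a := (0 : ℝ)) (b := T)).symm]
  refine setLIntegral_congr_fun_ae measurableSet_Ioo ?_
  filter_upwards [hg] with t ht htm
  rw [(ht htm).deriv]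

lemma energy_congr {T : ℝ} {h g : ℝ → ℝ} (hg : Set.EqOn h g (Set.Ioo 0 T)) :
    energy T h = energy T g := by
  unfold energy
  rw [setLIntegral_congr (Ioo_ae_eq_Icc (a := (0 : ℝ)) (b := T)).symm,
    setLIntegral_congr (Ioo_ae_eq_Icc (a := (0 : ℝ)) (b := T)).symm]
  refine setLIntegral_congr_fun measurableSet_Ioo fun t ht ↦ ?_
  have : h =ᶠ[𝓝 t] g := hg.eventuallyEq_of_mem (isOpen_Ioo.mem_nhds ht)
  simp only [this.deriv_eq]

/-- Primitives of integrable functions are absolutely continuous, with the expected energy. -/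
lemma primitive_props {g : ℝ → ℝ} {T : ℝ} (hT : 0 ≤ T) (hg : IntervalIntegrable g volume 0 T)
    (c : ℝ) :
    AbsolutelyContinuousOnInterval (fun t ↦ c + ∫ s in (0 : ℝ)..t, g s) 0 T ∧
      energy T (fun t ↦ c + ∫ s in (0 : ℝ)..t, g s) =
        ∫⁻ t in Set.Icc 0 T, ENNReal.ofReal (g t ^ 2) := by
  refine ⟨absolutelyContinuousOnInterval_const_add c
    (hg.absolutelyContinuousOnInterval_intervalIntegral Set.left_mem_uIcc), energy_eq_of_ae ?_⟩
  filter_upwards [hg.ae_hasDerivAt_integral] with t ht htm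
  rw [Set.uIcc_of_le hT] at ht
  exact (ht (Set.Ioo_subset_Icc_self htm) 0 (Set.left_mem_Icc.2 hT)).const_add c

/-- The composition is recognised as the primitive of t ↦ c h'(ct + d); `primitive_props` then
yields both claims at once. -/
lemma absolutelyContinuousOnInterval_comp_affine {h : ℝ → ℝ} {c d L T : ℝ} (hc : 0 < c)
    (hd : 0 ≤ d) (hL : 0 ≤ L) (hT : c * L + d ≤ T) (hh : AbsolutelyContinuousOnInterval h 0 T) :
    AbsolutelyContinuousOnInterval (fun t ↦ h (c * t + d)) 0 L ∧
      energy L (fun t ↦ h (c * t + d)) =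
        ∫⁻ t in Set.Icc 0 L, ENNReal.ofReal ((c * deriv h (c * t + d)) ^ 2) := by
  have hT0 : 0 ≤ T := le_trans (by positivity) hT
  have hI : IntervalIntegrable (deriv h) volume d (c * L + d) :=
    hh.intervalIntegrable_deriv.mono_set (by
      rw [Set.uIcc_of_le hT0, Set.uIcc_of_le (le_add_of_nonneg_left (by positivity))]
      exact Set.Icc_subset_Icc hd hT)
  have hI' : IntervalIntegrable (fun s ↦ c * deriv h (c * s + d)) volume 0 L := by
    have := hI.comp_add_right d
    rw [sub_self, add_sub_cancel_right] at this
    have h2 := (this.comp_mul_left (c := c))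
    rw [zero_div, mul_div_cancel_left₀ L hc.ne'] at h2
    exact h2.const_mul c
  have heq : Set.EqOn (fun t ↦ h d + ∫ s in (0 : ℝ)..t, c * deriv h (c * s + d))
      (fun t ↦ h (c * t + d)) (Set.Icc 0 L) := by
    intro t ht
    have hle : c * t + d ≤ T := le_trans (by gcongr; exact ht.2) hT
    have hnn : 0 ≤ c * t := mul_nonneg hc.le ht.1
    simp only
    rw [intervalIntegral.integral_const_mul, intervalIntegral.mul_integral_comp_mul_add,
      mul_zero, zero_add]
    have : AbsolutelyContinuousOnInterval h d (c * t + d) := hh.mono (by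
      rw [Set.uIcc_of_le hT0, Set.uIcc_of_le (le_add_of_nonneg_left hnn)]
      exact Set.Icc_subset_Icc hd hle)
    rw [this.integral_deriv_eq_sub]
    ring
  obtain ⟨h1, h2⟩ := primitive_props hL hI' (h d)
  refine ⟨AbsolutelyContinuousOnInterval.congr h1 (by rwa [Set.uIcc_of_le hL]), ?_⟩
  rw [← h2]
  exact (energy_congr (heq.mono Set.Ioo_subset_Icc_self)).symm

lemma lintegral_Icc_add {f : ℝ → ℝ≥0∞} {S L : ℝ} (hS : 0 ≤ S) (hL : 0 ≤ L) :
    ∫⁻ t in Set.Icc 0 (S + L), f t =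
      (∫⁻ t in Set.Icc 0 S, f t) + ∫⁻ t in Set.Icc 0 L, f (t + S) := by
  have h1 : ∫⁻ t in Set.Icc 0 L, f (t + S) = ∫⁻ t in Set.Icc S (S + L), f t := by
    have h := (measurePreserving_add_right (volume : Measure ℝ) S).setLIntegral_comp_preimage_emb
      (MeasurableEquiv.addRight S).measurableEmbedding f (Set.Icc S (S + L))
    have e : (fun x ↦ x + S) ⁻¹' Set.Icc S (S + L) = Set.Icc 0 L := by
      ext x; simp [add_comm S L]
    rwa [e] at h
  have h2 : Set.Icc 0 (S + L) = Set.Icc 0 S ∪ Set.Ioc S (S + L) := by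
    rw [Set.Icc_union_Ioc_eq_Icc hS (by linarith)]
  rw [h1, h2, lintegral_union measurableSet_Ioc, setLIntegral_congr (Ioc_ae_eq_Icc)]
  rw [Set.disjoint_left]
  intro x hx hx'
  exact absurd hx.2 (not_le.2 hx'.1)

/-- Concatenation of absolutely continuous functions. -/
lemma exists_concat {h₁ h₂ : ℝ → ℝ} {S L : ℝ} (hS : 0 ≤ S) (hL : 0 ≤ L)
    (ac₁ : AbsolutelyContinuousOnInterval h₁ 0 S) (ac₂ : AbsolutelyContinuousOnInterval h₂ 0 L)
    (h0 : h₂ 0 = 0) :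
    ∃ h : ℝ → ℝ, AbsolutelyContinuousOnInterval h 0 (S + L) ∧
      (∀ t ∈ Set.Icc 0 S, h t = h₁ t) ∧ (∀ t ∈ Set.Icc 0 L, h (t + S) = h₁ S + h₂ t) ∧
      energy (S + L) h = energy S h₁ + energy L h₂ := by
  -- The derivatives are glued rather than the functions: the primitive is then absolutely
  -- continuous for free, and the value at the junction is irrelevant.
  set γ : ℝ → ℝ := fun t ↦ if t ≤ S then deriv h₁ t else deriv h₂ (t - S) with hγ
  have i1 : IntervalIntegrable γ volume 0 S := by
    refine ac₁.intervalIntegrable_deriv.congr fun t ht ↦ ?_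
    rw [Set.uIoc_of_le hS] at ht
    simp [hγ, ht.2]
  have i2 : IntervalIntegrable γ volume S (S + L) := by
    have := ac₂.intervalIntegrable_deriv.comp_sub_right S
    rw [zero_add, add_comm L S] at this
    refine this.congr fun t ht ↦ ?_
    rw [Set.uIoc_of_le (by linarith)] at ht
    simp [hγ, not_le.2 ht.1]
  have hI := i1.trans i2
  obtain ⟨p1, p2⟩ := primitive_props (add_nonneg hS hL) hI (h₁ 0)
  have e1 : ∀ t ∈ Set.Icc 0 S, h₁ 0 + ∫ s in (0 : ℝ)..t, γ s = h₁ t := by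
    intro t ht
    rw [AbsolutelyContinuousOnInterval.eq_add_integral ac₁ ht]
    congr 1
    refine intervalIntegral.integral_congr fun s hs ↦ ?_
    rw [Set.uIcc_of_le ht.1] at hs
    simp [hγ, hs.2.trans ht.2]
  refine ⟨_, p1, e1, fun t ht ↦ ?_, ?_⟩
  · have := e1 S ⟨hS, le_rfl⟩
    have i2' : IntervalIntegrable γ volume S (t + S) := i2.mono_set (by
      rw [Set.uIcc_of_le (by linarith [ht.1]), Set.uIcc_of_le (by linarith)]
      exact Set.Icc_subset_Icc_right (by linarith [ht.2]))
    rw [← intervalIntegral.integral_add_adjacent_intervals i1 i2', ← add_assoc, this]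
    congr 1
    rw [AbsolutelyContinuousOnInterval.eq_add_integral ac₂ ht, h0, zero_add]
    have e2 : ∫ s in S..(t + S), γ s = ∫ s in S..(t + S), deriv h₂ (s - S) := by
      refine intervalIntegral.integral_congr_ae (ae_of_all _ fun s hs ↦ ?_)
      rw [Set.uIoc_of_le (by linarith [ht.1])] at hs
      simp [hγ, not_le.2 hs.1]
    rw [e2, intervalIntegral.integral_comp_sub_right (fun s ↦ deriv h₂ s), sub_self,
      add_sub_cancel_right]
  · rw [p2, lintegral_Icc_add hS hL]
    unfold energy
    congr 1
    · refine setLIntegral_congr_fun measurableSet_Icc fun t ht ↦ ?_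
      simp [hγ, ht.2]
    · rw [setLIntegral_congr (Ioc_ae_eq_Icc (a := (0 : ℝ)) (b := L)).symm,
        setLIntegral_congr (Ioc_ae_eq_Icc (a := (0 : ℝ)) (b := L)).symm]
      refine setLIntegral_congr_fun measurableSet_Ioc fun t ht ↦ ?_
      simp [hγ, not_le.2 ht.1]

lemma ofReal_sq_eq_enorm_sq (x : ℝ) : ENNReal.ofReal (x ^ 2) = ‖x‖ₑ ^ 2 := by
  rw [← sq_abs, ENNReal.ofReal_pow (abs_nonneg x), ← Real.norm_eq_abs, ofReal_norm]

/-- Cauchy–Schwarz: the increment of a primitive is controlled by the square integral. -/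
lemma sq_integral_le {g : ℝ → ℝ} {T s t : ℝ} (hs : 0 ≤ s) (hst : s ≤ t) (ht : t ≤ T)
    (hg : AEMeasurable g (volume.restrict (Set.Icc 0 T))) :
    ENNReal.ofReal ((∫ u in s..t, g u) ^ 2) ≤
      ENNReal.ofReal T * ∫⁻ u in Set.Icc 0 T, ENNReal.ofReal (g u ^ 2) := by
  set μ : Measure ℝ := volume.restrict (Set.Icc 0 T) with hμ
  have h1 : ‖∫ u in s..t, g u‖ₑ ≤ ∫⁻ u, ‖g u‖ₑ ∂μ := by
    rw [intervalIntegral.integral_of_le hst]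
    refine (enorm_integral_le_lintegral_enorm _).trans ?_
    exact lintegral_mono' (Measure.restrict_mono
      (Set.Ioc_subset_Icc_self.trans (Set.Icc_subset_Icc hs ht)) le_rfl) le_rfl
  have h2 : ∫⁻ u, ‖g u‖ₑ ∂μ ≤ (∫⁻ u, ‖g u‖ₑ ^ (2 : ℝ) ∂μ) ^ (1 / 2 : ℝ) * (∫⁻ _, 1 ∂μ) ^ (1 / 2 : ℝ) := by
    have := ENNReal.lintegral_mul_le_Lp_mul_Lq μ (p := 2) (q := 2) (by constructor <;> norm_num)
      (f := fun u ↦ ‖g u‖ₑ) (g := fun _ ↦ 1) hg.enorm aemeasurable_const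
    simpa using this
  have h3 : (∫⁻ u, ‖g u‖ₑ ∂μ) ^ 2 ≤ (∫⁻ u, ‖g u‖ₑ ^ (2 : ℝ) ∂μ) * ∫⁻ _, 1 ∂μ := by
    refine (pow_le_pow_left' h2 2).trans_eq ?_
    rw [mul_pow, ← ENNReal.rpow_natCast, ← ENNReal.rpow_natCast, ← ENNReal.rpow_mul,
      ← ENNReal.rpow_mul]
    norm_num
  rw [ofReal_sq_eq_enorm_sq]
  refine (pow_le_pow_left' h1 2).trans (h3.trans_eq ?_)
  rw [mul_comm, lintegral_one, hμ, Measure.restrict_apply_univ, Real.volume_Icc, sub_zero]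
  congr 1
  refine lintegral_congr fun u ↦ ?_
  rw [ofReal_sq_eq_enorm_sq]
  norm_num

lemma aemeasurable_deriv (h : ℝ → ℝ) (μ : Measure ℝ) : AEMeasurable (deriv h) μ :=
  (measurable_deriv h).aemeasurable

lemma sq_sub_le_energy {h : ℝ → ℝ} {T s t : ℝ} (hh : AbsolutelyContinuousOnInterval h 0 T)
    (hs : s ∈ Set.Icc 0 T) (ht : t ∈ Set.Icc 0 T) :
    ENNReal.ofReal ((h t - h s) ^ 2) ≤ ENNReal.ofReal T * energy T h := by
  wlog hst : s ≤ t generalizing s t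
  · rw [← neg_sub, neg_sq]
    exact this ht hs (not_le.1 hst).le
  have hac : AbsolutelyContinuousOnInterval h s t := hh.mono (by
    rw [Set.uIcc_of_le hst, Set.uIcc_of_le (hs.1.trans hs.2)]
    exact Set.Icc_subset_Icc hs.1 ht.2)
  rw [← hac.integral_deriv_eq_sub]
  exact sq_integral_le hs.1 hst ht.2 (aemeasurable_deriv h _)

/-! ### Tube energies: superadditivity and subadditivity. -/

/-- `h` is absolutely continuous on `[0, T]` and stays within uniform distance `r` of `w`. -/
def InTube (w : ℝ≥0 → ℝ) (T : ℝ≥0) (r : ℝ) (h : ℝ → ℝ) : Prop :=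
  AbsolutelyContinuousOnInterval h 0 T ∧ ∀ t : ℝ≥0, t ≤ T → |h t - w t| ≤ r

/-- The minimal energy of a function in the tube around `w` whose starting point differs from that
of `w` by an element of `S`. -/
def tubeEnergy (S : Set ℝ) (w : ℝ≥0 → ℝ) (T : ℝ≥0) (r : ℝ) : ℝ≥0∞ :=
  ⨅ (h : ℝ → ℝ) (_ : InTube w T r h ∧ h 0 - w 0 ∈ S), energy T h

/-- The minimal energy of a function in the tube around `w` with the same end points as `w`. -/
def bridgeEnergy (w : ℝ≥0 → ℝ) (T : ℝ≥0) (r : ℝ) : ℝ≥0∞ :=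
  ⨅ (h : ℝ → ℝ) (_ : InTube w T r h ∧ h 0 = w 0 ∧ h T = w T), energy T h

/-- The increments of a path after time `s`. -/
def shiftPath (s : ℝ≥0) (w : ℝ≥0 → ℝ) (t : ℝ≥0) : ℝ := w (s + t) - w s

/-- The square root is an order isomorphism of [0, ∞], so it commutes with the infimum. All limits
are then taken for the energy, which is additive in time, and not for the norm. -/
lemma minNorm_eq {w : ℝ≥0 → ℝ} (h0 : w 0 = 0) (T : ℝ≥0) (r : ℝ) :
    minNorm w T r = tubeEnergy {0} w T r ^ (1 / 2 : ℝ) := by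
  have hi : ∀ f : (ℝ → ℝ) → ℝ≥0∞, ∀ p : (ℝ → ℝ) → Prop,
      (⨅ (h : ℝ → ℝ) (_ : p h), f h) ^ (1 / 2 : ℝ) = ⨅ (h : ℝ → ℝ) (_ : p h), f h ^ (1 / 2 : ℝ) := by
    intro f p
    have h1 : (0 : ℝ) < 1 / 2 := by norm_num
    have h2 : ∀ {ι : Type} (g : ι → ℝ≥0∞), (⨅ i, g i) ^ (1 / 2 : ℝ) = ⨅ i, g i ^ (1 / 2 : ℝ) :=
      fun g ↦ (ENNReal.orderIsoRpow (1 / 2 : ℝ) h1).map_iInf g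
    have h3 : ∀ {q : Prop} (g : q → ℝ≥0∞), (⨅ i, g i) ^ (1 / 2 : ℝ) = ⨅ i, g i ^ (1 / 2 : ℝ) :=
      fun g ↦ (ENNReal.orderIsoRpow (1 / 2 : ℝ) h1).map_iInf g
    simp only [h2, h3]
  rw [minNorm, tubeEnergy, hi]
  refine iInf_congr fun h ↦ iInf_congr_Prop ?_ fun _ ↦ rfl
  simp only [Admissible, InTube, h0, sub_zero, Set.mem_singleton_iff, NNReal.coe_le_coe]
  tauto

lemma tubeEnergy_le {S : Set ℝ} {w : ℝ≥0 → ℝ} {T : ℝ≥0} {r : ℝ} {h : ℝ → ℝ} (hh : InTube w T r h)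
    (hS : h 0 - w 0 ∈ S) : tubeEnergy S w T r ≤ energy T h :=
  iInf₂_le h ⟨hh, hS⟩

lemma tubeEnergy_anti {S S' : Set ℝ} (hS : S ⊆ S') (w : ℝ≥0 → ℝ) (T : ℝ≥0) (r : ℝ) :
    tubeEnergy S' w T r ≤ tubeEnergy S w T r :=
  le_iInf₂ fun _ hh ↦ tubeEnergy_le hh.1 (hS hh.2)

lemma energy_mono {S T : ℝ} (hST : S ≤ T) (h : ℝ → ℝ) : energy S h ≤ energy T h :=
  lintegral_mono_set (Set.Icc_subset_Icc_right hST)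

lemma InTube.mono {w : ℝ≥0 → ℝ} {S T : ℝ≥0} {r : ℝ} {h : ℝ → ℝ} (hST : S ≤ T)
    (hh : InTube w T r h) : InTube w S r h := by
  refine ⟨hh.1.mono ?_, fun t ht ↦ hh.2 t (ht.trans hST)⟩
  rw [Set.uIcc_of_le S.coe_nonneg, Set.uIcc_of_le T.coe_nonneg]
  exact Set.Icc_subset_Icc_right hST

lemma tubeEnergy_mono (S : Set ℝ) (w : ℝ≥0 → ℝ) {T T' : ℝ≥0} (hT : T ≤ T') (r : ℝ) :
    tubeEnergy S w T r ≤ tubeEnergy S w T' r :=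
  le_iInf₂ fun h hh ↦ (tubeEnergy_le (hh.1.mono hT) hh.2).trans (energy_mono hT h)

lemma tubeEnergy_le_bridgeEnergy (w : ℝ≥0 → ℝ) (T : ℝ≥0) (r : ℝ) :
    tubeEnergy {0} w T r ≤ bridgeEnergy w T r :=
  le_iInf₂ fun h hh ↦ tubeEnergy_le hh.1 (by simp [hh.2.1])

/-- Superadditivity. -/
lemma tubeEnergy_add_le (S : Set ℝ) (w : ℝ≥0 → ℝ) (s L : ℝ≥0) (r : ℝ) :
    tubeEnergy S w s r + tubeEnergy Set.univ (shiftPath s w) L r ≤ tubeEnergy S w (s + L) r := by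
  refine le_iInf₂ fun h hh ↦ ?_
  have h1 := tubeEnergy_le (hh.1.mono (S := s) le_self_add) hh.2
  -- The restriction to [s, s + L], moved back to time 0 and lowered by `w s`, lies in the tube
  -- around the increments. Its starting point is not controlled, hence the free condition
  -- `Set.univ`.
  obtain ⟨ac, he⟩ := absolutelyContinuousOnInterval_comp_affine (h := h) (c := 1) (d := s) (L := L)
    (T := (s + L : ℝ≥0)) one_pos s.coe_nonneg L.coe_nonneg (by push_cast; linarith) hh.1.1
  have ht : InTube (shiftPath s w) L r (fun t ↦ -w s + h (1 * t + s)) := by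
    refine ⟨absolutelyContinuousOnInterval_const_add _ ac, fun t ht ↦ ?_⟩
    have := hh.1.2 (s + t) (by gcongr)
    rw [shiftPath]
    push_cast at this
    convert this using 2
    simp only [one_mul, add_comm (t : ℝ)]
    ring
  have h2 := tubeEnergy_le (S := Set.univ) ht (Set.mem_univ _)
  have h3 : energy L (fun t ↦ -w s + h (1 * t + s)) = energy L (fun t ↦ h (1 * t + s)) := by
    unfold energy
    refine lintegral_congr fun t ↦ ?_
    rw [deriv_const_add]
  rw [h3, he] at h2
  refine (add_le_add h1 h2).trans_eq ?_
  simp only [one_mul]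
  unfold energy
  rw [NNReal.coe_add, lintegral_Icc_add s.coe_nonneg L.coe_nonneg]

/-- Superadditivity over `n` blocks. -/
lemma sum_tubeEnergy_le (S : Set ℝ) (w : ℝ≥0 → ℝ) (L : ℝ≥0) (r : ℝ) (n : ℕ) :
    ∑ i ∈ Finset.range n, tubeEnergy Set.univ (shiftPath (i * L) w) L r ≤
      tubeEnergy S w (n * L) r := by
  induction n with
  | zero => simp
  | succ n ih =>
    rw [Finset.sum_range_succ]
    refine (add_le_add_left ih _).trans ((tubeEnergy_add_le S w _ L r).trans_eq ?_)
    congr 1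
    push_cast; ring

/-- Subadditivity. -/
lemma bridgeEnergy_add_le (w : ℝ≥0 → ℝ) (s L : ℝ≥0) (r : ℝ) :
    bridgeEnergy w (s + L) r ≤ bridgeEnergy w s r + bridgeEnergy (shiftPath s w) L r := by
  conv_rhs => rw [bridgeEnergy, bridgeEnergy]
  simp only [ENNReal.iInf_add, ENNReal.add_iInf]
  refine le_iInf₂ fun h₂ H₂ ↦ le_iInf₂ fun h₁ H₁ ↦ ?_
  -- Both pieces agree with the path at the junction, so they can be joined with no extra energy.
  obtain ⟨h, ac, e1, e2, he⟩ := exists_concat s.coe_nonneg L.coe_nonneg H₁.1.1 H₂.1.1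
    (by rw [H₂.2.1]; simp [shiftPath])
  rw [← he, ← NNReal.coe_add]
  refine iInf₂_le h ⟨⟨by push_cast; exact ac, fun t ht ↦ ?_⟩, ?_, ?_⟩
  · rcases le_total t s with hts | hts
    · rw [e1 t ⟨t.coe_nonneg, by exact_mod_cast hts⟩]
      exact H₁.1.2 t hts
    · obtain ⟨u, rfl⟩ := exists_add_of_le hts
      have hu : u ≤ L := by simpa using ht
      have := e2 u ⟨u.coe_nonneg, by exact_mod_cast hu⟩
      rw [NNReal.coe_add, add_comm, this, H₁.2.2]
      have := H₂.1.2 u hu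
      rw [shiftPath] at this
      convert this using 2
      ring
  · rw [e1 0 ⟨le_rfl, s.coe_nonneg⟩, H₁.2.1]
  · have := e2 L ⟨L.coe_nonneg, le_rfl⟩
    rw [NNReal.coe_add, add_comm, this, H₁.2.2, H₂.2.2, shiftPath]
    ring

lemma bridgeEnergy_zero (w : ℝ≥0 → ℝ) {r : ℝ} (hr : 0 ≤ r) : bridgeEnergy w 0 r = 0 := by
  refine le_antisymm ?_ zero_le
  have ac : AbsolutelyContinuousOnInterval (fun _ ↦ w 0) (0 : ℝ) (0 : ℝ≥0) :=
    ((LipschitzWith.const (w 0)).lipschitzOnWith (s := Set.uIcc (0 : ℝ) (0 : ℝ≥0))).absolutelyContinuousOnInterval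
  have hin : InTube w 0 r fun _ ↦ w 0 := ⟨ac, fun t ht ↦ by
    rw [nonpos_iff_eq_zero.1 ht]; simpa using hr⟩
  refine (iInf₂_le (fun _ ↦ w 0) ⟨hin, rfl, rfl⟩).trans ?_
  simp [energy]

lemma bridgeEnergy_le_sum (w : ℝ≥0 → ℝ) (L : ℝ≥0) {r : ℝ} (hr : 0 ≤ r) (n : ℕ) :
    bridgeEnergy w (n * L) r ≤ ∑ i ∈ Finset.range n, bridgeEnergy (shiftPath (i * L) w) L r := by
  induction n with
  | zero => simp [bridgeEnergy_zero w hr]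
  | succ n ih =>
    rw [Finset.sum_range_succ]
    refine le_trans (le_of_eq ?_) ((bridgeEnergy_add_le w (n * L) L r).trans (add_le_add_left ih _))
    congr 1
    push_cast; ring

/-! ### Lipschitz approximants and the cost of pinning the end points. -/

/-- The oscillation of `w` on each of the `m` cells of mesh `δ` is at most `ρ`. -/
def SmallOsc (w : ℝ≥0 → ℝ) (m : ℕ) (δ : ℝ≥0) (ρ : ℝ) : Prop :=
  ∀ i < m, ∀ t ≤ δ, |w (i * δ + t) - w (i * δ)| ≤ ρ

/-- A path with small oscillation on the cells of a grid is close to a Lipschitz function. -/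
lemma SmallOsc.exists_lipschitz {w : ℝ≥0 → ℝ} {m : ℕ} {δ : ℝ≥0} {ρ : ℝ≥0} (hδ : 0 < δ)
    (h : SmallOsc w m δ ρ) :
    ∃ k : ℝ → ℝ, LipschitzWith (ρ / δ) k ∧ InTube w (m * δ) (2 * ρ) k ∧ k 0 = w 0 ∧
      k ((m * δ : ℝ≥0) : ℝ) = w (m * δ) := by
  have hδ' : (0 : ℝ) < δ := hδ
  set s : Set ℝ := {x | ∃ i ≤ m, x = i * δ} with hs
  have hinc : ∀ i j : ℕ, i ≤ j → j ≤ m → |w (j * δ) - w (i * δ)| ≤ (j - i : ℝ) * ρ := by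
    intro i j hij
    induction j, hij using Nat.le_induction with
    | base => simp
    | succ j hij ih =>
      intro hj
      have h1 := ih (by omega)
      have h2 := h j (by omega) δ le_rfl
      have e : ((j + 1 : ℕ) : ℝ≥0) * δ = j * δ + δ := by push_cast; ring
      rw [e]
      have h3 := abs_add_le (w (j * δ + δ) - w (j * δ)) (w (j * δ) - w (i * δ))
      rw [sub_add_sub_cancel] at h3
      push_cast
      linarith
  -- On the grid the path is Lipschitz with constant ρ / δ, and such a function extends to the line
  -- with the same constant. Within a cell the path and the extension each move by at most ρ, which
  -- gives the radius 2ρ.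
  have hL : LipschitzOnWith (ρ / δ) (fun x : ℝ ↦ w x.toNNReal) s := by
    refine LipschitzOnWith.of_dist_le_mul ?_
    have key : ∀ i j : ℕ, i ≤ j → j ≤ m →
        |w ((j : ℝ) * δ).toNNReal - w ((i : ℝ) * δ).toNNReal| ≤ (ρ / δ : ℝ) * |(j : ℝ) * δ - i * δ| := by
      intro i j hij hj
      have e : ∀ i : ℕ, ((i : ℝ) * δ).toNNReal = i * δ := fun i ↦ by
        rw [Real.toNNReal_mul (by positivity)]; simp
      rw [e, e]
      refine (hinc i j hij hj).trans_eq ?_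
      have : (i : ℝ) ≤ j := by exact_mod_cast hij
      rw [← sub_mul, abs_mul, abs_of_nonneg (sub_nonneg.2 this), abs_of_pos hδ']
      field_simp
    rintro _ ⟨i, hi, rfl⟩ _ ⟨j, hj, rfl⟩
    rw [Real.dist_eq, Real.dist_eq, NNReal.coe_div]
    rcases le_total i j with hij | hij
    · rw [abs_sub_comm, abs_sub_comm (_ * _ : ℝ)]
      exact key i j hij hj
    · exact key j i hij hi
  obtain ⟨k, hk, hkeq⟩ := hL.extend_real
  have hgrid : ∀ i : ℕ, i ≤ m → k ((i * δ : ℝ≥0) : ℝ) = w (i * δ) := by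
    intro i hi
    have := hkeq (show ((i * δ : ℝ≥0) : ℝ) ∈ s from ⟨i, hi, by push_cast; ring⟩)
    simp only [Real.toNNReal_coe] at this
    exact this.symm
  refine ⟨k, hk, ⟨hk.lipschitzOnWith.absolutelyContinuousOnInterval, fun t ht ↦ ?_⟩, ?_, hgrid m le_rfl⟩
  · have hcell : ∃ i : ℕ, i ≤ m ∧ i * δ ≤ t ∧ |w t - w (i * δ)| ≤ ρ ∧ t ≤ i * δ + δ := by
      rcases eq_or_lt_of_le ht with rfl | hlt
      · exact ⟨m, le_rfl, le_rfl, by simp, le_self_add⟩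
      · obtain ⟨i, hi⟩ : ∃ i, i = ⌊t / δ⌋₊ := ⟨_, rfl⟩
        have h1 : (i : ℝ≥0) * δ ≤ t := by
          rw [← le_div_iff₀ hδ, hi]; exact Nat.floor_le zero_le
        have h2 : t < (i + 1) * δ := by
          rw [← div_lt_iff₀ hδ, hi]; exact Nat.lt_floor_add_one _
        have h3 : i < m := by
          have := lt_of_le_of_lt h1 hlt
          exact_mod_cast lt_of_mul_lt_mul_right this zero_le
        obtain ⟨u, rfl⟩ := exists_add_of_le h1
        have hu : u ≤ δ := by
          rw [add_mul, one_mul] at h2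
          exact (lt_of_add_lt_add_left h2).le
        exact ⟨i, h3.le, h1, h i h3 u hu, by gcongr⟩
    obtain ⟨i, him, hit, hosc, htd⟩ := hcell
    have h1 := hk.dist_le_mul (t : ℝ) ((i * δ : ℝ≥0) : ℝ)
    rw [hgrid i him, Real.dist_eq, Real.dist_eq] at h1
    have h2 : |(t : ℝ) - ((i * δ : ℝ≥0) : ℝ)| ≤ δ := by
      rw [abs_of_nonneg (sub_nonneg.2 (by exact_mod_cast hit))]
      have : (t : ℝ) ≤ ((i * δ : ℝ≥0) : ℝ) + δ := by exact_mod_cast htd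
      linarith
    have h3 : ((ρ / δ : ℝ≥0) : ℝ) * |(t : ℝ) - ((i * δ : ℝ≥0) : ℝ)| ≤ ρ := by
      refine (mul_le_mul_of_nonneg_left h2 (by positivity)).trans_eq ?_
      rw [NNReal.coe_div]; field_simp
    have h4 := abs_sub_le (k t) (w (i * δ)) (w t)
    rw [abs_sub_comm (w (i * δ))] at h4
    linarith
  · simpa using hgrid 0 (Nat.zero_le _)

lemma LipschitzWith.abs_deriv_le {k : ℝ → ℝ} {C : ℝ≥0} (hk : LipschitzWith C k) (x : ℝ) :
    |deriv k x| ≤ C := by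
  simpa using norm_deriv_le_of_lipschitz hk (x₀ := x)

/-- The smallest `4 ^ n` such that the oscillation of `w` on the dyadic intervals of length
`2⁻ⁿ` in `[0, ℓ]` is at most `1 / 2`. -/
def oscCost (ℓ : ℕ) (w : ℝ≥0 → ℝ) : ℝ≥0∞ :=
  ⨅ (n : ℕ) (_ : SmallOsc w (ℓ * 2 ^ n) ((2 ^ n)⁻¹) (1 / 2)), 4 ^ n

/-- Oscillation 1/2 yields tube radius 1, and the mesh 2⁻ⁿ yields a Lipschitz constant of at most
2ⁿ, so the energy per unit of time is at most the 4ⁿ occurring in `oscCost`. -/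
lemma SmallOsc.exists_lipschitz_dyadic {w : ℝ≥0 → ℝ} {ℓ n : ℕ}
    (h : SmallOsc w (ℓ * 2 ^ n) ((2 ^ n)⁻¹) (1 / 2)) :
    ∃ k : ℝ → ℝ, LipschitzWith (2 ^ n) k ∧ InTube w ℓ 1 k ∧ k 0 = w 0 ∧ k (ℓ : ℝ≥0) = w ℓ := by
  have h' : SmallOsc w (ℓ * 2 ^ n) ((2 ^ n)⁻¹) (1 / 2 : ℝ≥0) := by simpa using h
  obtain ⟨k, h1, h2, h3, h4⟩ := h'.exists_lipschitz (by positivity)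
  have e : ((ℓ * 2 ^ n : ℕ) : ℝ≥0) * (2 ^ n)⁻¹ = ℓ := by
    push_cast
    rw [mul_assoc, mul_inv_cancel₀ (by positivity), mul_one]
  rw [e] at h2 h4
  refine ⟨k, h1.weaken ?_, by simpa using h2, h3, h4⟩
  rw [div_inv_eq_mul]
  calc (1 / 2 : ℝ≥0) * 2 ^ n ≤ 1 * 2 ^ n := by
        gcongr
        rw [← NNReal.coe_le_coe]; norm_num
    _ = 2 ^ n := one_mul _

lemma energy_le_of_lipschitz {k : ℝ → ℝ} {C : ℝ≥0} (hk : LipschitzWith C k) (T : ℝ≥0) :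
    energy T k ≤ T * (C : ℝ≥0∞) ^ 2 := by
  unfold energy
  calc ∫⁻ t in Set.Icc (0 : ℝ) T, ENNReal.ofReal (deriv k t ^ 2)
      ≤ ∫⁻ _ in Set.Icc (0 : ℝ) T, (C : ℝ≥0∞) ^ 2 := by
        refine lintegral_mono fun t ↦ ?_
        rw [← ENNReal.ofReal_coe_nnreal, ← ENNReal.ofReal_pow C.coe_nonneg]
        refine ENNReal.ofReal_le_ofReal ?_
        rw [← sq_abs]
        exact pow_le_pow_left₀ (abs_nonneg _) (LipschitzWith.abs_deriv_le hk t) 2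
    _ = T * (C : ℝ≥0∞) ^ 2 := by
        rw [lintegral_const, Measure.restrict_apply_univ, Real.volume_Icc, sub_zero,
          ENNReal.ofReal_coe_nnreal, mul_comm]

lemma four_pow_eq (n : ℕ) : ((2 ^ n : ℝ≥0) : ℝ≥0∞) ^ 2 = 4 ^ n := by
  push_cast
  rw [← pow_mul, mul_comm, pow_mul]
  norm_num

lemma bridgeEnergy_le_oscCost (ℓ : ℕ) (w : ℝ≥0 → ℝ) :
    bridgeEnergy w ℓ 1 ≤ ℓ * oscCost ℓ w := by
  rcases Nat.eq_zero_or_pos ℓ with rfl | hℓ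
  · simp [bridgeEnergy_zero w zero_le_one]
  have h0 : (ℓ : ℝ≥0∞) ≠ 0 := by exact_mod_cast hℓ.ne'
  unfold oscCost
  simp only [ENNReal.mul_iInf_of_ne h0 (ENNReal.natCast_ne_top ℓ)]
  refine le_iInf₂ fun n hn ↦ ?_
  obtain ⟨k, h1, h2, h3, h4⟩ := hn.exists_lipschitz_dyadic
  refine (iInf₂_le k ⟨h2, h3, h4⟩).trans ((energy_le_of_lipschitz h1 ℓ).trans_eq ?_)
  rw [four_pow_eq]
  simp

/-- A cut-off function which vanishes at the end points of `[0, ℓ]`. -/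
def cutoff (ℓ : ℝ) (t : ℝ) : ℝ := min (min t 1) (ℓ - t)

lemma lipschitzWith_cutoff (ℓ : ℝ) : LipschitzWith 1 (cutoff ℓ) := by
  have h1 : LipschitzWith 1 fun t : ℝ ↦ ℓ - t := by
    refine LipschitzWith.of_dist_le_mul fun x y ↦ ?_
    rw [dist_sub_left]; simp
  have h2 : LipschitzWith 1 fun t : ℝ ↦ min t 1 := LipschitzWith.id.min_const 1
  have h3 := h2.min h1
  rw [max_self] at h3
  exact h3

lemma sq_add_le {ε : ℝ} (hε : 0 < ε) (a b : ℝ) :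
    (a + b) ^ 2 ≤ (1 + ε) * a ^ 2 + (1 + 1 / ε) * b ^ 2 := by
  have h : 0 ≤ (ε * a - b) ^ 2 / ε := by positivity
  have e : (ε * a - b) ^ 2 / ε = ε * a ^ 2 - 2 * (a * b) + 1 / ε * b ^ 2 := by
    field_simp; ring
  rw [e] at h
  nlinarith

/-- Replacing a function in the tube by one with prescribed end points near the end points. -/
lemma bridgeEnergy_le_of_lipschitz {w : ℝ≥0 → ℝ} {ℓ : ℕ} (hℓ : 0 < ℓ) {h k : ℝ → ℝ} {C : ℝ≥0}
    (hC : 1 ≤ C) (hh : InTube w ℓ 1 h) (hkL : LipschitzWith C k) (hk : InTube w ℓ 1 k)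
    (hk0 : k 0 = w 0) (hk1 : k (ℓ : ℝ≥0) = w ℓ) {ε : ℝ} (hε : 0 < ε) :
    bridgeEnergy w ℓ 1 ≤ ENNReal.ofReal (1 + ε) * energy (ℓ : ℝ≥0) h +
      ENNReal.ofReal (18 * (1 + 1 / ε)) * (C : ℝ≥0∞) ^ 2 := by
  set T : ℝ := ((ℓ : ℝ≥0) : ℝ) with hTdef
  have hT : 1 ≤ T := by
    rw [hTdef]; simp only [NNReal.coe_natCast]; exact_mod_cast hℓ
  have hT0 : 0 ≤ T := zero_le_one.trans hT
  set θ := cutoff T with hθ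
  have hθ01 : ∀ t ∈ Set.Icc 0 T, 0 ≤ θ t ∧ θ t ≤ 1 := by
    intro t ht
    simp only [hθ, cutoff]
    exact ⟨le_min (le_min ht.1 zero_le_one) (by linarith [ht.2]),
      (min_le_left _ _).trans (min_le_right _ _)⟩
  have acθ : AbsolutelyContinuousOnInterval θ 0 T :=
    (lipschitzWith_cutoff T).lipschitzOnWith.absolutelyContinuousOnInterval
  have ach : AbsolutelyContinuousOnInterval h 0 T := hh.1
  have ack : AbsolutelyContinuousOnInterval k 0 T := hk.1
  -- A pointwise convex combination stays in the tube; it equals `k` at the end points and `h` in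
  -- the middle.
  set g : ℝ → ℝ := k + θ * (h - k) with hg
  have acg : AbsolutelyContinuousOnInterval g 0 T := ack.add (acθ.mul (ach.sub ack))
  have hgt : ∀ t, g t = k t + θ t * (h t - k t) := fun t ↦ rfl
  have hgin : InTube w ℓ 1 g := by
    refine ⟨acg, fun t ht ↦ ?_⟩
    have h1 := abs_le.1 (hh.2 t ht)
    have h2 := abs_le.1 (hk.2 t ht)
    obtain ⟨h3, h4⟩ := hθ01 t ⟨t.coe_nonneg, by exact_mod_cast ht⟩
    rw [hgt, abs_le]
    constructor <;> nlinarith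
  have hg0 : g 0 = w 0 := by
    have : θ 0 = 0 := by simp [hθ, cutoff, hT0]
    rw [hgt, this, hk0]; ring
  have hg1 : g T = w ℓ := by
    have : θ T = 0 := by simp [hθ, cutoff, hT0]
    rw [hgt, this, hk1]; ring
  have hb : bridgeEnergy w ℓ 1 ≤ energy T g := iInf₂_le g ⟨hgin, hg0, hg1⟩
  refine hb.trans ?_
  -- Outside these two unit strips the cut-off is locally 1 and `g` has the derivative of `h`, so
  -- the error term is confined to a set of measure at most 2.
  set E : Set ℝ := Set.Icc 0 1 ∪ Set.Icc (T - 1) T with hE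
  have hEm : MeasurableSet E := measurableSet_Icc.union measurableSet_Icc
  have hpt : ∀ᵐ t, t ∈ Set.Icc 0 T → ENNReal.ofReal (deriv g t ^ 2) ≤
      ENNReal.ofReal (1 + ε) * ENNReal.ofReal (deriv h t ^ 2) +
        E.indicator (fun _ ↦ ENNReal.ofReal (9 * (1 + 1 / ε)) * (C : ℝ≥0∞) ^ 2) t := by
    filter_upwards [acθ.ae_differentiableAt, ach.ae_differentiableAt, ack.ae_differentiableAt]
      with t d1 d2 d3 ht
    have htu : t ∈ Set.uIcc 0 T := by rwa [Set.uIcc_of_le hT0]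
    have D1 := (d1 htu).hasDerivAt
    have D2 := (d2 htu).hasDerivAt
    have D3 := (d3 htu).hasDerivAt
    have Dg := (D3.add (D1.mul (D2.sub D3))).deriv
    have hder : deriv g t =
        deriv k t + (deriv θ t * (h t - k t) + θ t * (deriv h t - deriv k t)) := Dg
    rw [← ENNReal.ofReal_mul (by positivity)]
    by_cases htE : t ∈ E
    · rw [Set.indicator_of_mem htE, ← ENNReal.ofReal_coe_nnreal,
        ← ENNReal.ofReal_pow C.coe_nonneg, ← ENNReal.ofReal_mul (by positivity),
        ← ENNReal.ofReal_add (by positivity) (by positivity)]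
      refine ENNReal.ofReal_le_ofReal ?_
      obtain ⟨h3, h4⟩ := hθ01 t ht
      have b1 : |deriv θ t| ≤ 1 := by
        simpa using LipschitzWith.abs_deriv_le (lipschitzWith_cutoff T) t
      have b2 : |deriv k t| ≤ C := LipschitzWith.abs_deriv_le hkL t
      have b3 : |h t - k t| ≤ 2 := by
        lift t to ℝ≥0 using ht.1
        have htl : t ≤ ℓ := by exact_mod_cast ht.2
        have h1 := abs_le.1 (hh.2 t htl)
        have h2 := abs_le.1 (hk.2 t htl)
        rw [abs_le]; constructor <;> linarith
      -- Two functions in the same unit tube differ by at most 2, so |X| ≤ C + 2 ≤ 3C. This gives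
      -- the 9 in the bound, and the two strips make it 18.
      set X := (1 - θ t) * deriv k t + deriv θ t * (h t - k t) with hX
      have e : deriv g t = θ t * deriv h t + X := by rw [hder, hX]; ring
      have hC' : (1 : ℝ) ≤ C := by exact_mod_cast hC
      have bX : |X| ≤ 3 * C := by
        calc |X| ≤ |(1 - θ t) * deriv k t| + |deriv θ t * (h t - k t)| := abs_add_le _ _
          _ ≤ 1 * C + 1 * 2 := by
              rw [abs_mul, abs_mul, abs_of_nonneg (by linarith : 0 ≤ 1 - θ t)]
              gcongr
              linarith
          _ ≤ 3 * C := by linarith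
      have hX2 : X ^ 2 ≤ 9 * C ^ 2 := by
        rw [← sq_abs]
        calc |X| ^ 2 ≤ (3 * C) ^ 2 := pow_le_pow_left₀ (abs_nonneg _) bX 2
          _ = 9 * C ^ 2 := by ring
      have hθ2 : (θ t * deriv h t) ^ 2 ≤ deriv h t ^ 2 := by
        rw [mul_pow]
        exact mul_le_of_le_one_left (sq_nonneg _) (pow_le_one₀ h3 h4)
      rw [e]
      refine (sq_add_le hε _ _).trans ?_
      calc (1 + ε) * (θ t * deriv h t) ^ 2 + (1 + 1 / ε) * X ^ 2
          ≤ (1 + ε) * deriv h t ^ 2 + (1 + 1 / ε) * (9 * C ^ 2) := by gcongr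
        _ = (1 + ε) * deriv h t ^ 2 + 9 * (1 + 1 / ε) * C ^ 2 := by ring
    · rw [Set.indicator_of_notMem htE, add_zero]
      refine ENNReal.ofReal_le_ofReal ?_
      simp only [hE, Set.mem_union, Set.mem_Icc, not_or, not_and, not_le] at htE
      have t1 : 1 < t := htE.1 ht.1
      have t2 : t < T - 1 := by
        by_contra hcon
        exact absurd (htE.2 (not_lt.1 hcon)) (not_lt.2 ht.2)
      have hev : θ =ᶠ[𝓝 t] fun _ ↦ 1 := by
        filter_upwards [isOpen_Ioo.mem_nhds (⟨t1, t2⟩ : t ∈ Set.Ioo 1 (T - 1))] with s hs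
        simp only [hθ, cutoff]
        rw [min_eq_right hs.1.le, min_eq_left (by linarith [hs.2])]
      have hd0 : deriv θ t = 0 := by rw [hev.deriv_eq]; simp
      have e : deriv g t = deriv h t := by rw [hder, hd0, hev.eq_of_nhds]; ring
      rw [e]
      nlinarith [sq_nonneg (deriv h t)]
  have hm : Measurable fun t ↦ ENNReal.ofReal (1 + ε) * ENNReal.ofReal (deriv h t ^ 2) :=
    (((measurable_deriv h).pow_const 2).ennreal_ofReal).const_mul _
  calc energy T g ≤ ∫⁻ t in Set.Icc 0 T, (ENNReal.ofReal (1 + ε) * ENNReal.ofReal (deriv h t ^ 2) +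
        E.indicator (fun _ ↦ ENNReal.ofReal (9 * (1 + 1 / ε)) * (C : ℝ≥0∞) ^ 2) t) :=
        setLIntegral_mono_ae' measurableSet_Icc hpt
    _ = ENNReal.ofReal (1 + ε) * energy T h + ∫⁻ t in Set.Icc 0 T,
        E.indicator (fun _ ↦ ENNReal.ofReal (9 * (1 + 1 / ε)) * (C : ℝ≥0∞) ^ 2) t := by
        rw [lintegral_add_left hm, lintegral_const_mul]
        · rfl
        · exact ((measurable_deriv h).pow_const 2).ennreal_ofReal
    _ ≤ _ := by
        gcongr
        refine (setLIntegral_le_lintegral _ _).trans ?_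
        rw [lintegral_indicator hEm, setLIntegral_const]
        have hvol : volume E ≤ 2 := by
          refine (measure_union_le _ _).trans ?_
          rw [Real.volume_Icc, Real.volume_Icc]
          norm_num
        calc ENNReal.ofReal (9 * (1 + 1 / ε)) * (C : ℝ≥0∞) ^ 2 * volume E
            ≤ ENNReal.ofReal (9 * (1 + 1 / ε)) * (C : ℝ≥0∞) ^ 2 * 2 := by gcongr
          _ = ENNReal.ofReal (18 * (1 + 1 / ε)) * (C : ℝ≥0∞) ^ 2 := by
            rw [show 18 * (1 + 1 / ε) = 9 * (1 + 1 / ε) * 2 by ring,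
              ENNReal.ofReal_mul (p := 9 * (1 + 1 / ε)) (by positivity)]
            simp only [ENNReal.ofReal_ofNat]
            ring

/-- The converse comparison of pinned and free energies. The coefficient of `oscCost` does not
depend on ℓ, unlike in `bridgeEnergy_le_oscCost`, so the correction is negligible for long blocks.
-/
lemma bridgeEnergy_le_tubeEnergy_add (w : ℝ≥0 → ℝ) {ℓ : ℕ} (hℓ : 0 < ℓ) {ε : ℝ} (hε : 0 < ε) :
    bridgeEnergy w ℓ 1 ≤ ENNReal.ofReal (1 + ε) * tubeEnergy Set.univ w ℓ 1 +
      ENNReal.ofReal (18 * (1 + 1 / ε)) * oscCost ℓ w := by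
  unfold oscCost tubeEnergy
  have a0 : ENNReal.ofReal (1 + ε) ≠ 0 := by
    rw [Ne, ENNReal.ofReal_eq_zero, not_le]; positivity
  have b0 : ENNReal.ofReal (18 * (1 + 1 / ε)) ≠ 0 := by
    rw [Ne, ENNReal.ofReal_eq_zero, not_le]; positivity
  simp only [ENNReal.mul_iInf_of_ne a0 ENNReal.ofReal_ne_top,
    ENNReal.mul_iInf_of_ne b0 ENNReal.ofReal_ne_top, ENNReal.iInf_add, ENNReal.add_iInf]
  refine le_iInf₂ fun n hn ↦ le_iInf₂ fun h hh ↦ ?_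
  obtain ⟨k, h1, h2, h3, h4⟩ := hn.exists_lipschitz_dyadic
  have := bridgeEnergy_le_of_lipschitz hℓ (one_le_pow₀ one_le_two) hh.1 h1 h2 h3 h4 hε
  rwa [four_pow_eq] at this

/-- The upper bound for the energy of a taut string over `n` blocks of length `ℓ`. -/
lemma tubeEnergy_le_sum (w : ℝ≥0 → ℝ) {ℓ : ℕ} (hℓ : 0 < ℓ) {ε : ℝ} (hε : 0 < ε) (n : ℕ) :
    tubeEnergy {0} w (n * ℓ) 1 ≤ ∑ i ∈ Finset.range n,
      (ENNReal.ofReal (1 + ε) * tubeEnergy Set.univ (shiftPath (i * ℓ) w) ℓ 1 +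
        ENNReal.ofReal (18 * (1 + 1 / ε)) * oscCost ℓ (shiftPath (i * ℓ) w)) :=
  (tubeEnergy_le_bridgeEnergy w _ 1).trans ((bridgeEnergy_le_sum w ℓ zero_le_one n).trans
    (Finset.sum_le_sum fun _ _ ↦ bridgeEnergy_le_tubeEnergy_add _ hℓ hε))

/-! ### Measurability of the tube energy. -/

/-- A countable family of functions which is dense in `L²([0, T])`. -/
lemma exists_l2_dense (T : ℝ) : ∃ g : ℕ → ℝ → ℝ,
    (∀ j, MemLp (g j) 2 (volume.restrict (Set.Icc 0 T))) ∧
    ∀ f : ℝ → ℝ, MemLp f 2 (volume.restrict (Set.Icc 0 T)) → ∀ η : ℝ≥0∞, η ≠ 0 →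
      ∃ j, ∫⁻ t in Set.Icc 0 T, ENNReal.ofReal ((g j t - f t) ^ 2) < η := by
  set μ : Measure ℝ := volume.restrict (Set.Icc 0 T)
  have : Fact ((2 : ℝ≥0∞) ≠ ∞) := ⟨by simp⟩
  have : SecondCountableTopology (Lp ℝ 2 μ) := inferInstance
  set D : ℕ → Lp ℝ 2 μ := TopologicalSpace.denseSeq _
  have hD : DenseRange D := TopologicalSpace.denseRange_denseSeq _
  refine ⟨fun j ↦ D j, fun j ↦ Lp.memLp _, fun f hf η hη ↦ ?_⟩
  have h0 : Continuous fun x : Lp ℝ 2 μ ↦ ‖x - hf.toLp f‖ₑ ^ 2 := by fun_prop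
  obtain ⟨j, hj⟩ := hD.exists_mem_open (isOpen_lt h0 continuous_const) (s := {x | _ < η})
    ⟨hf.toLp f, by simpa [pos_iff_ne_zero] using hη⟩
  refine ⟨j, lt_of_eq_of_lt ?_ hj⟩
  have h2 := eLpNorm_nnreal_pow_eq_lintegral (f := ⇑(D j - hf.toLp f)) (μ := μ) (p := 2) (by simp)
  simp only [NNReal.coe_ofNat, ENNReal.coe_ofNat, ENNReal.rpow_ofNat] at h2
  rw [Lp.enorm_def, h2]
  refine lintegral_congr_ae ?_
  filter_upwards [Lp.coeFn_sub (D j) (hf.toLp f), hf.coeFn_toLp] with t h3 h4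
  rw [h3, Pi.sub_apply, h4, ofReal_sq_eq_enorm_sq]

lemma exists_smallOsc {w : ℝ≥0 → ℝ} (hw : Continuous w) {T : ℝ≥0} {ρ : ℝ}
    (hρ : 0 < ρ) : ∃ m : ℕ, 0 < m ∧ SmallOsc w m (T / m) ρ := by
  have huc : UniformContinuousOn w (Set.Icc 0 T) :=
    isCompact_Icc.uniformContinuousOn_of_continuous hw.continuousOn
  obtain ⟨δ, hδ, h⟩ := Metric.uniformContinuousOn_iff.1 huc ρ hρ
  obtain ⟨m, hm⟩ := exists_nat_gt ((T : ℝ) / δ)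
  have hm0 : 0 < m := by
    have h1 : (0 : ℝ) ≤ T / δ := by positivity
    exact_mod_cast h1.trans_lt hm
  have hm' : (0 : ℝ≥0) < m := by exact_mod_cast hm0
  refine ⟨m, hm0, fun i hi t ht ↦ ?_⟩
  have hlt : (T : ℝ) / m < δ := by
    rw [div_lt_iff₀ hδ] at hm
    rw [div_lt_iff₀ (by exact_mod_cast hm0)]
    linarith
  have hi1 : ((i : ℝ≥0) + 1) ≤ m := by exact_mod_cast hi
  have hle : i * (T / m) + t ≤ T := by
    calc i * (T / m) + t ≤ i * (T / m) + T / m := by gcongr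
      _ = (i + 1) * (T / m) := by ring
      _ ≤ m * (T / m) := by gcongr
      _ = T := by field_simp
  have := h (i * (T / m) + t) ⟨zero_le, hle⟩ (i * (T / m)) ⟨zero_le, le_self_add.trans hle⟩ (by
    rw [NNReal.dist_eq]
    push_cast
    rw [add_sub_cancel_left, abs_of_nonneg t.coe_nonneg]
    refine lt_of_le_of_lt ?_ hlt
    have : (t : ℝ) ≤ ((T / m : ℝ≥0) : ℝ) := by exact_mod_cast ht
    simpa using this)
  rw [Real.dist_eq] at this
  exact this.le

/-- Inside every tube around a continuous path there is a function of finite energy. -/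
lemma exists_inTube {w : ℝ≥0 → ℝ} (hw : Continuous w) {T : ℝ≥0} (hT : 0 < T) {r : ℝ}
    (hr : 0 < r) : ∃ k : ℝ → ℝ, InTube w T r k ∧ k 0 = w 0 ∧ energy T k ≠ ∞ := by
  obtain ⟨m, hm, h⟩ := exists_smallOsc hw (T := T) (half_pos hr)
  lift r to ℝ≥0 using hr.le
  have hm' : (0 : ℝ≥0) < m := by exact_mod_cast hm
  have h' : SmallOsc w m (T / m) (r / 2 : ℝ≥0) := by simpa using h
  obtain ⟨k, h1, h2, h3, -⟩ := h'.exists_lipschitz (by positivity)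
  have e : (m : ℝ≥0) * (T / m) = T := by field_simp
  rw [e] at h2
  refine ⟨k, ?_, h3, ne_top_of_le_ne_top ?_ (energy_le_of_lipschitz h1 T)⟩
  · convert h2 using 1
    push_cast; ring
  · finiteness

lemma energy_convex_comb {h k : ℝ → ℝ} {T ε : ℝ} (hT : 0 ≤ T) (hε : ε ∈ Set.Icc (0 : ℝ) 1)
    (hh : AbsolutelyContinuousOnInterval h 0 T) (hk : AbsolutelyContinuousOnInterval k 0 T) :
    energy T (fun t ↦ h t + ε * (k t - h t)) ≤ energy T h + ENNReal.ofReal ε * energy T k := by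
  have h1 : energy T (fun t ↦ h t + ε * (k t - h t)) =
      ∫⁻ t in Set.Icc 0 T, ENNReal.ofReal ((deriv h t + ε * (deriv k t - deriv h t)) ^ 2) := by
    refine energy_eq_of_ae ?_
    filter_upwards [hh.ae_differentiableAt, hk.ae_differentiableAt] with t d1 d2 ht
    have htu : t ∈ Set.uIcc 0 T := by
      rw [Set.uIcc_of_le hT]; exact Set.Ioo_subset_Icc_self ht
    exact (d1 htu).hasDerivAt.add (((d2 htu).hasDerivAt.sub (d1 htu).hasDerivAt).const_mul ε)
  rw [h1]
  have hm : ∀ f : ℝ → ℝ, Measurable fun t ↦ ENNReal.ofReal (deriv f t ^ 2) := fun f ↦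
    ((measurable_deriv f).pow_const 2).ennreal_ofReal
  unfold energy
  rw [← lintegral_const_mul _ (hm k), ← lintegral_add_left (hm h)]
  refine lintegral_mono fun t ↦ ?_
  rw [← ENNReal.ofReal_mul hε.1, ← ENNReal.ofReal_add (by positivity)
    (mul_nonneg hε.1 (sq_nonneg _))]
  refine ENNReal.ofReal_le_ofReal ?_
  obtain ⟨e0, e1⟩ := hε
  nlinarith [mul_nonneg (mul_nonneg e0 (sub_nonneg.2 e1)) (sq_nonneg (deriv k t - deriv h t)),
    mul_nonneg e0 (sq_nonneg (deriv h t))]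

/-- A measurable functional on the path space which agrees with `tubeEnergy` on continuous paths:
the infimum over a countable family of functions. -/
def countableTubeEnergy (S : Set ℝ) (T : ℝ≥0) (r : ℝ) (τ : ℕ → ℝ≥0) (g : ℕ → ℝ → ℝ)
    (w : ℝ≥0 → ℝ) : ℝ≥0∞ :=
  ⨅ (j : ℕ), ⨅ (q : S), ⨅ (_ : ∀ n, |w 0 + q + (∫ s in (0 : ℝ)..τ n, g j s) - w (τ n)| ≤ r),
    ∫⁻ t in Set.Icc (0 : ℝ) T, ENNReal.ofReal (g j t ^ 2)

lemma Measurable.iInf_prop_const {α : Type*} [MeasurableSpace α] {p : α → Prop} {c : ℝ≥0∞}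
    (hp : MeasurableSet {a | p a}) : Measurable fun a ↦ ⨅ (_ : p a), c := by
  classical
  have : (fun a ↦ ⨅ (_ : p a), c) = fun a ↦ if p a then c else ∞ := by
    ext a
    by_cases h : p a <;> simp [h]
  rw [this]
  exact Measurable.ite hp measurable_const measurable_const

lemma measurable_countableTubeEnergy (S : Set ℝ) (hS : S.Countable) (T : ℝ≥0) (r : ℝ) (τ : ℕ → ℝ≥0)
    (g : ℕ → ℝ → ℝ) : Measurable (countableTubeEnergy S T r τ g) := by
  have := hS.to_subtype
  refine Measurable.iInf fun j ↦ Measurable.iInf fun q ↦ Measurable.iInf_prop_const ?_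
  rw [Set.ofPred_forall]
  refine MeasurableSet.iInter fun n ↦ measurableSet_le (Measurable.abs ?_) measurable_const
  fun_prop

/-- By continuity the tube constraint need only be imposed at countably many dense times. -/
lemma le_of_forall_le_tube {w : ℝ≥0 → ℝ} (hw : Continuous w) {T : ℝ≥0} {r : ℝ} {h : ℝ → ℝ}
    (hc : ContinuousOn h (Set.Icc 0 T)) {τ : ℕ → ℝ≥0} (hτ : Set.Iic T ⊆ closure (Set.range τ ∩ Set.Iic T))
    (H : ∀ n, τ n ≤ T → |h (τ n) - w (τ n)| ≤ r) : ∀ t ≤ T, |h t - w t| ≤ r := by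
  intro t ht
  have hcl : IsClosed {t : Set.Iic T | |h ((t : ℝ≥0) : ℝ) - w t| ≤ r} := by
    refine isClosed_le ?_ continuous_const
    have h1 : Continuous fun t : Set.Iic T ↦ h ((t : ℝ≥0) : ℝ) :=
      hc.comp_continuous (by fun_prop) fun t ↦ ⟨NNReal.coe_nonneg _, by exact_mod_cast t.2⟩
    have h2 : Continuous fun t : Set.Iic T ↦ w t := hw.comp continuous_subtype_val
    exact (h1.sub h2).abs
  have hmem : (⟨t, ht⟩ : Set.Iic T) ∈ closure {t : Set.Iic T | |h ((t : ℝ≥0) : ℝ) - w t| ≤ r} := by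
    rw [closure_subtype]
    refine closure_mono ?_ (hτ ht)
    rintro x ⟨⟨n, rfl⟩, hn⟩
    exact ⟨⟨τ n, hn⟩, H n hn, rfl⟩
  rw [hcl.closure_eq] at hmem
  exact hmem

lemma tubeEnergy_le_countable {S S₀ : Set ℝ} (hS : S₀ ⊆ S) {w : ℝ≥0 → ℝ} (hw : Continuous w)
    {T : ℝ≥0} {r : ℝ} {τ : ℕ → ℝ≥0} (hτ : Set.Iic T ⊆ closure (Set.range τ ∩ Set.Iic T))
    {g : ℕ → ℝ → ℝ} (hg : ∀ j, MemLp (g j) 2 (volume.restrict (Set.Icc (0 : ℝ) T))) :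
    tubeEnergy S w T r ≤ countableTubeEnergy S₀ T r τ g w := by
  refine le_iInf fun j ↦ le_iInf fun q ↦ le_iInf fun hq ↦ ?_
  have hT : (0 : ℝ) ≤ T := T.coe_nonneg
  have hi : IntervalIntegrable (g j) volume 0 T := by
    rw [intervalIntegrable_iff_integrableOn_Icc_of_le hT]
    exact (hg j).integrable (by norm_num)
  obtain ⟨h1, h2⟩ := primitive_props hT hi (w 0 + q)
  rw [← h2]
  refine tubeEnergy_le ⟨h1, ?_⟩ (by simpa using hS q.2)
  refine le_of_forall_le_tube (h := fun t ↦ w 0 + q + ∫ s in (0 : ℝ)..t, g j s) hw ?_ hτ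
    fun n _ ↦ hq n
  have := h1.continuousOn
  rwa [Set.uIcc_of_le hT] at this

/-- The slack δ is spent in two halves: one for moving the starting point into `S₀`, one for
replacing the derivative by a member of the dense family, which by Cauchy–Schwarz moves the
primitive uniformly little. -/
lemma countable_le_of_strict {S S₀ : Set ℝ} (hS : S ⊆ closure S₀) {w : ℝ≥0 → ℝ}
    {T : ℝ≥0} {r : ℝ} {τ : ℕ → ℝ≥0} (hτ : ∀ n, τ n ≤ T)
    {g : ℕ → ℝ → ℝ} (hg : ∀ j, MemLp (g j) 2 (volume.restrict (Set.Icc (0 : ℝ) T)))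
    (hd : ∀ f : ℝ → ℝ, MemLp f 2 (volume.restrict (Set.Icc (0 : ℝ) T)) → ∀ η : ℝ≥0∞, η ≠ 0 →
      ∃ j, ∫⁻ t in Set.Icc (0 : ℝ) T, ENNReal.ofReal ((g j t - f t) ^ 2) < η)
    {h : ℝ → ℝ} {δ : ℝ} (hδ : 0 < δ) (hh : InTube w T (r - δ) h) (h0 : h 0 - w 0 ∈ S)
    (hE : energy T h ≠ ∞) :
    countableTubeEnergy S₀ T r τ g w ≤ energy T h := by
  have hT : (0 : ℝ) ≤ T := T.coe_nonneg
  set μ : Measure ℝ := volume.restrict (Set.Icc (0 : ℝ) T) with hμ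
  have hf : MemLp (deriv h) 2 μ := by
    refine ⟨(measurable_deriv h).aestronglyMeasurable, ?_⟩
    have h2 := eLpNorm_nnreal_pow_eq_lintegral (f := deriv h) (μ := μ) (p := 2) (by simp)
    simp only [NNReal.coe_ofNat, ENNReal.coe_ofNat, ENNReal.rpow_ofNat] at h2
    have h3 : eLpNorm (deriv h) 2 μ ^ 2 ≠ ∞ := by
      rw [h2]
      simpa only [energy, ofReal_sq_eq_enorm_sq] using hE
    exact lt_top_iff_ne_top.2 fun h4 ↦ h3 (by simp [h4])
  obtain ⟨q, hqS, hq⟩ := Metric.mem_closure_iff.1 (hS h0) (δ / 2) (by positivity)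
  have hR : ∀ ε : ℝ, 0 < ε → countableTubeEnergy S₀ T r τ g w ≤
      ENNReal.ofReal ((1 + ε) * (energy T h).toReal + ε) := by
    intro ε hε
    -- The first bound keeps the primitives within δ / 2 of each other, with T + 1 to allow T = 0;
    -- the second makes the error term (1 + 1/ε) η in the energy at most ε.
    set η : ℝ := min ((δ / 2) ^ 2 / (T + 1)) (ε / (1 + 1 / ε)) with hη
    have hη0 : 0 < η := by positivity
    obtain ⟨j, hj⟩ := hd (deriv h) hf (ENNReal.ofReal η) (by simpa using hη0)
    have hi : ∀ t ∈ Set.Icc (0 : ℝ) T, IntervalIntegrable (g j) volume 0 t ∧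
        IntervalIntegrable (deriv h) volume 0 t := by
      intro t ht
      rw [intervalIntegrable_iff_integrableOn_Icc_of_le ht.1,
        intervalIntegrable_iff_integrableOn_Icc_of_le ht.1]
      have h1 : IntegrableOn (g j) (Set.Icc 0 T) := (hg j).integrable (by norm_num)
      have h2 : IntegrableOn (deriv h) (Set.Icc 0 T) := hf.integrable (by norm_num)
      exact ⟨h1.mono_set (Set.Icc_subset_Icc_right ht.2),
        h2.mono_set (Set.Icc_subset_Icc_right ht.2)⟩
    have hclose : ∀ t ∈ Set.Icc (0 : ℝ) T,
        |(∫ s in (0 : ℝ)..t, g j s) - ∫ s in (0 : ℝ)..t, deriv h s| ≤ δ / 2 := by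
      intro t ht
      rw [← intervalIntegral.integral_sub (hi t ht).1 (hi t ht).2]
      have h1 := sq_integral_le (g := fun s ↦ g j s - deriv h s) le_rfl ht.1 ht.2
        ((hg j).aestronglyMeasurable.aemeasurable.sub hf.aestronglyMeasurable.aemeasurable)
      have h2 := h1.trans (mul_le_mul_right hj.le (ENNReal.ofReal (T : ℝ)))
      rw [← ENNReal.ofReal_mul hT, ENNReal.ofReal_le_ofReal_iff (by positivity)] at h2
      refine abs_le_of_sq_le_sq (h2.trans ?_) (by positivity)
      calc (T : ℝ) * η ≤ (T + 1) * ((δ / 2) ^ 2 / (T + 1)) := by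
            gcongr
            · linarith
            · exact min_le_left _ _
        _ = (δ / 2) ^ 2 := by field_simp
    have hadm : ∀ n, |w 0 + q + (∫ s in (0 : ℝ)..τ n, g j s) - w (τ n)| ≤ r := by
      intro n
      have hn : ((τ n : ℝ≥0) : ℝ) ∈ Set.Icc (0 : ℝ) T := ⟨NNReal.coe_nonneg _, by exact_mod_cast hτ n⟩
      have h1 := abs_le.1 (hclose _ hn)
      have h2 := abs_le.1 (hh.2 _ (hτ n))
      rw [AbsolutelyContinuousOnInterval.eq_add_integral hh.1 hn] at h2
      rw [Real.dist_eq] at hq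
      have h3 := abs_lt.1 hq
      rw [abs_le]
      constructor <;> linarith
    have hle : countableTubeEnergy S₀ T r τ g w ≤
        ∫⁻ t in Set.Icc (0 : ℝ) T, ENNReal.ofReal (g j t ^ 2) :=
      (iInf_le _ j).trans ((iInf_le _ (⟨q, hqS⟩ : S₀)).trans (iInf_le _ hadm))
    refine hle.trans ?_
    have hm1 : Measurable fun t ↦ ENNReal.ofReal (deriv h t ^ 2) :=
      ((measurable_deriv h).pow_const 2).ennreal_ofReal
    calc ∫⁻ t in Set.Icc (0 : ℝ) T, ENNReal.ofReal (g j t ^ 2)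
        ≤ ∫⁻ t in Set.Icc (0 : ℝ) T, (ENNReal.ofReal (1 + ε) * ENNReal.ofReal (deriv h t ^ 2) +
            ENNReal.ofReal (1 + 1 / ε) * ENNReal.ofReal ((g j t - deriv h t) ^ 2)) := by
          refine lintegral_mono fun t ↦ ?_
          rw [← ENNReal.ofReal_mul (by positivity), ← ENNReal.ofReal_mul (by positivity),
            ← ENNReal.ofReal_add (by positivity) (by positivity)]
          refine ENNReal.ofReal_le_ofReal ?_
          have := sq_add_le hε (deriv h t) (g j t - deriv h t)
          rwa [add_sub_cancel] at this
      _ = ENNReal.ofReal (1 + ε) * energy T h + ENNReal.ofReal (1 + 1 / ε) *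
            ∫⁻ t in Set.Icc (0 : ℝ) T, ENNReal.ofReal ((g j t - deriv h t) ^ 2) := by
          rw [lintegral_add_left (hm1.const_mul _), lintegral_const_mul _ hm1,
            lintegral_const_mul' _ _ (by finiteness)]
          rfl
      _ ≤ ENNReal.ofReal (1 + ε) * ENNReal.ofReal (energy T h).toReal +
            ENNReal.ofReal (1 + 1 / ε) * ENNReal.ofReal (ε / (1 + 1 / ε)) := by
          rw [ENNReal.ofReal_toReal hE]
          gcongr
          exact hj.le.trans (ENNReal.ofReal_le_ofReal (min_le_right _ _))
      _ = ENNReal.ofReal ((1 + ε) * (energy T h).toReal + ε) := by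
          rw [← ENNReal.ofReal_mul (by positivity), ← ENNReal.ofReal_mul (by positivity),
            ← ENNReal.ofReal_add (by positivity) (by positivity)]
          congr 2
          field_simp
  have hlim : Tendsto (fun ε : ℝ ↦ ENNReal.ofReal ((1 + ε) * (energy T h).toReal + ε)) (𝓝[>] 0)
      (𝓝 (energy T h)) := by
    have hc : Continuous fun ε : ℝ ↦ ENNReal.ofReal ((1 + ε) * (energy T h).toReal + ε) :=
      ENNReal.continuous_ofReal.comp (by fun_prop)
    have := (hc.tendsto 0).mono_left (nhdsWithin_le_nhds (s := Set.Ioi 0))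
    simpa [ENNReal.ofReal_toReal hE] using this
  exact ge_of_tendsto hlim (eventually_nhdsWithin_of_forall fun ε hε ↦ hR ε hε)

/-- Slack is created by moving `h` slightly towards a function `k` of finite energy in the half-size
tube; by convexity this costs little energy. As `k` starts on the path, the initial discrepancy is
multiplied by 1 - ε, whence `hconv`. -/
lemma countable_le_tubeEnergy {S S₀ : Set ℝ} (hS : S ⊆ closure S₀)
    (hconv : ∀ x ∈ S, ∀ c ∈ Set.Ioo (0 : ℝ) 1, c * x ∈ S) {w : ℝ≥0 → ℝ} (hw : Continuous w)
    {T : ℝ≥0} (hT0 : 0 < T) {r : ℝ} (hr : 0 < r) {τ : ℕ → ℝ≥0} (hτ : ∀ n, τ n ≤ T)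
    {g : ℕ → ℝ → ℝ} (hg : ∀ j, MemLp (g j) 2 (volume.restrict (Set.Icc (0 : ℝ) T)))
    (hd : ∀ f : ℝ → ℝ, MemLp f 2 (volume.restrict (Set.Icc (0 : ℝ) T)) → ∀ η : ℝ≥0∞, η ≠ 0 →
      ∃ j, ∫⁻ t in Set.Icc (0 : ℝ) T, ENNReal.ofReal ((g j t - f t) ^ 2) < η) :
    countableTubeEnergy S₀ T r τ g w ≤ tubeEnergy S w T r := by
  have hT : (0 : ℝ) ≤ T := T.coe_nonneg
  obtain ⟨k, hk, hk0, hkE⟩ := exists_inTube hw hT0 (half_pos hr)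
  refine le_iInf₂ fun h hh ↦ ?_
  rcases eq_or_ne (energy T h) ∞ with hE | hE
  · simp [hE]
  have hR : ∀ ε ∈ Set.Ioo (0 : ℝ) 1, countableTubeEnergy S₀ T r τ g w ≤
      energy T h + ENNReal.ofReal ε * energy T k := by
    intro ε hε
    have hle := energy_convex_comb hT (Set.Ioo_subset_Icc_self hε) hh.1.1 hk.1
    refine (countable_le_of_strict hS hτ hg hd (δ := ε * (r / 2))
      (h := fun t ↦ h t + ε * (k t - h t)) (mul_pos hε.1 (half_pos hr)) ⟨?_, ?_⟩ ?_ ?_).trans hle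
    · have := hh.1.1.add ((hk.1.sub hh.1.1).const_smul ε)
      exact this
    · intro t ht
      have h1 := abs_le.1 (hh.1.2 t ht)
      have h2 := abs_le.1 (hk.2 t ht)
      obtain ⟨e0, e1⟩ := hε
      rw [abs_le]
      constructor <;> nlinarith
    · have e : h 0 + ε * (k 0 - h 0) - w 0 = (1 - ε) * (h 0 - w 0) := by rw [hk0]; ring
      simp only [e]
      exact hconv _ hh.2 _ ⟨by linarith [hε.2], by linarith [hε.1]⟩
    · exact ne_top_of_le_ne_top (by finiteness) hle
  have hlim : Tendsto (fun ε : ℝ ↦ energy T h + ENNReal.ofReal ε * energy T k) (𝓝[>] 0)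
      (𝓝 (energy T h)) := by
    have hc : Tendsto (fun ε : ℝ ↦ ENNReal.ofReal ε) (𝓝[>] 0) (𝓝 0) := by
      have := (ENNReal.continuous_ofReal.tendsto 0).mono_left (nhdsWithin_le_nhds (s := Set.Ioi 0))
      simpa using this
    have := (ENNReal.Tendsto.mul_const hc (.inr hkE)).const_add (energy T h)
    simpa using this
  refine ge_of_tendsto hlim ?_
  filter_upwards [Ioo_mem_nhdsGT (zero_lt_one' ℝ)] with ε hε using hR ε hε

lemma exists_dense_times (T : ℝ≥0) : ∃ τ : ℕ → ℝ≥0, (∀ n, τ n ≤ T) ∧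
    Set.Iic T ⊆ closure (Set.range τ ∩ Set.Iic T) := by
  refine ⟨fun n ↦ (TopologicalSpace.denseSeq (Set.Iic T) n : Set.Iic T),
    fun n ↦ (TopologicalSpace.denseSeq (Set.Iic T) n).2, ?_⟩
  intro t ht
  have := (TopologicalSpace.denseRange_denseSeq (Set.Iic T)) ⟨t, ht⟩
  rw [closure_subtype] at this
  refine closure_mono ?_ this
  rintro _ ⟨_, ⟨n, rfl⟩, rfl⟩
  exact ⟨⟨n, rfl⟩, (TopologicalSpace.denseSeq (Set.Iic T) n).2⟩

/-! ### Functionals of blocks of increments: equal laws and independence. -/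

/-- A functional of paths which depends only on the path on `[0, ℓ]`, and which agrees with a
measurable functional on continuous paths. -/
structure IsPathFunctional (Ψ : (ℝ≥0 → ℝ) → ℝ≥0∞) (ℓ : ℝ≥0) : Prop where
  exists_measurable : ∃ Φ : (ℝ≥0 → ℝ) → ℝ≥0∞, Measurable Φ ∧ ∀ w, Continuous w → Ψ w = Φ w
  local' : ∀ w v : ℝ≥0 → ℝ, (∀ t ≤ ℓ, w t = v t) → Ψ w = Ψ v

lemma isPathFunctional_tubeEnergy {S S₀ : Set ℝ} (hS₀ : S₀.Countable) (hSS : S₀ ⊆ S)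
    (hS : S ⊆ closure S₀) (hconv : ∀ x ∈ S, ∀ c ∈ Set.Ioo (0 : ℝ) 1, c * x ∈ S) {T : ℝ≥0}
    (hT : 0 < T) {r : ℝ} (hr : 0 < r) : IsPathFunctional (tubeEnergy S · T r) T where
  exists_measurable := by
    obtain ⟨τ, h1, h2⟩ := exists_dense_times T
    obtain ⟨g, h3, h4⟩ := exists_l2_dense T
    exact ⟨countableTubeEnergy S₀ T r τ g, measurable_countableTubeEnergy S₀ hS₀ T r τ g,
      fun w hw ↦ le_antisymm (tubeEnergy_le_countable hSS hw h2 h3)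
        (countable_le_tubeEnergy hS hconv hw hT hr h1 h3 h4)⟩
  local' w v h := by
    unfold tubeEnergy InTube
    refine iInf_congr fun k ↦ iInf_congr_Prop ?_ fun _ ↦ rfl
    rw [h 0 zero_le]
    refine and_congr_left fun _ ↦ and_congr_right fun _ ↦ forall₂_congr fun t ht ↦ ?_
    rw [h t ht]

lemma isPathFunctional_tubeEnergy_univ {T : ℝ≥0} (hT : 0 < T) {r : ℝ} (hr : 0 < r) :
    IsPathFunctional (tubeEnergy Set.univ · T r) T :=
  isPathFunctional_tubeEnergy (S₀ := Set.range ((↑) : ℚ → ℝ)) (Set.countable_range _)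
    (Set.subset_univ _) (by rw [Rat.denseRange_cast.closure_range]) (by simp) hT hr

lemma isPathFunctional_tubeEnergy_zero {T : ℝ≥0} (hT : 0 < T) {r : ℝ} (hr : 0 < r) :
    IsPathFunctional (tubeEnergy {0} · T r) T :=
  isPathFunctional_tubeEnergy (S₀ := {0}) (Set.countable_singleton _)
    subset_rfl subset_closure (by simp) hT hr

lemma smallOsc_congr {w v : ℝ≥0 → ℝ} {m : ℕ} {δ : ℝ≥0} {ρ : ℝ} (h : ∀ t ≤ m * δ, w t = v t) :
    SmallOsc w m δ ρ ↔ SmallOsc v m δ ρ := by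
  refine forall₂_congr fun i hi ↦ forall₂_congr fun t ht ↦ ?_
  have hi1 : ((i : ℝ≥0) + 1) ≤ m := by exact_mod_cast hi
  have hle : i * δ + t ≤ m * δ := by
    calc i * δ + t ≤ i * δ + δ := by gcongr
      _ = (i + 1) * δ := by ring
      _ ≤ m * δ := by gcongr
  rw [h _ hle, h _ (le_self_add.trans hle)]

lemma isPathFunctional_oscCost (ℓ : ℕ) : IsPathFunctional (oscCost ℓ) ℓ where
  exists_measurable := by
    choose τ h1 h2 using fun n : ℕ ↦ exists_dense_times ((2 ^ n)⁻¹ : ℝ≥0)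
    refine ⟨fun w ↦ ⨅ (n : ℕ), ⨅ (_ : ∀ i < ℓ * 2 ^ n, ∀ j,
      |w (i * (2 ^ n)⁻¹ + τ n j) - w (i * (2 ^ n)⁻¹)| ≤ 1 / 2), 4 ^ n, ?_, fun w hw ↦ ?_⟩
    · refine Measurable.iInf fun n ↦ Measurable.iInf_prop_const ?_
      simp only [Set.ofPred_forall]
      refine MeasurableSet.iInter fun i ↦ MeasurableSet.iInter fun _ ↦ MeasurableSet.iInter fun j ↦
        measurableSet_le (Measurable.abs ?_) measurable_const
      fun_prop
    · refine iInf_congr fun n ↦ iInf_congr_Prop ?_ fun _ ↦ rfl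
      refine forall₂_congr fun i _ ↦ ⟨fun H j ↦ H _ (h1 n j), fun H t ht ↦ ?_⟩
      have := le_of_forall_le_tube (w := fun t ↦ w (i * (2 ^ n)⁻¹ + t)) (by fun_prop)
        (T := (2 ^ n)⁻¹) (h := fun _ ↦ w (i * (2 ^ n)⁻¹)) continuousOn_const (h2 n)
        (r := 1 / 2) (fun j _ ↦ by rw [abs_sub_comm]; exact H j) t ht
      rwa [abs_sub_comm]
  local' w v h := by
    refine iInf_congr fun n ↦ iInf_congr_Prop (smallOsc_congr fun t ht ↦ h t (ht.trans_eq ?_))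
      fun _ ↦ rfl
    push_cast
    field_simp

lemma IsPathFunctional.add {Ψ Ψ' : (ℝ≥0 → ℝ) → ℝ≥0∞} {ℓ : ℝ≥0} (h : IsPathFunctional Ψ ℓ)
    (h' : IsPathFunctional Ψ' ℓ) (a b : ℝ≥0∞) :
    IsPathFunctional (fun w ↦ a * Ψ w + b * Ψ' w) ℓ where
  exists_measurable := by
    obtain ⟨Φ, m, e⟩ := h.exists_measurable
    obtain ⟨Φ', m', e'⟩ := h'.exists_measurable
    exact ⟨fun w ↦ a * Φ w + b * Φ' w, by fun_prop, fun w hw ↦ by rw [e w hw, e' w hw]⟩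
  local' w v hwv := by rw [h.local' w v hwv, h'.local' w v hwv]



lemma IsPathFunctional.measurable {Ψ : (ℝ≥0 → ℝ) → ℝ≥0∞} {ℓ : ℝ≥0} (h : IsPathFunctional Ψ ℓ)
    (hW : IsNiceBrownian W P) : Measurable fun ω ↦ Ψ (W · ω) := by
  obtain ⟨Φ, m, e⟩ := h.exists_measurable
  simp only [fun ω ↦ e _ (hW.cont ω)]
  exact m.comp hW.measurable_path

lemma IsPathFunctional.identDistrib {Ω' : Type*} {mΩ' : MeasurableSpace Ω'} {Q : Measure Ω'}
    {V : ℝ≥0 → Ω' → ℝ} {Ψ : (ℝ≥0 → ℝ) → ℝ≥0∞} {ℓ : ℝ≥0} (h : IsPathFunctional Ψ ℓ)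
    (hW : IsNiceBrownian W P) (hV : IsNiceBrownian V Q) :
    IdentDistrib (fun ω ↦ Ψ (W · ω)) (fun ω ↦ Ψ (V · ω)) P Q := by
  obtain ⟨Φ, m, e⟩ := h.exists_measurable
  simp only [fun ω ↦ e _ (hW.cont ω), fun ω ↦ e _ (hV.cont ω)]
  exact IdentDistrib.comp ⟨hW.measurable_path.aemeasurable, hV.measurable_path.aemeasurable,
    hW.map_path_eq hV⟩ m

lemma IsPathFunctional.identDistrib_shift {Ψ : (ℝ≥0 → ℝ) → ℝ≥0∞} {ℓ : ℝ≥0}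
    (h : IsPathFunctional Ψ ℓ) (hW : IsNiceBrownian W P) (s : ℝ≥0) :
    IdentDistrib (fun ω ↦ Ψ (shiftPath s (W · ω))) (fun ω ↦ Ψ (W · ω)) P P :=
  h.identDistrib (hW.shift s) hW

/-- The earlier block is a function of the path up to time j ℓ, and the later one of the increments
after that time; these are independent. -/
lemma IsPathFunctional.pairwise_indepFun {Ψ : (ℝ≥0 → ℝ) → ℝ≥0∞} {ℓ : ℝ≥0}
    (h : IsPathFunctional Ψ ℓ) (hW : IsNiceBrownian W P) :
    Pairwise fun i j : ℕ ↦ IndepFun (fun ω ↦ Ψ (shiftPath (i * ℓ) (W · ω)))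
      (fun ω ↦ Ψ (shiftPath (j * ℓ) (W · ω))) P := by
  intro i j hij
  wlog hlt : i < j generalizing i j
  · exact (this hij.symm (lt_of_le_of_ne (not_lt.1 hlt) hij.symm)).symm
  obtain ⟨Φ, m, e⟩ := h.exists_measurable
  have hind := hW.indepFun_shift (j * ℓ)
  have hle : i * ℓ + ℓ ≤ j * ℓ := by
    have : (i : ℝ≥0) + 1 ≤ j := by exact_mod_cast hlt
    calc i * ℓ + ℓ = (i + 1) * ℓ := by ring
      _ ≤ j * ℓ := by gcongr
  -- Freezing the increments after time ℓ uses only values up to time j ℓ and keeps the path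
  -- continuous; locality of `Ψ` makes the change invisible.
  set φ : (Set.Iic (j * ℓ) → ℝ) → ℝ≥0 → ℝ := fun v t ↦
    v ⟨i * ℓ + min t ℓ, (add_le_add_right (min_le_right _ _) _).trans hle⟩ -
      v ⟨i * ℓ, le_self_add.trans hle⟩ with hφ
  have mφ : Measurable φ := measurable_pi_lambda _ fun t ↦ by fun_prop
  have h1 := hind.symm.comp (m.comp mφ) m
  have e1 : (fun ω ↦ Ψ (shiftPath (i * ℓ) (W · ω))) =
      (Φ ∘ φ) ∘ fun ω (t : Set.Iic (j * ℓ)) ↦ W t ω := by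
    ext ω
    have hc : Continuous fun t ↦ W (i * ℓ + min t ℓ) ω - W (i * ℓ) ω := by
      have := hW.cont ω
      fun_prop
    have := e _ hc
    rw [Function.comp_apply, Function.comp_apply]
    refine Eq.trans ?_ this
    refine h.local' _ _ fun t ht ↦ ?_
    rw [shiftPath, min_eq_left ht]
  have e2 : (fun ω ↦ Ψ (shiftPath (j * ℓ) (W · ω))) =
      Φ ∘ fun ω t ↦ W (j * ℓ + t) ω - W (j * ℓ) ω := by
    ext ω
    exact e _ ((hW.shift (j * ℓ)).cont ω)
  rw [e1, e2]
  exact h1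

/-! ### Moments of the oscillation cost. -/

/-- The even moments of the standard Gaussian distribution. -/
def gaussMoment (k : ℕ) : ℝ≥0∞ := ∫⁻ z, ‖z‖ₑ ^ (2 * k) ∂gaussianReal 0 1

lemma gaussMoment_ne_top (k : ℕ) : gaussMoment k ≠ ∞ := by
  rcases Nat.eq_zero_or_pos k with rfl | hk
  · simp [gaussMoment]
  have h : MemLp (id : ℝ → ℝ) (2 * k : ℕ) (gaussianReal 0 1) := by
    simpa using memLp_id_gaussianReal (μ := 0) (v := 1) (2 * k : ℕ)
  have h2 := lintegral_rpow_enorm_lt_top_of_eLpNorm_lt_top (p := ((2 * k : ℕ) : ℝ≥0∞))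
    (by simpa using hk.ne') (ENNReal.natCast_ne_top _) h.2
  simpa only [gaussMoment, ENNReal.toReal_natCast, ENNReal.rpow_natCast, id] using h2.ne

lemma lintegral_enorm_pow_eval (hW : IsNiceBrownian W P) (t : ℝ≥0) (k : ℕ) :
    ∫⁻ ω, ‖W t ω‖ₑ ^ (2 * k) ∂P = t ^ k * gaussMoment k := by
  have hm : Measurable fun z : ℝ ↦ ‖z‖ₑ ^ (2 * k) := by fun_prop
  rw [← lintegral_map hm (hW.meas t), (hW.hasLaw_eval t).map_eq]
  have h1 := gaussianReal_map_const_mul (μ := 0) (v := 1) (√t)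
  have h2 : (NNReal.mk (√(t : ℝ) ^ 2) (sq_nonneg _)) * 1 = t := by
    ext
    simp [Real.sq_sqrt t.coe_nonneg]
  rw [mul_zero, h2] at h1
  rw [← h1, lintegral_map hm (by fun_prop), gaussMoment, ← lintegral_const_mul' _ _ (by finiteness)]
  refine lintegral_congr fun z ↦ ?_
  rw [enorm_mul, mul_pow, pow_mul, pow_mul]
  congr 2
  rw [← ofReal_sq_eq_enorm_sq, Real.sq_sqrt t.coe_nonneg, ENNReal.ofReal_coe_nnreal]

/-- The reflection principle reduces the running maximum to the end value, to which Markov's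
inequality with a high even moment applies. -/
lemma measure_hit_le (hW : IsNiceBrownian W P) (t : ℝ≥0) {u : ℝ} (hu : 0 < u) (k : ℕ) :
    P {ω | ∃ s ≤ t, u < W s ω} ≤ t ^ k * gaussMoment k / ENNReal.ofReal u ^ (2 * k) := by
  rw [measure_hit hW t hu.le, ← lintegral_enorm_pow_eval hW t k]
  have hm : Measurable fun ω ↦ ‖W t ω‖ₑ ^ (2 * k) := by
    have := hW.meas t
    fun_prop
  refine le_trans (measure_mono fun ω (hω : u < |W t ω|) ↦ ?_)
    (meas_ge_le_lintegral_div hm.aemeasurable (ε := ENNReal.ofReal u ^ (2 * k))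
      (by simp [hu]) (by finiteness))
  simp only [Set.mem_ofPred_eq]
  gcongr
  rw [← ofReal_norm, Real.norm_eq_abs]
  exact ENNReal.ofReal_le_ofReal hω.le

/-- The event that the increments of the path over some cell of the grid are large. -/
def largeOsc (W : ℝ≥0 → Ω → ℝ) (m : ℕ) (δ : ℝ≥0) (ρ : ℝ) : Set Ω :=
  ⋃ i ∈ Finset.range m, ({ω | ∃ t ≤ δ, ρ < W (i * δ + t) ω - W (i * δ) ω} ∪
    {ω | ∃ t ≤ δ, ρ < -(W (i * δ + t) ω - W (i * δ) ω)})

lemma measurableSet_largeOsc (hW : IsNiceBrownian W P) (m : ℕ) (δ : ℝ≥0) (ρ : ℝ) :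
    MeasurableSet (largeOsc W m δ ρ) :=
  Finset.measurableSet_biUnion _ fun i _ ↦ (measurableSet_hit (hW.shift (i * δ)) δ ρ).union
    (measurableSet_hit (hW.shift (i * δ)).neg δ ρ)

lemma smallOsc_of_notMem {m : ℕ} {δ : ℝ≥0} {ρ : ℝ} {ω : Ω} (h : ω ∉ largeOsc W m δ ρ) :
    SmallOsc (W · ω) m δ ρ := by
  intro i hi t ht
  by_contra hcon
  refine h (Set.mem_biUnion (Finset.mem_coe.2 (Finset.mem_range.2 hi)) ?_)
  rcases lt_abs.1 (not_le.1 hcon) with h1 | h1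
  · exact Or.inl ⟨t, ht, h1⟩
  · exact Or.inr ⟨t, ht, h1⟩

lemma measure_largeOsc_le (hW : IsNiceBrownian W P) (m : ℕ) (δ : ℝ≥0) {ρ : ℝ} (hρ : 0 < ρ)
    (k : ℕ) : P (largeOsc W m δ ρ) ≤
      m * (2 * (δ ^ k * gaussMoment k / ENNReal.ofReal ρ ^ (2 * k))) := by
  refine (measure_biUnion_finset_le _ _).trans ((Finset.sum_le_card_nsmul _ _
    (2 * (δ ^ k * gaussMoment k / ENNReal.ofReal ρ ^ (2 * k))) fun i _ ↦ ?_).trans ?_)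
  · rw [two_mul]
    exact (measure_union_le _ _).trans (add_le_add (measure_hit_le (hW.shift (i * δ)) δ hρ k)
      (measure_hit_le (hW.shift (i * δ)).neg δ hρ k))
  · simp

/-- A bound, per unit of time, for the moments of `oscCost`. -/
def oscMoment (p : ℕ) : ℝ≥0∞ :=
  2 * (4 ^ p * (2 * (gaussMoment (2 * p + 2) * 4 ^ (2 * p + 2))))

lemma oscMoment_ne_top (p : ℕ) : oscMoment p ≠ ∞ := by
  have := gaussMoment_ne_top (2 * p + 2)
  unfold oscMoment
  finiteness

/-- If n is the first good scale, either n = 0 and the cost is at most 1, or scale n - 1 is bad and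
its term already equals the bound 4ⁿ to the power p. If all scales are bad, the sum is infinite. -/
lemma oscCost_pow_le (ℓ : ℕ) (p : ℕ) (ω : Ω) :
    oscCost ℓ (W · ω) ^ p ≤ 1 + ∑' n : ℕ, (largeOsc W (ℓ * 2 ^ n) ((2 ^ n)⁻¹) (1 / 2)).indicator
      (fun _ ↦ ((4 : ℝ≥0∞) ^ (n + 1)) ^ p) ω := by
  classical
  set B : ℕ → Set Ω := fun n ↦ largeOsc W (ℓ * 2 ^ n) ((2 ^ n)⁻¹) (1 / 2) with hB
  have hle : ∀ n, ω ∉ B n → oscCost ℓ (W · ω) ≤ 4 ^ n := fun n hn ↦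
    iInf₂_le n (smallOsc_of_notMem hn)
  by_cases hex : ∃ n, ω ∉ B n
  · set n := Nat.find hex with hn
    have h1 : ω ∉ B n := Nat.find_spec hex
    refine (pow_le_pow_left₀ zero_le (hle n h1) p).trans ?_
    rcases Nat.eq_zero_or_pos n with h0 | h0
    · rw [h0]; simp
    · have h2 : ω ∈ B (n - 1) := not_not.1 (Nat.find_min hex (m := n - 1) (by omega))
      refine le_trans ?_ (le_trans (ENNReal.le_tsum (n - 1)) le_add_self)
      rw [Set.indicator_of_mem h2, Nat.sub_add_cancel h0]
  · push Not at hex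
    have : ∑' n : ℕ, (B n).indicator (fun _ ↦ ((4 : ℝ≥0∞) ^ (n + 1)) ^ p) ω = ∞ := by
      refine top_unique ?_
      rw [← ENNReal.tsum_const_eq_top_of_ne_zero (α := ℕ) one_ne_zero]
      refine ENNReal.tsum_le_tsum fun n ↦ ?_
      rw [Set.indicator_of_mem (hex n)]
      exact one_le_pow₀ (one_le_pow₀ (by norm_num))
    rw [this]
    simp

lemma lintegral_oscCost_pow_le (hW : IsNiceBrownian W P) (ℓ p : ℕ) :
    ∫⁻ ω, oscCost ℓ (W · ω) ^ p ∂P ≤ 1 + ℓ * oscMoment p := by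
  have hP := hW.isProbabilityMeasure
  refine (lintegral_mono fun ω ↦ oscCost_pow_le ℓ p ω).trans ?_
  rw [lintegral_add_left measurable_const, lintegral_const, measure_univ, mul_one,
    lintegral_tsum fun n ↦ (measurable_const.indicator (measurableSet_largeOsc hW _ _ _)).aemeasurable]
  refine add_le_add_right ?_ _
  simp_rw [lintegral_indicator (measurableSet_largeOsc hW _ _ _), setLIntegral_const]
  -- At scale n there are ℓ 2ⁿ cells, each bad with probability of order 2^(-nk), at cost 4^(np).
  -- The exponent k = 2p + 2 leaves 2⁻ⁿ, which is summable, and a bound affine in ℓ.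
  set k := 2 * p + 2 with hk
  have hterm : ∀ n : ℕ, ((4 : ℝ≥0∞) ^ (n + 1)) ^ p * P (largeOsc W (ℓ * 2 ^ n) ((2 ^ n)⁻¹) (1 / 2)) ≤
      (2⁻¹ : ℝ≥0∞) ^ n * (ℓ * (4 ^ p * (2 * (gaussMoment k * 4 ^ k)))) := by
    intro n
    refine (mul_le_mul_right (measure_largeOsc_le hW _ _ (by norm_num) k) _).trans_eq ?_
    have h1 : ENNReal.ofReal (1 / 2) = 2⁻¹ := by
      rw [one_div, ENNReal.ofReal_inv_of_pos (by norm_num)]; simp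
    have h2 : (((2 ^ n)⁻¹ : ℝ≥0) : ℝ≥0∞) = (2⁻¹) ^ n := by
      rw [ENNReal.coe_inv (by positivity)]; push_cast; rw [ENNReal.inv_pow]
    have h3 : (4 : ℝ≥0∞) = 2 ^ 2 := by norm_num
    have h4 : (2 : ℝ≥0∞) * 2⁻¹ = 1 := ENNReal.mul_inv_cancel (by simp) (by simp)
    rw [h1, h2, ENNReal.div_eq_inv_mul, ← ENNReal.inv_pow, inv_inv, pow_mul 2 2 k, ← h3]
    have h5 : ((4 : ℝ≥0∞) ^ (n + 1)) ^ p * 2 ^ n * ((2⁻¹ : ℝ≥0∞) ^ n) ^ k = (2⁻¹) ^ n * 4 ^ p := by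
      have h6 : ((4 : ℝ≥0∞) ^ (n + 1)) ^ p = (2 ^ n) ^ (2 * p) * 4 ^ p := by
        rw [← pow_mul, ← pow_mul, h3, ← pow_mul, ← pow_mul, ← pow_add]
        congr 1
        ring
      have h7 : (2 : ℝ≥0∞) ^ n * (2⁻¹) ^ n = 1 := by rw [← mul_pow, h4, one_pow]
      rw [h6, hk]
      calc ((2 : ℝ≥0∞) ^ n) ^ (2 * p) * 4 ^ p * 2 ^ n * ((2⁻¹ : ℝ≥0∞) ^ n) ^ (2 * p + 2)
          = (2 ^ n * (2⁻¹) ^ n) ^ (2 * p + 1) * ((2⁻¹) ^ n * 4 ^ p) := by ring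
        _ = (2⁻¹) ^ n * 4 ^ p := by rw [h7, one_pow, one_mul]
    calc ((4 : ℝ≥0∞) ^ (n + 1)) ^ p * (((ℓ * 2 ^ n : ℕ) : ℝ≥0∞) *
          (2 * (4 ^ k * (((2⁻¹ : ℝ≥0∞) ^ n) ^ k * gaussMoment k))))
        = (((4 : ℝ≥0∞) ^ (n + 1)) ^ p * 2 ^ n * ((2⁻¹ : ℝ≥0∞) ^ n) ^ k) *
          (ℓ * (2 * (gaussMoment k * 4 ^ k))) := by push_cast; ring
      _ = _ := by rw [h5]; ring
  refine (ENNReal.tsum_le_tsum hterm).trans_eq ?_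
  rw [ENNReal.tsum_mul_right, ENNReal.tsum_geometric, ENNReal.one_sub_inv_two, inv_inv]
  rw [oscMoment]
  ring

lemma memLp_toReal_of_lintegral_pow {X : Ω → ℝ≥0∞} (hX : Measurable X) {p : ℕ} (hp : p ≠ 0)
    (h : ∫⁻ ω, X ω ^ p ∂P ≠ ∞) :
    MemLp (fun ω ↦ (X ω).toReal) p P ∧ ∀ᵐ ω ∂P, X ω < ∞ := by
  constructor
  · refine ⟨hX.ennreal_toReal.aestronglyMeasurable, ?_⟩
    rw [eLpNorm_lt_top_iff_lintegral_rpow_enorm_lt_top (by exact_mod_cast hp)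
      (ENNReal.natCast_ne_top _)]
    simp only [ENNReal.toReal_natCast, ENNReal.rpow_natCast]
    refine lt_of_le_of_lt (lintegral_mono fun ω ↦ ?_) h.lt_top
    gcongr
    rcases eq_or_ne (X ω) ∞ with h1 | h1
    · simp [h1]
    · rw [← ofReal_norm, Real.norm_of_nonneg ENNReal.toReal_nonneg, ENNReal.ofReal_toReal h1]
  · filter_upwards [ae_lt_top (hX.pow_const p) h] with ω hω
    by_contra hcon
    rw [not_lt, top_le_iff] at hcon
    simp [hcon, hp] at hω

namespace IsPathFunctional

variable {Ψ : (ℝ≥0 → ℝ) → ℝ≥0∞} {ℓ : ℝ≥0}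

lemma memLp_of_le (h : IsPathFunctional Ψ ℓ) (hW : IsNiceBrownian W P) {L : ℕ} {a : ℝ≥0∞}
    (ha : a ≠ ∞) (hle : ∀ w, Ψ w ≤ a * oscCost L w) {p : ℕ} (hp : p ≠ 0) :
    MemLp (fun ω ↦ (Ψ (W · ω)).toReal) p P ∧ ∀ᵐ ω ∂P, Ψ (W · ω) < ∞ := by
  refine memLp_toReal_of_lintegral_pow (h.measurable hW) hp (ne_top_of_le_ne_top ?_
    (lintegral_mono fun ω ↦ pow_le_pow_left₀ zero_le (hle (W · ω)) p))
  simp_rw [mul_pow]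
  rw [lintegral_const_mul' _ _ (by finiteness)]
  have := ne_top_of_le_ne_top (by have := oscMoment_ne_top p; finiteness)
    (lintegral_oscCost_pow_le hW L p)
  finiteness

/-- The law of large numbers for a functional of the increments over blocks of length `ℓ`. -/
lemma tendsto_average (h : IsPathFunctional Ψ ℓ) (hW : IsNiceBrownian W P) {p : ℕ} (hp : p ≠ 0)
    (hLp : MemLp (fun ω ↦ (Ψ (W · ω)).toReal) p P) :
    Tendsto (fun n : ℕ ↦ eLpNorm (fun ω ↦ (n : ℝ)⁻¹ *
      (∑ i ∈ Finset.range n, (Ψ (shiftPath (i * ℓ) (W · ω))).toReal) - ∫ ω, (Ψ (W · ω)).toReal ∂P)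
      p P) atTop (𝓝 0) := by
  have hid : ∀ i : ℕ, IdentDistrib (fun ω ↦ (Ψ (shiftPath (i * ℓ) (W · ω))).toReal)
      (fun ω ↦ (Ψ (W · ω)).toReal) P P := fun i ↦
    (h.identDistrib_shift hW (i * ℓ)).comp ENNReal.measurable_toReal
  have := strong_law_Lp (μ := P) (p := p) (by exact_mod_cast Nat.one_le_iff_ne_zero.2 hp)
    (ENNReal.natCast_ne_top _) (fun (i : ℕ) ω ↦ (Ψ (shiftPath (i * ℓ) (W · ω))).toReal)
    ((hid 0).symm.memLp_snd hLp) (fun i j hij ↦ (h.pairwise_indepFun hW hij).comp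
      ENNReal.measurable_toReal ENNReal.measurable_toReal) (fun i ↦ (hid i).trans (hid 0).symm)
  simp only [(hid 0).integral_eq, smul_eq_mul] at this
  exact this

lemma lintegral_shift (h : IsPathFunctional Ψ ℓ) (hW : IsNiceBrownian W P) (s : ℝ≥0) :
    ∫⁻ ω, Ψ (shiftPath s (W · ω)) ∂P = ∫⁻ ω, Ψ (W · ω) ∂P :=
  (h.identDistrib_shift hW s).lintegral_eq

end IsPathFunctional

/-! ### Energy per unit of time and the law of large numbers. -/

lemma tubeEnergy_zero_time {S : Set ℝ} (hS : 0 ∈ S) (w : ℝ≥0 → ℝ) {r : ℝ} (hr : 0 ≤ r) :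
    tubeEnergy S w 0 r = 0 := by
  refine le_antisymm ((tubeEnergy_anti (Set.singleton_subset_iff.2 hS) w 0 r).trans
    ((tubeEnergy_le_bridgeEnergy w 0 r).trans_eq (bridgeEnergy_zero w hr))) zero_le

lemma isPathFunctional_tubeEnergy_univ' (T : ℝ≥0) {r : ℝ} (hr : 0 < r) :
    IsPathFunctional (tubeEnergy Set.univ · T r) T := by
  rcases eq_or_ne T 0 with rfl | hT
  · simp only [tubeEnergy_zero_time (Set.mem_univ _) _ hr.le]
    exact ⟨⟨fun _ ↦ 0, measurable_const, fun _ _ ↦ rfl⟩, fun _ _ _ ↦ rfl⟩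
  · exact isPathFunctional_tubeEnergy_univ (pos_iff_ne_zero.2 hT) hr

lemma tubeEnergy_le_oscCost {S : Set ℝ} (hS : 0 ∈ S) (w : ℝ≥0 → ℝ) {T : ℝ≥0} {L : ℕ} (hT : T ≤ L) :
    tubeEnergy S w T 1 ≤ L * oscCost L w :=
  (tubeEnergy_anti (Set.singleton_subset_iff.2 hS) w T 1).trans <|
    (tubeEnergy_mono _ w hT 1).trans <|
    (tubeEnergy_le_bridgeEnergy w L 1).trans (bridgeEnergy_le_oscCost L w)

lemma tubeEnergy_moments (hW : IsNiceBrownian W P) {T : ℝ≥0} (hT : 0 < T) {p : ℕ} (hp : p ≠ 0) :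
    MemLp (fun ω ↦ (tubeEnergy {0} (W · ω) T 1).toReal) p P ∧
      ∀ᵐ ω ∂P, tubeEnergy {0} (W · ω) T 1 < ∞ :=
  (isPathFunctional_tubeEnergy_zero hT one_pos).memLp_of_le hW (ENNReal.natCast_ne_top _)
    (fun w ↦ tubeEnergy_le_oscCost (Set.mem_singleton 0) w (Nat.le_ceil T)) hp

/-- The expectation of the minimal energy with free end points. -/
def meanEnergy (W : ℝ≥0 → Ω → ℝ) (P : Measure Ω) (n : ℕ) : ℝ :=
  ∫ ω, (tubeEnergy Set.univ (W · ω) n 1).toReal ∂P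

lemma freeEnergy_moments (hW : IsNiceBrownian W P) (n : ℕ) {p : ℕ} (hp : p ≠ 0) :
    MemLp (fun ω ↦ (tubeEnergy Set.univ (W · ω) n 1).toReal) p P ∧
      ∀ᵐ ω ∂P, tubeEnergy Set.univ (W · ω) n 1 < ∞ :=
  (isPathFunctional_tubeEnergy_univ' _ one_pos).memLp_of_le hW (ENNReal.natCast_ne_top _)
    (fun w ↦ tubeEnergy_le_oscCost (Set.mem_univ _) w le_rfl) hp

lemma oscCost_moments (hW : IsNiceBrownian W P) (n : ℕ) {p : ℕ} (hp : p ≠ 0) :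
    MemLp (fun ω ↦ (oscCost n (W · ω)).toReal) p P ∧ ∀ᵐ ω ∂P, oscCost n (W · ω) < ∞ :=
  (isPathFunctional_oscCost n).memLp_of_le hW ENNReal.one_ne_top (fun w ↦ by rw [one_mul]) hp

lemma meanEnergy_eq (hW : IsNiceBrownian W P) (n : ℕ) :
    ENNReal.ofReal (meanEnergy W P n) = ∫⁻ ω, tubeEnergy Set.univ (W · ω) n 1 ∂P := by
  have h := freeEnergy_moments hW n one_ne_zero
  rw [Nat.cast_one] at h
  rw [meanEnergy, integral_toReal
    ((isPathFunctional_tubeEnergy_univ' _ one_pos).measurable hW).aemeasurable h.2,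
    ENNReal.ofReal_toReal]
  refine ne_top_of_le_ne_top ?_ (lintegral_mono fun ω ↦
    tubeEnergy_le_oscCost (Set.mem_univ _) (W · ω) (T := n) le_rfl)
  rw [lintegral_const_mul' _ _ (by finiteness)]
  have := ne_top_of_le_ne_top (by have := oscMoment_ne_top 1; finiteness)
    (lintegral_oscCost_pow_le hW n 1)
  simp only [pow_one] at this
  finiteness

lemma meanEnergy_nonneg (n : ℕ) : 0 ≤ meanEnergy W P n :=
  integral_nonneg fun _ ↦ ENNReal.toReal_nonneg

/-- Pathwise superadditivity passes to means because the increments are stationary. -/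
lemma meanEnergy_add_le (hW : IsNiceBrownian W P) (m n : ℕ) :
    meanEnergy W P m + meanEnergy W P n ≤ meanEnergy W P (m + n) := by
  rw [← ENNReal.ofReal_le_ofReal_iff (meanEnergy_nonneg _),
    ENNReal.ofReal_add (meanEnergy_nonneg _) (meanEnergy_nonneg _), meanEnergy_eq hW,
    meanEnergy_eq hW, meanEnergy_eq hW]
  have h := (isPathFunctional_tubeEnergy_univ' (n : ℝ≥0) one_pos).lintegral_shift hW (m : ℝ≥0)
  rw [← h]
  refine (le_lintegral_add _ _).trans (lintegral_mono fun ω ↦ ?_)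
  push_cast
  exact tubeEnergy_add_le _ _ _ _ _

lemma meanEnergy_le (hW : IsNiceBrownian W P) : ∃ M : ℝ, ∀ n, meanEnergy W P n ≤ n * M := by
  have hfin : ∫⁻ ω, oscCost 1 (W · ω) ∂P ≠ ∞ := by
    have := ne_top_of_le_ne_top (by have := oscMoment_ne_top 1; finiteness)
      (lintegral_oscCost_pow_le hW 1 1)
    simpa only [pow_one] using this
  refine ⟨(∫⁻ ω, oscCost 1 (W · ω) ∂P).toReal, fun n ↦ ?_⟩
  rw [← ENNReal.ofReal_le_ofReal_iff (by positivity), meanEnergy_eq hW,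
    ENNReal.ofReal_mul (by positivity), ENNReal.ofReal_toReal hfin, ENNReal.ofReal_natCast]
  have hpf := isPathFunctional_oscCost 1
  have hle : ∀ w, tubeEnergy Set.univ w n 1 ≤
      ∑ i ∈ Finset.range n, oscCost 1 (shiftPath (i * 1) w) := by
    intro w
    have h1 := bridgeEnergy_le_sum w 1 zero_le_one n
    rw [mul_one] at h1
    refine (tubeEnergy_anti (Set.subset_univ {0}) w n 1).trans
      ((tubeEnergy_le_bridgeEnergy w n 1).trans (h1.trans (Finset.sum_le_sum fun i _ ↦ ?_)))
    simpa using bridgeEnergy_le_oscCost 1 (shiftPath (i * 1) w)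
  refine (lintegral_mono fun ω ↦ hle (W · ω)).trans_eq ?_
  rw [lintegral_finsetSum']
  · simp [hpf.lintegral_shift hW]
  · exact fun i _ ↦ (hpf.identDistrib_shift hW _).aemeasurable_fst

/-- The energy per unit of time. -/
lemma exists_tendsto_meanEnergy (hW : IsNiceBrownian W P) :
    ∃ c : ℝ, 0 ≤ c ∧ Tendsto (fun n : ℕ ↦ meanEnergy W P n / n) atTop (𝓝 c) := by
  -- Fekete's lemma for minus the mean energy; the linear bound `M` keeps the limit finite.
  have hsub : Subadditive fun n ↦ -meanEnergy W P n := fun m n ↦ by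
    linarith [meanEnergy_add_le hW m n]
  obtain ⟨M, hM⟩ := meanEnergy_le hW
  have hlim := (hsub.tendsto_lim ⟨-|M|, by
    rintro _ ⟨n, rfl⟩
    rcases Nat.eq_zero_or_pos n with rfl | hn
    · simp
    · have hn' : (0 : ℝ) < n := by exact_mod_cast hn
      rw [le_div_iff₀ hn']
      nlinarith [hM n, le_abs_self M]⟩).neg
  have e : (fun n : ℕ ↦ -(-meanEnergy W P n / n)) = fun n : ℕ ↦ meanEnergy W P n / n := by
    ext n; ring
  rw [e] at hlim
  exact ⟨_, ge_of_tendsto' hlim fun n ↦ div_nonneg (meanEnergy_nonneg n) n.cast_nonneg, hlim⟩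

/-- The average cost of a correction at the end points is negligible. -/
lemma tendsto_mean_oscCost (hW : IsNiceBrownian W P) :
    Tendsto (fun n : ℕ ↦ (∫ ω, (oscCost n (W · ω)).toReal ∂P) / n) atTop (𝓝 0) := by
  have hP := hW.isProbabilityMeasure
  set M := (oscMoment 2).toReal with hM
  -- The first moment bound is only linear in n. The second moment is also at most linear, so X ≤ √n
  -- + X² / √n gives a mean of order √n.
  have hle : ∀ n : ℕ, 0 < n →
      (∫ ω, (oscCost n (W · ω)).toReal ∂P) / n ≤ (2 + M) * (√n)⁻¹ := by
    intro n hn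
    have hn' : (1 : ℝ) ≤ n := by exact_mod_cast hn
    have hs : 0 < √(n : ℝ) := by positivity
    have hss : √(n : ℝ) * √n = n := Real.mul_self_sqrt (by positivity)
    have h1 := (oscCost_moments hW n one_ne_zero)
    have h2 := (oscCost_moments hW n two_ne_zero)
    have hi1 : Integrable (fun ω ↦ (oscCost n (W · ω)).toReal) P := by
      rw [← memLp_one_iff_integrable]; simpa using h1.1
    have hi2 : Integrable (fun ω ↦ (oscCost n (W · ω)).toReal ^ 2) P := by
      have := h2.1.integrable_sq
      exact this
    have hsq : ∫ ω, (oscCost n (W · ω)).toReal ^ 2 ∂P ≤ 1 + n * M := by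
      have hpow : ∀ ω, (oscCost n (W · ω)).toReal ^ 2 = (oscCost n (W · ω) ^ 2).toReal :=
        fun ω ↦ (ENNReal.toReal_pow _ _).symm
      simp only [hpow]
      rw [integral_toReal]
      · have hb := lintegral_oscCost_pow_le hW n 2
        have hfin := oscMoment_ne_top 2
        have := ENNReal.toReal_mono (by finiteness) hb
        rwa [ENNReal.toReal_add (by simp) (by finiteness), ENNReal.toReal_mul,
          ENNReal.toReal_one, ENNReal.toReal_natCast] at this
      · exact (((isPathFunctional_oscCost n).measurable hW).pow_const 2).aemeasurable
      · filter_upwards [h2.2] with ω hω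
        finiteness
    have hmono : ∫ ω, (oscCost n (W · ω)).toReal ∂P ≤
        ∫ ω, (√n + (oscCost n (W · ω)).toReal ^ 2 / √n) ∂P := by
      refine integral_mono hi1 ((integrable_const _).add (hi2.div_const _)) fun ω ↦ ?_
      set x := (oscCost n (W · ω)).toReal
      have hx : x * √n ≤ √n * √n + x ^ 2 := by nlinarith [sq_nonneg (x - √n), sq_nonneg (x + √n)]
      calc x = x * √n / √n := by field_simp
        _ ≤ (√n * √n + x ^ 2) / √n := by gcongr
        _ = √n + x ^ 2 / √n := by field_simp
    rw [integral_add (integrable_const _) (hi2.div_const _), integral_const, integral_div,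
      probReal_univ, one_smul] at hmono
    calc (∫ ω, (oscCost n (W · ω)).toReal ∂P) / n ≤ (√n + (1 + n * M) / √n) / n := by
          gcongr
          exact hmono.trans (by gcongr)
      _ ≤ (√n + (n + n * M) / √n) / n := by gcongr
      _ = (2 + M) * (√n)⁻¹ := by
          have key : ∀ s : ℝ, 0 < s → (s + (s * s + s * s * M) / s) / (s * s) = (2 + M) * s⁻¹ := by
            intro s hs
            field_simp
            ring
          have := key _ hs
          rwa [hss] at this
  have hlim : Tendsto (fun n : ℕ ↦ (2 + M) * (√(n : ℝ))⁻¹) atTop (𝓝 0) := by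
    have := (tendsto_inv_atTop_zero.comp (Real.tendsto_sqrt_atTop.comp
      (tendsto_natCast_atTop_atTop (R := ℝ)))).const_mul (2 + M)
    simpa using this
  refine squeeze_zero' (Eventually.of_forall fun n ↦ ?_) ?_ hlim
  · exact div_nonneg (integral_nonneg fun _ ↦ ENNReal.toReal_nonneg) n.cast_nonneg
  · filter_upwards [eventually_gt_atTop 0] with n hn using hle n hn

lemma tendsto_scaled_bound {e : ℕ → ℝ≥0∞} (he : Tendsto e atTop (𝓝 0)) {a : ℕ → ℝ} {a₀ : ℝ}
    (ha : Tendsto a atTop (𝓝 a₀)) (m c : ℝ) :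
    Tendsto (fun n ↦ ‖a n‖ₑ * e n + ‖a n * m - c‖ₑ) atTop (𝓝 ‖a₀ * m - c‖ₑ) := by
  have h1 : Tendsto (fun n ↦ ‖a n‖ₑ * e n) atTop (𝓝 (‖a₀‖ₑ * 0)) :=
    ENNReal.Tendsto.mul ha.enorm (.inr (by simp)) he (.inr (by simp))
  simpa using h1.add ((ha.mul_const m).sub_const c).enorm

lemma eLpNorm_mul_sub_const_le [IsProbabilityMeasure P] {X : Ω → ℝ} (hX : AEStronglyMeasurable X P)
    {p : ℝ≥0∞} (hp : 1 ≤ p) (a m c : ℝ) :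
    eLpNorm (fun ω ↦ a * X ω - c) p P ≤ ‖a‖ₑ * eLpNorm (fun ω ↦ X ω - m) p P + ‖a * m - c‖ₑ := by
  have e : (fun ω ↦ a * X ω - c) = a • (fun ω ↦ X ω - m) + fun _ ↦ a * m - c := by
    ext ω
    simp only [Pi.add_apply, Pi.smul_apply, smul_eq_mul]
    ring
  rw [e]
  refine (eLpNorm_add_le ((hX.sub aestronglyMeasurable_const).const_smul a)
    aestronglyMeasurable_const hp).trans ?_
  rw [eLpNorm_const_smul, eLpNorm_const _ (by positivity) (IsProbabilityMeasure.ne_zero P)]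
  simp only [measure_univ, ENNReal.one_rpow, mul_one]
  rfl

/-- The cost of one block in the upper bound for the energy. -/
def blockCost (ε : ℝ) (ℓ : ℕ) (w : ℝ≥0 → ℝ) : ℝ≥0∞ :=
  ENNReal.ofReal (1 + ε) * tubeEnergy Set.univ w ℓ 1 +
    ENNReal.ofReal (18 * (1 + 1 / ε)) * oscCost ℓ w

lemma isPathFunctional_blockCost (ε : ℝ) (ℓ : ℕ) : IsPathFunctional (blockCost ε ℓ) ℓ :=
  (isPathFunctional_tubeEnergy_univ' _ one_pos).add (isPathFunctional_oscCost ℓ) _ _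

lemma blockCost_moments (hW : IsNiceBrownian W P) (ε : ℝ) (n : ℕ) {p : ℕ} (hp : p ≠ 0) :
    MemLp (fun ω ↦ (blockCost ε n (W · ω)).toReal) p P ∧ ∀ᵐ ω ∂P, blockCost ε n (W · ω) < ∞ := by
  refine (isPathFunctional_blockCost ε n).memLp_of_le hW
    (a := ENNReal.ofReal (1 + ε) * n + ENNReal.ofReal (18 * (1 + 1 / ε))) (L := n)
    (by finiteness) (fun w ↦ ?_) hp
  rw [add_mul, mul_assoc]
  exact add_le_add_left (mul_le_mul_right (tubeEnergy_le_oscCost (Set.mem_univ _) w le_rfl) _) _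

lemma integral_blockCost (hW : IsNiceBrownian W P) {ε : ℝ} (hε : 0 < ε) (n : ℕ) :
    ∫ ω, (blockCost ε n (W · ω)).toReal ∂P = (1 + ε) * meanEnergy W P n +
      18 * (1 + 1 / ε) * ∫ ω, (oscCost n (W · ω)).toReal ∂P := by
  have h1 := freeEnergy_moments hW n one_ne_zero
  have h2 := oscCost_moments hW n one_ne_zero
  rw [Nat.cast_one, memLp_one_iff_integrable] at h1 h2
  rw [meanEnergy, ← integral_const_mul, ← integral_const_mul,
    ← integral_add (h1.1.const_mul _) (h2.1.const_mul _)]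
  refine integral_congr_ae ?_
  filter_upwards [h1.2, h2.2] with ω hω hω'
  rw [blockCost, ENNReal.toReal_add (by finiteness) (by finiteness), ENNReal.toReal_mul,
    ENNReal.toReal_mul, ENNReal.toReal_ofReal (by positivity), ENNReal.toReal_ofReal (by positivity)]

lemma toReal_sum_shift {Ψ : (ℝ≥0 → ℝ) → ℝ≥0∞} {ℓ : ℝ≥0}
    (h : ∀ s : ℝ≥0, ∀ᵐ ω ∂P, Ψ (shiftPath s (W · ω)) < ∞) :
    ∀ᵐ ω ∂P, ∀ n : ℕ, ∑ i ∈ Finset.range n, Ψ (shiftPath (i * ℓ) (W · ω)) ≠ ∞ ∧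
      (∑ i ∈ Finset.range n, Ψ (shiftPath (i * ℓ) (W · ω))).toReal =
        ∑ i ∈ Finset.range n, (Ψ (shiftPath (i * ℓ) (W · ω))).toReal := by
  filter_upwards [ae_all_iff.2 fun i : ℕ ↦ h (i * ℓ)] with ω hω n
  exact ⟨ENNReal.sum_ne_top.2 fun i _ ↦ (hω i).ne, ENNReal.toReal_sum fun i _ ↦ (hω i).ne⟩

/-- The energy is bounded below and above by sums over blocks. -/
lemma energy_sandwich (hW : IsNiceBrownian W P) {ℓ : ℕ} (hℓ : 0 < ℓ) {ε : ℝ} (hε : 0 < ε) :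
    ∀ᵐ ω ∂P, ∀ (n : ℕ) (T : ℝ≥0), n * ℓ ≤ T → T ≤ (n + 1) * ℓ →
      ∑ i ∈ Finset.range n, (tubeEnergy Set.univ (shiftPath (i * ℓ) (W · ω)) ℓ 1).toReal ≤
        (tubeEnergy {0} (W · ω) T 1).toReal ∧
      (tubeEnergy {0} (W · ω) T 1).toReal ≤
        ∑ i ∈ Finset.range (n + 1), (blockCost ε ℓ (shiftPath (i * ℓ) (W · ω))).toReal := by
  filter_upwards [toReal_sum_shift (W := W) (P := P) (Ψ := (tubeEnergy Set.univ · ℓ 1)) (ℓ := ℓ)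
      fun s ↦ (freeEnergy_moments (hW.shift s) ℓ one_ne_zero).2,
    toReal_sum_shift (W := W) (P := P) (Ψ := blockCost ε ℓ) (ℓ := ℓ)
      fun s ↦ (blockCost_moments (hW.shift s) ε ℓ one_ne_zero).2] with ω h1 h2 n T hn hT
  have hup : tubeEnergy {0} (W · ω) T 1 ≤
      ∑ i ∈ Finset.range (n + 1), blockCost ε ℓ (shiftPath (i * ℓ) (W · ω)) := by
    refine (tubeEnergy_mono _ _ hT 1).trans ?_
    have := tubeEnergy_le_sum (W · ω) hℓ hε (n + 1)
    push_cast at this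
    exact this
  have hlow : ∑ i ∈ Finset.range n, tubeEnergy Set.univ (shiftPath (i * ℓ) (W · ω)) ℓ 1 ≤
      tubeEnergy {0} (W · ω) T 1 :=
    (sum_tubeEnergy_le {0} (W · ω) ℓ 1 n).trans (tubeEnergy_mono _ _ hn 1)
  rw [← (h1 n).2, ← (h2 (n + 1)).2]
  exact ⟨ENNReal.toReal_mono (ne_top_of_le_ne_top (h2 (n + 1)).1 hup) hlow,
    ENNReal.toReal_mono (h2 (n + 1)).1 hup⟩

lemma abs_sub_le_of_mem_Icc {x a b c : ℝ} (h1 : a ≤ x) (h2 : x ≤ b) :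
    |x - c| ≤ |a - c| + |b - c| := by
  rw [abs_le]
  constructor
  · linarith [neg_abs_le (a - c), abs_nonneg (b - c)]
  · linarith [le_abs_self (b - c), abs_nonneg (a - c)]

lemma aestronglyMeasurable_average {Ψ : (ℝ≥0 → ℝ) → ℝ≥0∞} {ℓ : ℝ≥0} (h : IsPathFunctional Ψ ℓ)
    (hW : IsNiceBrownian W P) (n : ℕ) :
    AEStronglyMeasurable (fun ω ↦ (n : ℝ)⁻¹ *
      ∑ i ∈ Finset.range n, (Ψ (shiftPath (i * ℓ) (W · ω))).toReal) P := by
  have hm : ∀ i : ℕ, Measurable fun ω ↦ (Ψ (shiftPath (i * ℓ) (W · ω))).toReal := fun i ↦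
    (h.measurable (hW.shift (i * ℓ))).ennreal_toReal
  exact ((Finset.measurable_fun_sum _ fun i _ ↦ hm i).const_mul _).aestronglyMeasurable

/-- For a fixed block length the energy lies between two block sums, whose averages converge by the
law of large numbers; `hη` measures how far the two limits are from `c`. -/
lemma eventually_eLpNorm_energy_le (hW : IsNiceBrownian W P) {ℓ : ℕ} (hℓ : 0 < ℓ) {ε : ℝ}
    (hε : 0 < ε) {p : ℕ} (hp : p ≠ 0) (c : ℝ) {η : ℝ≥0∞}
    (hη : ‖meanEnergy W P ℓ / ℓ - c‖ₑ +
      ‖(∫ ω, (blockCost ε ℓ (W · ω)).toReal ∂P) / ℓ - c‖ₑ < η) :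
    ∀ᶠ T : ℝ≥0 in atTop,
      eLpNorm (fun ω ↦ (tubeEnergy {0} (W · ω) T 1).toReal / T - c) p P ≤ η := by
  have hP := hW.isProbabilityMeasure
  have hℓ' : (0 : ℝ) < ℓ := by exact_mod_cast hℓ
  have hp1 : (1 : ℝ≥0∞) ≤ p := by exact_mod_cast Nat.one_le_iff_ne_zero.2 hp
  have F1 := isPathFunctional_tubeEnergy_univ' (ℓ : ℝ≥0) one_pos
  have G1 := isPathFunctional_blockCost ε ℓ
  have F2 := F1.tendsto_average hW hp (freeEnergy_moments hW ℓ hp).1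
  have G2 := (G1.tendsto_average hW hp (blockCost_moments hW ε ℓ hp).1).comp (tendsto_add_atTop_nat 1)
  set A : ℕ → Ω → ℝ := fun n ω ↦ (n : ℝ)⁻¹ *
    ∑ i ∈ Finset.range n, (tubeEnergy Set.univ (shiftPath (i * ℓ) (W · ω)) ℓ 1).toReal with hA
  set B : ℕ → Ω → ℝ := fun n ω ↦ (n : ℝ)⁻¹ *
    ∑ i ∈ Finset.range n, (blockCost ε ℓ (shiftPath (i * ℓ) (W · ω))).toReal with hB
  set m₁ := meanEnergy W P ℓ with hm1
  set m₂ := ∫ ω, (blockCost ε ℓ (W · ω)).toReal ∂P with hm2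
  -- With n = ⌊T / ℓ⌋, the lower sum has n terms but is divided by (n + 1) ℓ, and the upper sum has
  -- n + 1 terms but is divided by n ℓ. The ratios n / (n + 1) and its inverse account for the
  -- mismatch.
  have hrat : Tendsto (fun n : ℕ ↦ (n : ℝ) / (n + 1)) atTop (𝓝 1) := tendsto_natCast_div_add_atTop 1
  have ha : Tendsto (fun n : ℕ ↦ (n : ℝ) / (n + 1) / ℓ) atTop (𝓝 (1 / ℓ)) := hrat.div_const _
  have hb : Tendsto (fun n : ℕ ↦ ((n : ℝ) / (n + 1))⁻¹ / ℓ) atTop (𝓝 (1 / ℓ)) := by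
    simpa using (hrat.inv₀ one_ne_zero).div_const (ℓ : ℝ)
  have h3 := (tendsto_scaled_bound F2 ha m₁ c).add (tendsto_scaled_bound G2 hb m₂ c)
  rw [one_div_mul_eq_div, one_div_mul_eq_div] at h3
  have h4 : Tendsto (fun T : ℝ≥0 ↦ ⌊T / ℓ⌋₊) atTop atTop :=
    tendsto_nat_floor_atTop.comp (tendsto_id.atTop_div_const (by exact_mod_cast hℓ))
  filter_upwards [h4.eventually (h3.eventually_le_const hη), h4.eventually_gt_atTop 0] with T hT hn
  refine le_trans ?_ hT
  set n := ⌊T / ℓ⌋₊ with hndef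
  have hn' : (0 : ℝ) < n := by exact_mod_cast hn
  have hℓ0 : (0 : ℝ≥0) < ℓ := by exact_mod_cast hℓ
  have t1 : (n : ℝ≥0) * ℓ ≤ T := (le_div_iff₀ hℓ0).1 (Nat.floor_le zero_le)
  have t2 : T ≤ ((n : ℝ≥0) + 1) * ℓ := ((div_lt_iff₀ hℓ0).1 (Nat.lt_floor_add_one _)).le
  have t1' : (n : ℝ) * ℓ ≤ T := by exact_mod_cast t1
  have t2' : (T : ℝ) ≤ ((n : ℝ) + 1) * ℓ := by exact_mod_cast t2
  have hT0 : (0 : ℝ) < T := lt_of_lt_of_le (by positivity) t1'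
  have hpt : ∀ᵐ ω ∂P, ‖(tubeEnergy {0} (W · ω) T 1).toReal / T - c‖ ≤
      ((fun ω ↦ ‖(n : ℝ) / (n + 1) / ℓ * A n ω - c‖) +
        fun ω ↦ ‖((n : ℝ) / (n + 1))⁻¹ / ℓ * B (n + 1) ω - c‖) ω := by
    filter_upwards [energy_sandwich hW hℓ hε] with ω hω
    obtain ⟨l, u⟩ := hω n T t1 t2
    refine abs_sub_le_of_mem_Icc ?_ ?_
    · have e : (n : ℝ) / (n + 1) / ℓ * A n ω =
          (∑ i ∈ Finset.range n, (tubeEnergy Set.univ (shiftPath (i * ℓ) (W · ω)) ℓ 1).toReal) /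
            ((n + 1) * ℓ) := by
        have key : ∀ S : ℝ, (n : ℝ) / (n + 1) / ℓ * ((n : ℝ)⁻¹ * S) = S / ((n + 1) * ℓ) := by
          intro S; field_simp
        exact key _
      rw [e]
      exact div_le_div₀ ENNReal.toReal_nonneg l hT0 t2'
    · have e : ((n : ℝ) / (n + 1))⁻¹ / ℓ * B (n + 1) ω =
          (∑ i ∈ Finset.range (n + 1), (blockCost ε ℓ (shiftPath (i * ℓ) (W · ω))).toReal) /
            (n * ℓ) := by
        have key : ∀ S : ℝ, ((n : ℝ) / (n + 1))⁻¹ / ℓ * (((n + 1 : ℕ) : ℝ)⁻¹ * S) =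
            S / (n * ℓ) := by
          intro S; push_cast; field_simp
        exact key _
      rw [e]
      exact div_le_div₀ (Finset.sum_nonneg fun _ _ ↦ ENNReal.toReal_nonneg) u (by positivity) t1'
  have mA : AEStronglyMeasurable (A n) P := aestronglyMeasurable_average F1 hW n
  have mB : AEStronglyMeasurable (B (n + 1)) P := aestronglyMeasurable_average G1 hW (n + 1)
  refine (eLpNorm_mono_ae_real hpt).trans ((eLpNorm_add_le ?_ ?_ hp1).trans (add_le_add ?_ ?_))
  · exact ((mA.const_mul _).sub aestronglyMeasurable_const).norm
  · exact ((mB.const_mul _).sub aestronglyMeasurable_const).norm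
  · rw [eLpNorm_norm]
    exact eLpNorm_mul_sub_const_le mA hp1 _ _ _
  · rw [eLpNorm_norm]
    exact eLpNorm_mul_sub_const_le mB hp1 _ _ _

/-- The energy per unit of time converges in every `L_p`. -/
theorem tendsto_eLpNorm_energy (hW : IsNiceBrownian W P) {c : ℝ} (hc0 : 0 ≤ c)
    (hc : Tendsto (fun n : ℕ ↦ meanEnergy W P n / n) atTop (𝓝 c)) {p : ℕ} (hp : p ≠ 0) :
    Tendsto (fun T : ℝ≥0 ↦ eLpNorm (fun ω ↦ (tubeEnergy {0} (W · ω) T 1).toReal / T - c) p P)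
      atTop (𝓝 0) := by
  rw [ENNReal.tendsto_nhds_zero]
  intro η hη
  obtain ⟨δ, hδ0, hδ⟩ : ∃ δ : ℝ, 0 < δ ∧ ENNReal.ofReal δ < η := by
    obtain ⟨δ, h1, h2⟩ := ENNReal.lt_iff_exists_nnreal_btwn.1 hη
    exact ⟨δ, by simpa using h1, by simpa using h2⟩
  -- As ℓ → ∞ the lower limit tends to c and the upper one to (1 + ε) c. Thus ε is chosen first,
  -- with ε c < δ, and one block length ℓ afterwards.
  set ε : ℝ := δ / (2 * (c + 1)) with hεdef
  have hε : 0 < ε := by positivity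
  have hεc : ε * c < δ := by
    rw [hεdef, div_mul_eq_mul_div, div_lt_iff₀ (by positivity)]
    nlinarith
  have h1 : Tendsto (fun n : ℕ ↦ (∫ ω, (blockCost ε n (W · ω)).toReal ∂P) / n) atTop
      (𝓝 ((1 + ε) * c + 18 * (1 + 1 / ε) * 0)) := by
    refine ((hc.const_mul (1 + ε)).add ((tendsto_mean_oscCost hW).const_mul
      (18 * (1 + 1 / ε)))).congr fun n ↦ ?_
    rw [integral_blockCost hW hε]
    ring
  have h2 := (hc.sub_const c).enorm.add (h1.sub_const c).enorm
  have h3 : ‖c - c‖ₑ + ‖(1 + ε) * c + 18 * (1 + 1 / ε) * 0 - c‖ₑ < η := by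
    refine lt_of_le_of_lt ?_ hδ
    rw [sub_self, enorm_zero, zero_add, show (1 + ε) * c + 18 * (1 + 1 / ε) * 0 - c = ε * c by ring,
      ← ofReal_norm, Real.norm_of_nonneg (by positivity)]
    exact ENNReal.ofReal_le_ofReal hεc.le
  obtain ⟨ℓ, hℓ, hℓ0⟩ := ((h2.eventually_lt_const h3).and (eventually_gt_atTop 0)).exists
  exact eventually_eLpNorm_energy_le hW hℓ0 hε hp c hℓ

/-! ### Brownian scaling and convergence of the norms. -/

lemma energy_const_mul (a T : ℝ) (h : ℝ → ℝ) :
    energy T (fun t ↦ a * h t) = ENNReal.ofReal (a ^ 2) * energy T h := by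
  unfold energy
  rw [← lintegral_const_mul _ ((measurable_deriv h).pow_const 2).ennreal_ofReal]
  refine lintegral_congr fun t ↦ ?_
  rw [deriv_const_mul_field, mul_pow, ENNReal.ofReal_mul (sq_nonneg a)]

lemma lintegral_Icc_comp_mul {c : ℝ} (hc : 0 < c) (T : ℝ) (f : ℝ → ℝ≥0∞) :
    ∫⁻ t in Set.Icc 0 T, f t = ENNReal.ofReal c * ∫⁻ t in Set.Icc 0 (T / c), f (c * t) := by
  have h := lintegral_image_eq_lintegral_abs_deriv_mul (s := Set.Icc 0 (T / c))
    (f := fun t ↦ c * t) (f' := fun _ ↦ c) measurableSet_Icc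
    (fun x _ ↦ by simpa using ((hasDerivAt_id x).const_mul c).hasDerivWithinAt)
    (fun x _ y _ hxy ↦ mul_left_cancel₀ hc.ne' hxy) f
  rw [Set.image_mul_left_Icc' hc, mul_zero, mul_div_cancel₀ _ hc.ne'] at h
  rw [h, abs_of_pos hc, lintegral_const_mul' _ _ (by finiteness)]

/-- Brownian scaling of a path. -/
def scalePath (c : ℝ≥0) (w : ℝ≥0 → ℝ) (t : ℝ≥0) : ℝ := (√c)⁻¹ * w (c * t)

/-- The map sending h to t ↦ c^(-1/2) h(ct) preserves the energy: the squared derivative gains a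
factor c, which the change of variable removes. -/
lemma minNorm_scalePath_le {c : ℝ≥0} (hc : 0 < c) (w : ℝ≥0 → ℝ) {T : ℝ} (hT : 0 ≤ T) (r : ℝ) :
    minNorm (scalePath c w) (T / c) (r / √c) ≤ minNorm w T r := by
  have hc' : (0 : ℝ) < c := hc
  refine le_iInf₂ fun h hh ↦ ?_
  obtain ⟨ac, he⟩ := absolutelyContinuousOnInterval_comp_affine (h := h) (c := c) (d := 0)
    (L := T / c) (T := T) hc' le_rfl (by positivity) (by rw [mul_div_cancel₀ _ hc'.ne', add_zero]) hh.1
  simp only [add_zero] at ac he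
  have hE : energy (T / c) (fun t ↦ (√c)⁻¹ * h (c * t)) = energy T h := by
    rw [energy_const_mul, he, energy,
      lintegral_Icc_comp_mul hc' T fun t ↦ ENNReal.ofReal (deriv h t ^ 2),
      ← lintegral_const_mul' _ _ (by finiteness), ← lintegral_const_mul' _ _ (by finiteness)]
    refine lintegral_congr fun t ↦ ?_
    rw [← ENNReal.ofReal_mul (by positivity), ← ENNReal.ofReal_mul (by positivity), inv_pow,
      Real.sq_sqrt hc'.le]
    congr 1
    field_simp
  rw [← hE]
  refine iInf₂_le _ ⟨ac.const_smul (√c)⁻¹, by simp [hh.2.1], fun t ht ↦ ?_⟩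
  have := hh.2.2 (c * t) (by rw [le_div_iff₀ hc'] at ht; push_cast; linarith)
  rw [scalePath, ← mul_sub, abs_mul, abs_of_nonneg (by positivity : 0 ≤ (√(c : ℝ))⁻¹),
    inv_mul_eq_div]
  push_cast at this
  gcongr

lemma minNorm_scalePath {c : ℝ≥0} (hc : 0 < c) (w : ℝ≥0 → ℝ) {T : ℝ} (hT : 0 ≤ T) (r : ℝ) :
    minNorm (scalePath c w) (T / c) (r / √c) = minNorm w T r := by
  have hc' : (0 : ℝ) < c := hc
  refine le_antisymm (minNorm_scalePath_le hc w hT r) ?_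
  have h := minNorm_scalePath_le (inv_pos.2 hc) (scalePath c w) (T := T / c) (by positivity) (r / √c)
  have e1 : scalePath c⁻¹ (scalePath c w) = w := by
    ext t
    have : √(c : ℝ) ≠ 0 := by positivity
    simp only [scalePath, NNReal.coe_inv, Real.sqrt_inv, inv_inv]
    rw [mul_inv_cancel_left₀ this, mul_inv_cancel_left₀ hc.ne']
  have e2 : T / c / ((c⁻¹ : ℝ≥0) : ℝ) = T := by
    push_cast; field_simp
  have e3 : r / √c / √((c⁻¹ : ℝ≥0) : ℝ) = r := by
    have : √(c : ℝ) ≠ 0 := by positivity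
    rw [NNReal.coe_inv, Real.sqrt_inv]; field_simp
  rwa [e1, e2, e3] at h

lemma minNorm_eq_unit_tube {w : ℝ≥0 → ℝ} (h0 : w 0 = 0) (T : ℝ≥0) {r : ℝ≥0} (hr : 0 < r) :
    minNorm w T r = tubeEnergy {0} (scalePath (r ^ 2) w) (T / r ^ 2) 1 ^ (1 / 2 : ℝ) := by
  rw [← minNorm_eq (by simp [scalePath, h0]), ← minNorm_scalePath (c := r ^ 2) (by positivity) w
    T.coe_nonneg]
  have : (0 : ℝ) < r := hr
  push_cast
  rw [Real.sqrt_sq this.le, div_self this.ne']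

lemma toReal_minNorm {w : ℝ≥0 → ℝ} (h0 : w 0 = 0) (T : ℝ≥0) {r : ℝ≥0} (hr : 0 < r) :
    (minNorm w T r).toReal = √(tubeEnergy {0} (scalePath (r ^ 2) w) (T / r ^ 2) 1).toReal := by
  rw [minNorm_eq_unit_tube h0 T hr, ← ENNReal.toReal_rpow, Real.sqrt_eq_rpow]

lemma IsNiceBrownian.scalePath (hW : IsNiceBrownian W P) {c : ℝ≥0} (hc : c ≠ 0) :
    IsNiceBrownian (fun t ω ↦ scalePath c (W · ω) t) P := hW.smul hc

lemma abs_sqrt_sub_sqrt_le {a b : ℝ} (ha : 0 ≤ a) (hb : 0 ≤ b) :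
    |√a - √b| ≤ |a - b| ^ (1 / 2 : ℝ) := by
  rw [← Real.sqrt_eq_rpow]
  refine Real.le_sqrt_of_sq_le ?_
  have h1 : a - b = (√a - √b) * (√a + √b) := by
    nlinarith [Real.sq_sqrt ha, Real.sq_sqrt hb]
  have h2 : |√a - √b| ≤ √a + √b := by
    rw [abs_le]
    constructor <;> linarith [Real.sqrt_nonneg a, Real.sqrt_nonneg b]
  rw [h1, abs_mul, abs_of_nonneg (add_nonneg (Real.sqrt_nonneg a) (Real.sqrt_nonneg b)), sq]
  gcongr

/-- The square root is 1/2-Hölder, so convergence of the energies in L_p gives convergence of the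
norms in L_(2p). -/
lemma eLpNorm_sqrt_sub_sqrt_le [IsProbabilityMeasure P] {X : Ω → ℝ} (hX : Measurable X)
    (hX0 : ∀ ω, 0 ≤ X ω) {c : ℝ} (hc : 0 ≤ c) {q : ℝ} {p : ℕ} (hq : q ≤ 2 * p) :
    eLpNorm (fun ω ↦ √(X ω) - √c) (ENNReal.ofReal q) P ≤
      eLpNorm (fun ω ↦ X ω - c) p P ^ (1 / 2 : ℝ) := by
  have h1 : ENNReal.ofReal q ≤ 2 * p := by
    refine (ENNReal.ofReal_le_ofReal hq).trans_eq ?_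
    rw [ENNReal.ofReal_mul (by norm_num)]
    simp
  have h2 : (2 * p : ℝ≥0∞) * ENNReal.ofReal (1 / 2) = p := by
    rw [one_div, ENNReal.ofReal_inv_of_pos (by norm_num), mul_comm 2, mul_assoc]
    simp [ENNReal.mul_inv_cancel]
  refine (eLpNorm_le_eLpNorm_of_exponent_le h1 (by fun_prop)).trans ?_
  have h3 := eLpNorm_norm_rpow (p := 2 * p) (q := 1 / 2) (μ := P) (fun ω ↦ X ω - c) (by norm_num)
  rw [h2] at h3
  rw [← h3]
  refine eLpNorm_mono_real fun ω ↦ ?_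
  simpa only [Real.norm_eq_abs] using abs_sqrt_sub_sqrt_le (hX0 ω) hc

lemma MemLp.sqrt [IsFiniteMeasure P] {X : Ω → ℝ} (hX0 : ∀ ω, 0 ≤ X ω) {p : ℝ≥0∞}
    (hX : MemLp X p P) : MemLp (fun ω ↦ √(X ω)) p P := by
  have hg : MemLp (fun ω ↦ 1 + X ω) p P := MemLp.add (f := fun _ ↦ (1 : ℝ)) (memLp_const _) hX
  refine MemLp.mono hg
    (Real.continuous_sqrt.comp_aestronglyMeasurable hX.1) (ae_of_all _ fun ω ↦ ?_)
  have h0 : 0 ≤ 1 + X ω := by linarith [hX0 ω]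
  have h1 : √(X ω) ≤ 1 + X ω := by
    nlinarith [Real.sq_sqrt (hX0 ω), Real.sqrt_nonneg (X ω), sq_nonneg (√(X ω) - 1)]
  change ‖√(X ω)‖ ≤ ‖1 + X ω‖
  rwa [Real.norm_of_nonneg (Real.sqrt_nonneg _), Real.norm_of_nonneg h0]

lemma isEnergyConstant_of_isNiceBrownian (hW : IsNiceBrownian W P) {c : ℝ} (hc0 : 0 ≤ c)
    (hc : Tendsto (fun n : ℕ ↦ meanEnergy W P n / n) atTop (𝓝 c)) :
    IsEnergyConstant W P √c := by
  have hP := hW.isProbabilityMeasure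
  refine ⟨fun T hT r hr ↦ ?_, fun q hq ↦ ⟨fun T hT r hr ↦ ?_, fun δ hδ ↦ ?_⟩⟩
  · lift T to ℝ≥0 using hT.le
    lift r to ℝ≥0 using hr.le
    have hr' : 0 < r := hr
    have hT' : 0 < T := hT
    filter_upwards [(tubeEnergy_moments (hW.scalePath (c := r ^ 2) (by positivity))
      (T := T / r ^ 2) (by positivity) one_ne_zero).2] with ω hω
    rw [minNorm_eq_unit_tube (hW.zero ω) T hr]
    exact ENNReal.rpow_lt_top_of_nonneg (by norm_num) hω.ne
  · lift T to ℝ≥0 using hT.le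
    lift r to ℝ≥0 using hr.le
    have hr' : 0 < r := hr
    have hT' : 0 < T := hT
    obtain ⟨p, hp⟩ := exists_nat_gt q
    have hp0 : p ≠ 0 := by rintro rfl; simp at hp; linarith
    simp only [fun ω ↦ toReal_minNorm (w := (W · ω)) (hW.zero ω) T hr]
    refine MemLp.mono_exponent (q := (p : ℝ≥0∞)) (MemLp.sqrt (fun _ ↦ ENNReal.toReal_nonneg)
      (tubeEnergy_moments (hW.scalePath (c := r ^ 2) (by positivity))
      (T := T / r ^ 2) (by positivity) hp0).1) ?_
    rw [← ENNReal.ofReal_natCast]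
    exact ENNReal.ofReal_le_ofReal hp.le
  · obtain ⟨p, hp⟩ := exists_nat_gt q
    have hp0 : p ≠ 0 := by rintro rfl; simp at hp; linarith
    have hlim := tendsto_eLpNorm_energy hW hc0 hc hp0
    -- The accuracy is δ² for the energy because a square root is taken at the end.
    obtain ⟨T₀, hT₀⟩ := eventually_atTop.1 (ENNReal.tendsto_nhds_zero.1 hlim
      (ENNReal.ofReal (δ ^ 2)) (by simp [hδ]))
    -- As r / √T = S^(-1/2) with S = T / r², smallness of the ratio means that S exceeds T₀; adding
    -- 1 avoids a zero denominator.
    refine ⟨(√(T₀ + 1 : ℝ))⁻¹, by positivity, fun T hT r hr hrT ↦ ?_⟩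
    lift T to ℝ≥0 using hT.le
    lift r to ℝ≥0 using hr.le
    have hr' : 0 < r := hr
    have hT' : 0 < T := hT
    set S : ℝ≥0 := T / r ^ 2 with hS
    have hS0 : 0 < S := by positivity
    have hrS : (r : ℝ) / √T = (√S)⁻¹ := by
      rw [hS]
      push_cast
      rw [Real.sqrt_div hT.le, Real.sqrt_sq hr.le, inv_div]
    have hTS : T₀ ≤ S := by
      rw [hrS, inv_lt_inv₀ (by positivity) (by positivity),
        Real.sqrt_lt_sqrt_iff (by positivity)] at hrT
      have : (T₀ : ℝ) ≤ S := by linarith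
      exact_mod_cast this
    have hV := hW.scalePath (c := r ^ 2) (by positivity)
    have hpf := isPathFunctional_tubeEnergy_zero hS0 one_pos
    have e : ∀ ω, (r : ℝ) / √T * (minNorm (W · ω) T r).toReal - √c =
        √((tubeEnergy {0} (scalePath (r ^ 2) (W · ω)) S 1).toReal / S) - √c := by
      intro ω
      rw [toReal_minNorm (hW.zero ω) T hr, hrS, Real.sqrt_div' _ S.coe_nonneg, inv_mul_eq_div]
    simp only [e]
    refine (eLpNorm_sqrt_sub_sqrt_le (p := p)
      ((hpf.measurable hV).ennreal_toReal.div_const _) (fun ω ↦ by positivity) hc0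
      (by linarith)).trans ?_
    have hid : IdentDistrib
        (fun ω ↦ (tubeEnergy {0} (scalePath (r ^ 2) (W · ω)) S 1).toReal / S - c)
        (fun ω ↦ (tubeEnergy {0} (W · ω) S 1).toReal / S - c) P P :=
      (hpf.identDistrib hV hW).comp (u := fun x : ℝ≥0∞ ↦ x.toReal / S - c) (by fun_prop)
    rw [hid.eLpNorm_eq]
    refine (ENNReal.rpow_le_rpow (hT₀ S hTS) (by norm_num)).trans_eq ?_
    rw [ENNReal.ofReal_rpow_of_nonneg (by positivity) (by norm_num), ← Real.sqrt_eq_rpow,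
      Real.sqrt_sq hδ.le]

lemma IsEnergyConstant.congr {V : ℝ≥0 → Ω → ℝ} {C : ℝ} (h : IsEnergyConstant V P C)
    (hVW : ∀ᵐ ω ∂P, ∀ t, V t ω = W t ω) : IsEnergyConstant W P C := by
  have e : ∀ T r : ℝ, ∀ᵐ ω ∂P, minNorm (V · ω) T r = minNorm (W · ω) T r := fun T r ↦ by
    filter_upwards [hVW] with ω hω
    rw [funext hω]
  refine ⟨fun T hT r hr ↦ ?_, fun q hq ↦ ⟨fun T hT r hr ↦ ?_, fun δ hδ ↦ ?_⟩⟩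
  · filter_upwards [h.1 T hT r hr, e T r] with ω h1 h2
    rwa [← h2]
  · refine ((h.2 q hq).1 T hT r hr).ae_eq ?_
    filter_upwards [e T r] with ω h2
    rw [h2]
  · obtain ⟨η, hη, H⟩ := (h.2 q hq).2 δ hδ
    refine ⟨η, hη, fun T hT r hr hrT ↦ le_trans (le_of_eq (eLpNorm_congr_ae ?_)) (H T hT r hr hrT)⟩
    filter_upwards [e T r] with ω h2
    rw [h2]

/-- This is why the constant does not depend on the Brownian motion or its probability space. -/
lemma meanEnergy_congr {Ω' : Type*} {mΩ' : MeasurableSpace Ω'} {Q : Measure Ω'}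
    {V : ℝ≥0 → Ω' → ℝ} (hW : IsNiceBrownian W P) (hV : IsNiceBrownian V Q) (n : ℕ) :
    meanEnergy W P n = meanEnergy V Q n :=
  (((isPathFunctional_tubeEnergy_univ' (n : ℝ≥0) one_pos).identDistrib hW hV).comp
    ENNReal.measurable_toReal).integral_eq

/-! ### The lower bound by the range. -/

/-- Between the times of the minimum and maximum of the path, a function in the tube changes by at
least the range minus 2x, and Cauchy–Schwarz over a time of at most 1 bounds its energy from below.
-/
lemma excess_sq_le_tubeEnergy {w : ℝ≥0 → ℝ} (hw : Continuous w) (x : ℝ) :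
    ENNReal.ofReal (excess w x ^ 2) ≤ tubeEnergy Set.univ w 1 x := by
  refine le_iInf₂ fun h hh ↦ ?_
  obtain ⟨s, hs, hs'⟩ := (isCompact_Icc (a := (0 : ℝ≥0)) (b := 1)).exists_isMaxOn
    ⟨0, by simp⟩ hw.continuousOn
  obtain ⟨t, ht, ht'⟩ := (isCompact_Icc (a := (0 : ℝ≥0)) (b := 1)).exists_isMinOn
    ⟨0, by simp⟩ hw.continuousOn
  have hne : Nonempty (Set.Icc (0 : ℝ≥0) 1) := ⟨0, by simp⟩
  have h1 : range w ≤ w s - w t :=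
    sub_le_sub (ciSup_le fun u ↦ hs' u.2) (le_ciInf fun u ↦ ht' u.2)
  have h2 := abs_le.1 (hh.1.2 s hs.2)
  have h3 := abs_le.1 (hh.1.2 t ht.2)
  have hE := sq_sub_le_energy (s := (t : ℝ)) (t := (s : ℝ)) hh.1.1
    ⟨t.coe_nonneg, by exact_mod_cast ht.2⟩ ⟨s.coe_nonneg, by exact_mod_cast hs.2⟩
  simp only [NNReal.coe_one, ENNReal.ofReal_one, one_mul] at hE ⊢
  refine le_trans (ENNReal.ofReal_le_ofReal ?_) hE
  rcases le_total (range w - 2 * x) 0 with h4 | h4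
  · rw [excess, max_eq_right h4]
    simpa using sq_nonneg _
  · rw [excess, max_eq_left h4]
    exact pow_le_pow_left₀ h4 (by linarith) 2

lemma memLp_pathMax (hW : IsNiceBrownian W P) : MemLp (fun ω ↦ pathMax (W · ω)) 2 P := by
  have h1 : MemLp (fun z : ℝ ↦ |z|) 2 (gaussianReal 0 1) := by
    have : MemLp (id : ℝ → ℝ) 2 (gaussianReal 0 1) := memLp_id_gaussianReal 2
    exact this.norm
  have h2 : MemLp (id : ℝ → ℝ) 2 ((gaussianReal 0 1).map fun z ↦ |z|) :=
    (memLp_map_measure_iff aestronglyMeasurable_id (by fun_prop)).2 h1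
  rw [← map_pathMax hW] at h2
  exact (memLp_map_measure_iff aestronglyMeasurable_id (measurable_pathMax hW).aemeasurable).1 h2

lemma measurable_excess (hW : IsNiceBrownian W P) (x : ℝ) :
    Measurable fun ω ↦ excess (W · ω) x :=
  ((measurable_range hW).sub_const _).max measurable_const

lemma excess_nonneg (w : ℝ≥0 → ℝ) (x : ℝ) : 0 ≤ excess w x := le_max_right _ _

lemma memLp_excess (hW : IsNiceBrownian W P) {x : ℝ} (hx : 0 < x) :
    MemLp (fun ω ↦ excess (W · ω) x) 2 P := by
  refine ((memLp_pathMax hW).add (memLp_pathMax hW.neg)).mono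
    (measurable_excess hW x).aestronglyMeasurable (ae_of_all _ fun ω ↦ ?_)
  have h1 : range (W · ω) = pathMax (W · ω) + pathMax ((-W) · ω) := range_eq_pathMax _
  have h2 := pathMax_nonneg (hW.cont ω) (hW.zero ω)
  have h3 := pathMax_nonneg (hW.neg.cont ω) (hW.neg.zero ω)
  rw [Pi.add_apply, Real.norm_of_nonneg (excess_nonneg _ _), Real.norm_of_nonneg (add_nonneg h2 h3),
    excess, h1]
  exact max_le (by linarith) (add_nonneg h2 h3)

lemma integral_excess_sq_pos (hW : IsNiceBrownian W P) {x : ℝ} (hx : 0 < x) :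
    0 < ∫ ω, excess (W · ω) x ^ 2 ∂P := by
  rw [integral_pos_iff_support_of_nonneg (fun ω ↦ sq_nonneg _) (memLp_excess hW hx).integrable_sq]
  refine lt_of_lt_of_le ?_ (measure_mono (s := W 1 ⁻¹' Set.Ioi (2 * x)) fun ω hω ↦ ?_)
  · rw [← Measure.map_apply (hW.meas 1) measurableSet_Ioi, (hW.hasLaw_eval 1).map_eq,
      pos_iff_ne_zero]
    intro h
    have := gaussianReal_absolutelyContinuous' 0 one_ne_zero h
    simp at this
  · have h1 : range (W · ω) = pathMax (W · ω) + pathMax ((-W) · ω) := range_eq_pathMax _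
    have h2 : W 1 ω ≤ pathMax (W · ω) := le_pathMax (hW.cont ω) le_rfl
    have h3 := pathMax_nonneg (hW.neg.cont ω) (hW.neg.zero ω)
    have h4 : 2 * x < W 1 ω := hω
    have h5 : 0 < excess (W · ω) x := lt_max_of_lt_left (by linarith)
    exact (pow_pos h5 2).ne'

lemma tubeEnergy_eq_scalePath {w : ℝ≥0 → ℝ} (h0 : w 0 = 0) (T : ℝ≥0) {r : ℝ≥0} (hr : 0 < r) :
    tubeEnergy {0} (scalePath (r ^ 2) w) (T / r ^ 2) 1 = tubeEnergy {0} w T r := by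
  have h := (minNorm_eq_unit_tube h0 T hr).symm.trans (minNorm_eq h0 T r)
  exact ENNReal.rpow_left_injective (by norm_num : (1 / 2 : ℝ) ≠ 0) h

/-- The tube of radius x over n unit blocks costs at least the sum of the block excesses squared;
scaling by x² makes it the unit tube over time n / x². Dividing by this time gives x² E Y_x² in the
limit. -/
lemma mul_integral_excess_sq_le (hW : IsNiceBrownian W P) {x : ℝ≥0} (hx : 0 < x) {n : ℕ}
    (hn : n ≠ 0) : n * ∫ ω, excess (W · ω) x ^ 2 ∂P ≤
      ∫ ω, (tubeEnergy {0} (W · ω) (n / x ^ 2) 1).toReal ∂P := by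
  have hn0 : 0 < n := Nat.pos_of_ne_zero hn
  have hS : 0 < (n : ℝ≥0) / x ^ 2 := by positivity
  have hpf := isPathFunctional_tubeEnergy_zero hS one_pos
  have hx' : (0 : ℝ) < x := hx
  have hpf1 := isPathFunctional_tubeEnergy_univ' 1 hx'
  obtain ⟨hm, hf⟩ := tubeEnergy_moments hW hS one_ne_zero
  rw [Nat.cast_one, memLp_one_iff_integrable] at hm
  rw [← ENNReal.ofReal_le_ofReal_iff (integral_nonneg fun _ ↦ ENNReal.toReal_nonneg),
    ENNReal.ofReal_mul n.cast_nonneg, ENNReal.ofReal_natCast,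
    ofReal_integral_eq_lintegral_ofReal hm (ae_of_all _ fun _ ↦ ENNReal.toReal_nonneg),
    ofReal_integral_eq_lintegral_ofReal (memLp_excess hW hx').integrable_sq
      (ae_of_all _ fun _ ↦ sq_nonneg _)]
  calc (n : ℝ≥0∞) * ∫⁻ ω, ENNReal.ofReal (excess (W · ω) x ^ 2) ∂P
      ≤ n * ∫⁻ ω, tubeEnergy Set.univ (W · ω) 1 x ∂P := by
        gcongr with ω
        exact excess_sq_le_tubeEnergy (hW.cont ω) x
    _ = ∫⁻ ω, ∑ i ∈ Finset.range n, tubeEnergy Set.univ (shiftPath (i * 1) (W · ω)) 1 x ∂P := by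
        rw [lintegral_finsetSum']
        · simp [hpf1.lintegral_shift hW]
        · exact fun i _ ↦ (hpf1.identDistrib_shift hW _).aemeasurable_fst
    _ ≤ ∫⁻ ω, tubeEnergy {0} (W · ω) n x ∂P := by
        refine lintegral_mono fun ω ↦ ?_
        simpa using sum_tubeEnergy_le {0} (W · ω) 1 x n
    _ = ∫⁻ ω, tubeEnergy {0} (scalePath (x ^ 2) (W · ω)) (n / x ^ 2) 1 ∂P := by
        simp only [fun ω ↦ tubeEnergy_eq_scalePath (w := (W · ω)) (hW.zero ω) n hx]
    _ = ∫⁻ ω, tubeEnergy {0} (W · ω) (n / x ^ 2) 1 ∂P :=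
        (hpf.identDistrib (hW.scalePath (c := x ^ 2) (by positivity)) hW).lintegral_eq
    _ = ∫⁻ ω, ENNReal.ofReal (tubeEnergy {0} (W · ω) (n / x ^ 2) 1).toReal ∂P := by
        refine lintegral_congr_ae ?_
        filter_upwards [hf] with ω hω
        rw [ENNReal.ofReal_toReal hω.ne]

lemma integral_excess_sq_le (hW : IsNiceBrownian W P) {c : ℝ} (hc0 : 0 ≤ c)
    (hc : Tendsto (fun n : ℕ ↦ meanEnergy W P n / n) atTop (𝓝 c)) {x : ℝ} (hx : 0 < x) :
    x ^ 2 * ∫ ω, excess (W · ω) x ^ 2 ∂P ≤ c := by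
  have hP := hW.isProbabilityMeasure
  lift x to ℝ≥0 using hx.le
  have hx' : 0 < x := hx
  have h1 := tendsto_eLpNorm_energy hW hc0 hc one_ne_zero
  rw [Nat.cast_one] at h1
  have h2 : Tendsto (fun n : ℕ ↦ (n : ℝ≥0) / x ^ 2) atTop atTop :=
    tendsto_natCast_atTop_atTop.atTop_div_const (by positivity)
  have h3 := tendsto_integral_of_L1' (μ := P) (fun _ ↦ c) aestronglyMeasurable_const
    (F := fun (n : ℕ) ω ↦ (tubeEnergy {0} (W · ω) ((n : ℝ≥0) / x ^ 2) 1).toReal / ((n : ℝ≥0) / x ^ 2 : ℝ≥0))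
    (l := atTop) ?_ (h1.comp h2)
  · rw [integral_const, probReal_univ, one_smul] at h3
    refine ge_of_tendsto h3 ?_
    filter_upwards [eventually_ne_atTop 0] with n hn
    have hn' : (0 : ℝ) < n := by exact_mod_cast Nat.pos_of_ne_zero hn
    rw [integral_div, le_div_iff₀ (by positivity)]
    refine le_trans (le_of_eq ?_) (mul_integral_excess_sq_le hW hx' hn)
    push_cast
    field_simp
  · filter_upwards [eventually_ne_atTop 0] with n hn
    have hn0 : 0 < n := Nat.pos_of_ne_zero hn
    have := (tubeEnergy_moments hW (T := (n : ℝ≥0) / x ^ 2) (by positivity) one_ne_zero).1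
    rw [Nat.cast_one, memLp_one_iff_integrable] at this
    exact this.div_const _

lemma integral_excess_sq_eq (hW : IsNiceBrownian W P) {x : ℝ} (hx : 0 < x) :
    ENNReal.ofReal (∫ ω, excess (W · ω) x ^ 2 ∂P) =
      ∫⁻ ω, ENNReal.ofReal (range (W · ω) - 2 * x) ^ 2 ∂P := by
  rw [ofReal_integral_eq_lintegral_ofReal (memLp_excess hW hx).integrable_sq
    (ae_of_all _ fun _ ↦ sq_nonneg _)]
  refine lintegral_congr fun ω ↦ ?_
  rw [ENNReal.ofReal_pow (excess_nonneg _ _), excess, ENNReal.ofReal_max, ENNReal.ofReal_zero,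
    max_eq_left zero_le]

lemma excess_numeric (hW : IsNiceBrownian W P) :
    0.381 ≤ 0.488 * √(∫ ω, excess (W · ω) 0.488 ^ 2 ∂P) ∧
      0.488 * √(∫ ω, excess (W · ω) 0.488 ^ 2 ∂P) ≤ 0.3815 := by
  obtain ⟨h1, h2⟩ := lintegral_sq_range_sub_numeric hW
  have h3 := integral_excess_sq_eq hW (x := 0.488) (by norm_num)
  rw [show (2 * 0.488 : ℝ) = 0.976 by norm_num] at h3
  rw [← h3] at h1 h2
  have h0 := integral_excess_sq_pos hW (x := 0.488) (by norm_num)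
  rw [ENNReal.ofReal_le_ofReal_iff h0.le] at h1
  rw [ENNReal.ofReal_le_ofReal_iff (by norm_num)] at h2
  set E := ∫ ω, excess (W · ω) 0.488 ^ 2 ∂P
  have l : 0.381 / 0.488 ≤ √E := Real.le_sqrt_of_sq_le (by norm_num at h1 ⊢; linarith)
  have u : √E ≤ 0.3815 / 0.488 := Real.sqrt_le_iff.2 ⟨by norm_num, by norm_num at h2 ⊢; linarith⟩
  constructor
  · linarith
  · linarith

-- The universal constant and the conclusion.

universe u

/-- A constant with all the required properties for the Brownian motions in a given universe. -/
lemma exists_energyConstant : ∃ C : ℝ, 0 < C ∧ 0.381 ≤ C ∧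
    ∀ (Ω : Type u) [MeasurableSpace Ω] (P : Measure Ω) (W : ℝ≥0 → Ω → ℝ), IsNiceBrownian W P →
      IsEnergyConstant W P C ∧
        ∀ x : ℝ, 0 < x → x ^ 2 * ∫ ω, excess (W · ω) x ^ 2 ∂P ≤ C ^ 2 := by
  -- The constant is read off from one Brownian motion; were there none in this universe, any number
  -- of sufficient size would do.
  by_cases h : ∃ (Ω : Type u) (_ : MeasurableSpace Ω) (P : Measure Ω) (W : ℝ≥0 → Ω → ℝ),
    IsNiceBrownian W P
  · obtain ⟨Ω, _, P, W, hW⟩ := h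
    obtain ⟨c, hc0, hc⟩ := exists_tendsto_meanEnergy hW
    have hsq : √c ^ 2 = c := Real.sq_sqrt hc0
    have h1 := integral_excess_sq_le hW hc0 hc (x := 0.488) (by norm_num)
    have h2 : 0.381 ≤ √c := by
      refine (excess_numeric hW).1.trans (Real.le_sqrt_of_sq_le ?_)
      rwa [mul_pow, Real.sq_sqrt (integral_excess_sq_pos hW (by norm_num)).le]
    refine ⟨√c, by linarith, h2, fun Ω' _ Q V hV ↦ ?_⟩
    simp only [meanEnergy_congr hW hV] at hc
    rw [hsq]
    exact ⟨isEnergyConstant_of_isNiceBrownian hV hc0 hc, fun x hx ↦ integral_excess_sq_le hV hc0 hc hx⟩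
  · exact ⟨1, by norm_num, by norm_num, fun Ω _ P W hW ↦ (h ⟨Ω, _, P, W, hW⟩).elim⟩

end

end TautString

theorem mainTheorem4 :
    ∃ C : ℝ, 0 < C ∧ 0.381 ≤ C ∧
      ∀ (Ω : Type*) [MeasurableSpace Ω] (P : Measure Ω) (W : ℝ≥0 → Ω → ℝ),
        IsBrownianReal W P →
          TautString.IsEnergyConstant W P C ∧
          (∀ x : ℝ, 0 < x →
            MemLp (fun ω ↦ TautString.excess (W · ω) x) 2 P ∧
            0 < x ^ 2 * ∫ ω, TautString.excess (W · ω) x ^ 2 ∂P ∧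
            x ^ 2 * ∫ ω, TautString.excess (W · ω) x ^ 2 ∂P ≤ C ^ 2) ∧
          ∃ x : ℝ, |x - 0.5| ≤ 0.05 ∧
            0.381 ≤ x * √(∫ ω, TautString.excess (W · ω) x ^ 2 ∂P) ∧
            x * √(∫ ω, TautString.excess (W · ω) x ^ 2 ∂P) ≤ 0.3815 := by
  obtain ⟨C, hC0, hC, H⟩ := TautString.exists_energyConstant
  refine ⟨C, hC0, hC, fun Ω _ P W hW ↦ ?_⟩
  -- All claims are unaffected by changing whole paths on a null set.
  obtain ⟨V, hV, hVW⟩ := TautString.exists_isNiceBrownian hW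
  obtain ⟨h1, h2⟩ := H Ω P V hV
  have hE : ∀ x, (fun ω ↦ TautString.excess (V · ω) x) =ᵐ[P]
      fun ω ↦ TautString.excess (W · ω) x := fun x ↦ by
    filter_upwards [hVW] with ω hω
    rw [funext hω]
  have hI : ∀ x, ∫ ω, TautString.excess (W · ω) x ^ 2 ∂P =
      ∫ ω, TautString.excess (V · ω) x ^ 2 ∂P := fun x ↦
    integral_congr_ae ((hE x).symm.fun_comp (· ^ 2))
  refine ⟨h1.congr hVW, fun x hx ↦ ⟨(TautString.memLp_excess hV hx).ae_eq (hE x), ?_, ?_⟩,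
    0.488, by norm_num [abs_le], ?_⟩
  · rw [hI]
    exact mul_pos (by positivity) (TautString.integral_excess_sq_pos hV hx)
  · rw [hI]
    exact h2 x hx
  · rw [hI]
    exact TautString.excess_numeric hV
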